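/- Let $D\in\mathbb N$ be a non-square discriminant, that is, $D\equiv 0,1 \pmod 4$ and $D$ is not a square. Put $K=\mathbb Q(\sqrt D)$ with Galois conjugation $\sigma$ and ring of integers $\mathcal O_K$, and let $\mathcal O_D=\mathbb Z\oplus\mathbb Z\,\tfrac{D+\sqrt D}{2}$ be the quadratic order of discriminant $D$, with conductor $f=[\mathcal O_K:\mathcal O_D]$. Let $d_1\mid d_2$ be positive integers such that $d_2/d_1$ is relatively prime to $f$. A polarized abelian surface of type $(d_1,d_2)$ with real multiplication by $\mathcal O_D$ is a triple $(A,H,\rho)$ consisting of a complex torus $A=\mathbb C^2/\Lambda$, a positive definite Hermitian form $H$ on $\mathbb C^2$ such that $E=\operatorname{Im}H$ is integer-valued on $\Lambda$ and has the matrix $\begin{pmatrix}0&\Delta\\-\Delta&0\end{pmatrix}$, $\Delta=\operatorname{diag}(d_1,d_2)$, in some $\mathbb Z$-basis of $\Lambda$, and an injective ring homomorphism $\rho:\mathcal O_D\hookrightarrow\operatorname{End}(A)$ with $H(\rho(x)v,w)=H(v,\rho(x)w)$ that does not extend to an injective ring homomorphism $\mathcal O\hookrightarrow\operatorname{End}(A)$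 for any order $\mathcal O\supsetneq\mathcal O_D$ of $K$. Isomorphisms of triples are isomorphisms of tori that preserve the Hermitian forms and commute with the actions of $\mathcal O_D$. Let $X_{D,(d_1,d_2)}$ be the moduli space of isomorphism classes $[(A,H,\rho)]$. Its analytic structure is the one of a coarse moduli space: a subset is open, respectively a function on an open subset is holomorphic, if and only if its pullback along the classifying map of every holomorphic family of triples is so. Irreducible components are maximal irreducible analytic subsets. The pair $(d_1,d_2)$ satisfies the prime factor condition in $\mathcal O_D$ if no prime divisor of $d_2/d_1$ is inert in $K$, and every prime divisor of $d_2/d_1$ that is ramified in $K$ divides $d_2/d_1$ exactly once. For an ideal $\mathfrak a\subseteq\mathcal O_D$ consider on $\mathcal O_D\oplus\tfrac1{\sqrt D}\mathfrak a$ the trace pairing $\langle(x,y),(\tilde x,\tilde y)\rangle=\operatorname{tr}_{K/\mathbb Q}(\tilde x y-x\tilde y)$, and suppose that it is of type $(d_1,d_2)$. For $z=(z_1,z_2)\in\mathbb H^2$ let $(A_z,H_z,\rho_z)$ be the triple with lattice the image of $\mathcal O_D\oplus\tfrac1{\sqrt D}\mathfrak a$ under $\phi_z(x,y)=(x+yz_1,\;x^\sigma+y^\sigma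 z_2)$, with $\operatorname{Im}H_z(\phi_z(u),\phi_z(v))=\langle u,v\rangle$, and with $\rho_z(k)(c_1,c_2)=(kc_1,k^\sigma c_2)$. Let $X_{\mathfrak a}\subseteq X_{D,(d_1,d_2)}$ be the locus of all $[(A_z,H_z,\rho_z)]$, $z\in\mathbb H^2$. Writing $I=\tfrac1{\sqrt D}\mathfrak a$ and $I^{-1}=\{x\in K: xI\subseteq\mathcal O_D\}$, let $$\mathrm{SL}_2(\mathcal O_D\oplus I)=\mathrm{SL}_2(K)\cap\begin{pmatrix}\mathcal O_D&I^{-1}\\ I&\mathcal O_D\end{pmatrix},\qquad \mathrm{PSL}_2(\mathcal O_D\oplus I)=\mathrm{SL}_2(\mathcal O_D\oplus I)/\{\pm1\},$$ acting on $\mathbb H^2$ by $M(z_1,z_2)=(Mz_1,M^\sigma z_2)$. **Theorem.** The space $X_{D,(d_1,d_2)}$ is non-empty if and only if $(d_1,d_2)$ satisfies the prime factor condition in $\mathcal O_D$. In this case its irreducible components are exactly the loci $X_{\mathfrak a}$, where $\mathfrak a$ runs through the ideals of $\mathcal O_D$ for which the trace pairing on $\mathcal O_D\oplus\tfrac1{\sqrt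 D}\mathfrak a$ is of type $(d_1,d_2)$. There are exactly $2^s$ of them, where $s$ is the number of prime divisors of $d_2/d_1$ that split in $K$; they are open, loci of distinct ideals are disjoint, and their union is $X_{D,(d_1,d_2)}$. For each such $\mathfrak a$ there is an isomorphism of analytic spaces $$\Phi:\ \mathrm{PSL}_2\bigl(\mathcal O_D\oplus\tfrac1{\sqrt D}\mathfrak a\bigr)\backslash\mathbb H^2\ \xrightarrow{\ \sim\ }\ X_{\mathfrak a},\qquad [z]\mapsto[(A_z,H_z,\rho_z)],$$ that is, a homeomorphism under which the holomorphic functions on open subsets correspond (those on the quotient being the functions with holomorphic pullback to $\mathbb H^2$). -/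

import Mathlib

open scoped UpperHalfPlane MatrixGroups ComplexConjugate

namespace RealMult

noncomputable section

/-! ### The real quadratic field, its orders, and the prime factor condition -/

/-- The field `K = ℚ(√D)`: the element `⟨a, b⟩` is `a + b √D`.
The Galois conjugation is `star` and the trace is `QuadraticAlgebra.trace`. -/
abbrev K (D : ℕ) : Type := QuadraticAlgebra ℚ (D : ℚ) 0

/-- The element `γ = (D + √D) / 2`. -/
def gam (D : ℕ) : K D := ⟨(D : ℚ) / 2, 1 / 2⟩

/-- The element `1 / √D`. -/
def invSqrt (D : ℕ) : K D := ⟨0, 1 / (D : ℚ)⟩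

/-- The quadratic order `𝓞_D = ℤ[γ]` of discriminant `D`. -/
def quadOrder (D : ℕ) : Subring (K D) := Subring.closure {gam D}

/-- For a discriminant `D`, the order `𝓞_D` is `ℤ + ℤ γ`. -/
theorem mem_quadOrder_iff {D : ℕ} (hD : D % 4 = 0 ∨ D % 4 = 1) (x : K D) :
    x ∈ quadOrder D ↔ ∃ a b : ℤ, x = (a : K D) + (b : K D) * gam D := by
  constructor
  · intro hx
    obtain ⟨k, hk⟩ : ∃ k : ℤ, (D : ℤ) - (D : ℤ) ^ 2 = 4 * k := by
      have h4 : ((D : ℤ) - (D : ℤ) ^ 2) % 4 = 0 := by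
        have h : (D : ℤ) % 4 = 0 ∨ (D : ℤ) % 4 = 1 := by omega
        rcases h with h | h <;> simp [pow_two, Int.sub_emod, Int.mul_emod, h]
      exact ⟨((D : ℤ) - (D : ℤ) ^ 2) / 4, by omega⟩
    have hkq : (D : ℚ) - (D : ℚ) ^ 2 = 4 * (k : ℚ) := by exact_mod_cast hk
    have hgam : gam D * gam D = (k : K D) + ((D : ℤ) : K D) * gam D := by
      ext
      · simp [gam]; linarith
      · simp [gam]; ring
    induction hx using Subring.closure_induction with
    | mem x hx => exact ⟨0, 1, by simpa using hx⟩
    | zero => exact ⟨0, 0, by simp⟩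
    | one => exact ⟨1, 0, by simp⟩
    | add x y _ _ hx hy =>
      obtain ⟨a, b, rfl⟩ := hx
      obtain ⟨c, d, rfl⟩ := hy
      exact ⟨a + c, b + d, by push_cast; ring⟩
    | neg x _ hx =>
      obtain ⟨a, b, rfl⟩ := hx
      exact ⟨-a, -b, by push_cast; ring⟩
    | mul x y _ _ hx hy =>
      obtain ⟨a, b, rfl⟩ := hx
      obtain ⟨c, d, rfl⟩ := hy
      refine ⟨a * c + b * d * k, a * d + b * c + b * d * D, ?_⟩
      have : ((a : K D) + b * gam D) * (c + d * gam D)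
          = a * c + (a * d + b * c) * gam D + b * d * (gam D * gam D) := by ring
      rw [this, hgam]
      push_cast
      ring
  · rintro ⟨a, b, rfl⟩
    exact add_mem (intCast_mem _ _)
      (mul_mem (intCast_mem _ _) (Subring.subset_closure rfl))

/-- The maximal order `𝓞_K`. -/
abbrev maxOrder (D : ℕ) : Subalgebra ℤ (K D) := integralClosure ℤ (K D)

/-- The conductor of `𝓞_D`, that is the index `[𝓞_K : 𝓞_D]`. -/
def conductor (D : ℕ) : ℕ :=
  (quadOrder D).toAddSubgroup.relIndex (maxOrder D).toSubring.toAddSubgroup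

/-- An order in `K`: a subring which is a lattice in the `ℚ`-vector space `K`. -/
def IsOrder {D : ℕ} (S : Subring (K D)) : Prop :=
  S.toAddSubgroup.FG ∧ Submodule.span ℚ (S : Set (K D)) = ⊤

/-- `p` is inert over `K`. -/
def IsInert (D p : ℕ) : Prop := (Ideal.span {(p : maxOrder D)}).IsPrime

/-- `p` is ramified over `K`. -/
def IsRamified (D p : ℕ) : Prop :=
  ∃ P : Ideal (maxOrder D), P.IsPrime ∧ Ideal.span {(p : maxOrder D)} = P ^ 2

/-- `p` splits over `K`. -/
def IsSplit (D p : ℕ) : Prop :=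
  ∃ P Q : Ideal (maxOrder D), P.IsPrime ∧ Q.IsPrime ∧ P ≠ Q ∧
    Ideal.span {(p : maxOrder D)} = P * Q

/-- The prime factor condition in `𝓞_D` for the pair `(d₁, d₂)`. -/
def PrimeFactorCondition (D d₁ d₂ : ℕ) : Prop :=
  ∀ p : ℕ, p.Prime → p ∣ d₂ / d₁ →
    ¬ IsInert D p ∧ (IsRamified D p → (d₂ / d₁).factorization p = 1)

/-- The number of splitting prime divisors of `d₂ / d₁`. -/
def numSplit (D d₁ d₂ : ℕ) : ℕ := {p : ℕ | p.Prime ∧ p ∣ d₂ / d₁ ∧ IsSplit D p}.ncard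

/-- The two embeddings of `K` into `ℝ`: `emb D 0` sends `√D` to the positive root, and
`emb D 1` is its composition with the Galois conjugation. -/
def emb (D : ℕ) (i : Fin 2) : K D →+* ℝ :=
  (QuadraticAlgebra.lift ⟨![Real.sqrt D, -Real.sqrt D] i, by
    fin_cases i <;> simp [Algebra.smul_def]⟩ : K D →ₐ[ℚ] ℝ).toRingHom

theorem emb_zero_apply {D : ℕ} (x : K D) : emb D 0 x = x.re + x.im * Real.sqrt D := by
  simp [emb, QuadraticAlgebra.lift, Algebra.smul_def]

theorem emb_one_apply {D : ℕ} (x : K D) : emb D 1 x = emb D 0 (star x) := by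
  simp [emb, QuadraticAlgebra.lift, Algebra.smul_def]

/-! ### Polarized abelian surfaces with real multiplication -/

/-- The complex vector space `ℂ²`. -/
abbrev V : Type := Fin 2 → ℂ

/-- The form `E` on the lattice `Λ` is given, with respect to some `ℤ`-basis
`(λ₁, λ₂, μ₁, μ₂)`, by the matrix `(0, Δ; -Δ, 0)` with `Δ = diag(d₁, d₂)`. -/
def HasType {M R : Type} [AddCommGroup M] [Ring R] (Λ : Submodule ℤ M) (E : M → M → R)
    (d₁ d₂ : ℕ) : Prop :=
  ∃ b : Module.Basis (Fin 2 ⊕ Fin 2) ℤ Λ, ∀ i j : Fin 2,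
    E (b (.inl i)) (b (.inl j)) = 0 ∧
    E (b (.inr i)) (b (.inr j)) = 0 ∧
    E (b (.inl i)) (b (.inr j)) = (if i = j then ((![d₁, d₂] i : ℕ) : R) else 0) ∧
    E (b (.inr j)) (b (.inl i)) = -(if i = j then ((![d₁, d₂] i : ℕ) : R) else 0)

/-- The raw data of a triple `(A, H, ρ)` with `A = ℂ² / Λ`: a subgroup `Λ` of `ℂ²`, a
sesquilinear form `H` (linear in the first variable), and a ring homomorphism `ρ`, written
through its analytic representation. -/
structure TorusData (D : ℕ) where
  lattice : Submodule ℤ V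
  form : V →ₗ[ℂ] V →ₗ⋆[ℂ] ℂ
  rho : quadOrder D →+* Module.End ℂ V

/-- `(A, H, ρ)` is a polarized abelian surface of type `(d₁, d₂)` with real multiplication by
`𝓞_D`. -/
structure TorusData.IsRM {D : ℕ} (T : TorusData D) (d₁ d₂ : ℕ) : Prop where
  /-- `Λ` is a lattice in `ℂ²` -/
  discrete : DiscreteTopology T.lattice
  span_top : Submodule.span ℝ (T.lattice : Set V) = ⊤
  /-- `H` is a positive definite Hermitian form -/
  hermitian : ∀ v w, T.form w v = conj (T.form v w)
  pos : ∀ v, v ≠ 0 → 0 < (T.form v v).re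
  /-- `Im H` is integral on `Λ` -/
  integral : ∀ v ∈ T.lattice, ∀ w ∈ T.lattice, ∃ n : ℤ, (T.form v w).im = n
  /-- the polarization is of type `(d₁, d₂)` -/
  type : HasType T.lattice (fun v w => (T.form v w).im) d₁ d₂
  /-- `ρ` is an injective homomorphism into `End(A)` -/
  injective : Function.Injective T.rho
  maps : ∀ (x : quadOrder D), ∀ v ∈ T.lattice, T.rho x v ∈ T.lattice
  /-- the action is self-adjoint -/
  selfAdjoint : ∀ (x : quadOrder D) (v w : V), T.form (T.rho x v) w = T.form v (T.rho x w)
  /-- `ρ` is proper: it does not extend to a larger order -/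
  proper : ¬ ∃ (S : Subring (K D)) (hS : quadOrder D < S) (ρ' : S →+* Module.End ℂ V),
    IsOrder S ∧ Function.Injective ρ' ∧ (∀ (x : S), ∀ v ∈ T.lattice, ρ' x v ∈ T.lattice) ∧
      ∀ x : quadOrder D, ρ' ⟨x, hS.le x.2⟩ = T.rho x

/-- Polarized abelian surfaces of type `(d₁, d₂)` with real multiplication by `𝓞_D`. -/
def Surface (D d₁ d₂ : ℕ) : Type := {T : TorusData D // T.IsRM d₁ d₂}

/-- An isomorphism `(A, H, ρ) → (A', H', ρ')`, through its analytic representation. -/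
def IsIso {D : ℕ} (T T' : TorusData D) : Prop :=
  ∃ F : V ≃ₗ[ℂ] V, (∀ v, v ∈ T.lattice ↔ F v ∈ T'.lattice) ∧
    (∀ v w, T'.form (F v) (F w) = T.form v w) ∧
    (∀ (x : quadOrder D) (v : V), F (T.rho x v) = T'.rho x (F v))

theorem IsIso.refl {D : ℕ} (T : TorusData D) : IsIso T T :=
  ⟨LinearEquiv.refl ℂ V, by simp, by simp, by simp⟩

theorem IsIso.symm {D : ℕ} {T T' : TorusData D} (h : IsIso T T') : IsIso T' T := by
  obtain ⟨F, h1, h2, h3⟩ := h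
  refine ⟨F.symm, fun v => ?_, fun v w => ?_, fun x v => ?_⟩
  · simpa using (h1 (F.symm v)).symm
  · simpa using (h2 (F.symm v) (F.symm w)).symm
  · apply F.injective
    simpa using (h3 x (F.symm v)).symm

theorem IsIso.trans {D : ℕ} {T T' T'' : TorusData D} (h : IsIso T T') (h' : IsIso T' T'') :
    IsIso T T'' := by
  obtain ⟨F, h1, h2, h3⟩ := h
  obtain ⟨G, g1, g2, g3⟩ := h'
  refine ⟨F.trans G, fun v => ?_, fun v w => ?_, fun x v => ?_⟩
  · simpa using (h1 v).trans (g1 (F v))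
  · simpa using (g2 (F v) (F w)).trans (h2 v w)
  · simp [h3, g3]

instance surfaceSetoid (D d₁ d₂ : ℕ) : Setoid (Surface D d₁ d₂) where
  r T T' := IsIso T.1 T'.1
  iseqv := ⟨fun T => .refl T.1, fun h => h.symm, fun h h' => h.trans h'⟩

/-- The moduli space `X_{D,(d₁,d₂)}`: the isomorphism classes `[(A, H, ρ)]`. -/
def ModuliSpace (D d₁ d₂ : ℕ) : Type := Quotient (surfaceSetoid D d₁ d₂)

/-- The isomorphism class `[(A, H, ρ)]`. -/
def ModuliSpace.mk {D d₁ d₂ : ℕ} (T : Surface D d₁ d₂) : ModuliSpace D d₁ d₂ :=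
  Quotient.mk _ T

/-! ### The analytic structure of the moduli space -/

/-- `(T w)`, `w ∈ U`, is a holomorphic family over the open set `U ⊆ ℂⁿ`: there are holomorphic
period vectors `Π₁, …, Π₄` which form a `ℤ`-basis of the lattice at each `w ∈ U`, and with
respect to which the alternating forms and the actions of `𝓞_D` are constant. -/
def IsHolomorphicFamily {D d₁ d₂ n : ℕ} (U : Set (Fin n → ℂ))
    (T : (Fin n → ℂ) → Surface D d₁ d₂) : Prop :=
  IsOpen U ∧
  ∃ (Per : Fin 4 → (Fin n → ℂ) → V) (E : Matrix (Fin 4) (Fin 4) ℤ)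
    (R : quadOrder D → Matrix (Fin 4) (Fin 4) ℤ),
    (∀ j, AnalyticOnNhd ℂ (Per j) U) ∧
    ∀ w ∈ U, LinearIndependent ℤ (fun j => Per j w) ∧
      Submodule.span ℤ (Set.range fun j => Per j w) = (T w).1.lattice ∧
      (∀ i j, ((T w).1.form (Per i w) (Per j w)).im = E i j) ∧
      (∀ x j, (T w).1.rho x (Per j w) = ∑ i, R x i j • Per i w)

/-- The topology of the moduli space: the finest one for which the classifying maps
`w ↦ [T w]` of all holomorphic families are continuous. -/
instance (D d₁ d₂ : ℕ) : TopologicalSpace (ModuliSpace D d₁ d₂) where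
  IsOpen S := ∀ (n : ℕ) (U : Set (Fin n → ℂ)) (T : (Fin n → ℂ) → Surface D d₁ d₂),
    IsHolomorphicFamily U T → IsOpen {w | w ∈ U ∧ ModuliSpace.mk (T w) ∈ S}
  isOpen_univ := fun n U T h => by simpa using h.1
  isOpen_inter := fun S S' hS hS' n U T h => by
    have : {w | w ∈ U ∧ ModuliSpace.mk (T w) ∈ S ∩ S'} =
        {w | w ∈ U ∧ ModuliSpace.mk (T w) ∈ S} ∩ {w | w ∈ U ∧ ModuliSpace.mk (T w) ∈ S'} := by
      ext w
      simp only [Set.mem_ofPred_eq, Set.mem_inter_iff]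
      tauto
    rw [this]
    exact (hS n U T h).inter (hS' n U T h)
  isOpen_sUnion := fun 𝒮 h𝒮 n U T h => by
    have : {w | w ∈ U ∧ ModuliSpace.mk (T w) ∈ ⋃₀ 𝒮} =
        ⋃ S ∈ 𝒮, {w | w ∈ U ∧ ModuliSpace.mk (T w) ∈ S} := by
      ext w
      simp only [Set.mem_ofPred_eq, Set.mem_sUnion, Set.mem_iUnion, exists_prop]
      constructor
      · rintro ⟨h1, S, h2, h3⟩
        exact ⟨S, h2, h1, h3⟩
      · rintro ⟨S, h2, h1, h3⟩
        exact ⟨h1, S, h2, h3⟩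
    rw [this]
    exact isOpen_biUnion fun S hS => h𝒮 S hS n U T h

/-- `f` is holomorphic on the open subset `S` of the moduli space: it becomes holomorphic after
composition with the classifying map of every holomorphic family. -/
def HolomorphicOn {D d₁ d₂ : ℕ} (S : Set (ModuliSpace D d₁ d₂))
    (f : ModuliSpace D d₁ d₂ → ℂ) : Prop :=
  ∀ (n : ℕ) (U : Set (Fin n → ℂ)) (T : (Fin n → ℂ) → Surface D d₁ d₂),
    IsHolomorphicFamily U T →
      AnalyticOnNhd ℂ (fun w => f (ModuliSpace.mk (T w))) {w | w ∈ U ∧ ModuliSpace.mk (T w) ∈ S}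

/-- Analytic subsets: locally the common zero set of finitely many holomorphic functions. -/
def IsAnalyticSubset {D d₁ d₂ : ℕ} (Z : Set (ModuliSpace D d₁ d₂)) : Prop :=
  ∀ x, ∃ S : Set (ModuliSpace D d₁ d₂), IsOpen S ∧ x ∈ S ∧
    ∃ F : Set (ModuliSpace D d₁ d₂ → ℂ), F.Finite ∧ (∀ f ∈ F, HolomorphicOn S f) ∧
      Z ∩ S = {y ∈ S | ∀ f ∈ F, f y = 0}

/-- Irreducible analytic subsets. -/
def IsIrredAnalytic {D d₁ d₂ : ℕ} (Z : Set (ModuliSpace D d₁ d₂)) : Prop :=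
  IsAnalyticSubset Z ∧ Z.Nonempty ∧
    ∀ Z₁ Z₂, IsAnalyticSubset Z₁ → IsAnalyticSubset Z₂ → Z = Z₁ ∪ Z₂ → Z = Z₁ ∨ Z = Z₂

/-- Irreducible components: the maximal irreducible analytic subsets. -/
def IsIrredComponent {D d₁ d₂ : ℕ} (Z : Set (ModuliSpace D d₁ d₂)) : Prop :=
  Maximal IsIrredAnalytic Z

/-! ### The surfaces `(A_z, H_z, ρ_z)` and the loci `X_𝔞` -/

/-- The fractional ideal `(1/√D) 𝔞`. -/
def scaledIdeal {D : ℕ} (𝔞 : Ideal (quadOrder D)) : Submodule (quadOrder D) (K D) :=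
  Submodule.map (LinearMap.toSpanSingleton (quadOrder D) (K D) (invSqrt D)) 𝔞

theorem mem_scaledIdeal {D : ℕ} (𝔞 : Ideal (quadOrder D)) (y : K D) :
    y ∈ scaledIdeal 𝔞 ↔ ∃ a ∈ 𝔞, y = invSqrt D * (a : K D) := by
  simp only [scaledIdeal, Submodule.mem_map, LinearMap.toSpanSingleton_apply, Subring.smul_def,
    smul_eq_mul]
  exact exists_congr fun a => and_congr_right fun _ => by rw [mul_comm, eq_comm]

/-- The `ℤ`-module underlying `𝓞_D ⊕ (1/√D) 𝔞`, inside `K²`. -/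
def pairModule {D : ℕ} (𝔞 : Ideal (quadOrder D)) : Submodule ℤ (K D × K D) :=
  (AddSubgroup.prod (quadOrder D).toAddSubgroup (scaledIdeal 𝔞).toAddSubgroup).toIntSubmodule

/-- The trace pairing `⟨(x, y), (x', y')⟩ = tr(x' y - x y')`. -/
def tracePairing {D : ℕ} (u v : K D × K D) : ℚ :=
  QuadraticAlgebra.trace (v.1 * u.2 - u.1 * v.2)

/-- The trace pairing on `𝓞_D ⊕ (1/√D) 𝔞` is of type `(d₁, d₂)`. -/
def IdealHasType {D : ℕ} (𝔞 : Ideal (quadOrder D)) (d₁ d₂ : ℕ) : Prop :=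
  HasType (pairModule 𝔞) tracePairing d₁ d₂

/-- The map `φ_z : (x, y) ↦ (x + y z₁, x^σ + y^σ z₂)`. -/
def phi (D : ℕ) (z : ℍ × ℍ) : K D × K D →+ V where
  toFun u := ![(emb D 0 u.1 : ℂ) + (emb D 0 u.2 : ℂ) * (z.1 : ℂ),
    (emb D 1 u.1 : ℂ) + (emb D 1 u.2 : ℂ) * (z.2 : ℂ)]
  map_zero' := by ext i; fin_cases i <;> simp
  map_add' u v := by ext i; fin_cases i <;> simp <;> ring

/-- The Hermitian form `H_z(v, w) = v₁ w̄₁ / Im z₁ + v₂ w̄₂ / Im z₂` on `ℂ²`. -/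
def torusForm (z : ℍ × ℍ) : V →ₗ[ℂ] V →ₗ⋆[ℂ] ℂ :=
  LinearMap.mk₂'ₛₗ (RingHom.id ℂ) (starRingEnd ℂ)
    (fun v w => v 0 * conj (w 0) / (z.1.im : ℂ) + v 1 * conj (w 1) / (z.2.im : ℂ))
    (fun v v' w => by simp; ring) (fun c v w => by simp; ring)
    (fun v w w' => by simp; ring) (fun c v w => by simp; ring)

/-- `H_z` is the form induced by the trace pairing. -/
theorem torusForm_phi_im {D : ℕ} (z : ℍ × ℍ) (u v : K D × K D) :
    (torusForm z (phi D z u) (phi D z v)).im = (tracePairing u v : ℝ) := by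
  have h1 : z.1.im ≠ 0 := z.1.im_ne_zero
  have h2 : z.2.im ≠ 0 := z.2.im_ne_zero
  have key : ∀ (a b c d : ℝ) (τ : ℍ),
      (((a : ℂ) + b * (τ : ℂ)) * ((c : ℂ) + d * conj (τ : ℂ)) / (τ.im : ℂ)).im
        = c * b - a * d := by
    intro a b c d τ
    have hτ : τ.im ≠ 0 := τ.im_ne_zero
    rw [Complex.div_ofReal_im]
    simp only [Complex.mul_im, Complex.add_re, Complex.add_im, Complex.ofReal_re,
      Complex.ofReal_im, Complex.mul_re, Complex.conj_re, Complex.conj_im,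
      UpperHalfPlane.coe_re, UpperHalfPlane.coe_im]
    field_simp
    ring
  have k1 := key (emb D 0 u.1) (emb D 0 u.2) (emb D 0 v.1) (emb D 0 v.2) z.1
  have k2 := key (emb D 1 u.1) (emb D 1 u.2) (emb D 1 v.1) (emb D 1 v.2) z.2
  simp only [torusForm, phi, LinearMap.mk₂'ₛₗ_apply, AddMonoidHom.coe_mk, ZeroHom.coe_mk,
    Matrix.cons_val_zero, Matrix.cons_val_one, map_add, map_mul, Complex.conj_ofReal,
    Complex.add_im]
  rw [k1, k2]
  have hs : Real.sqrt D ^ 2 = D := Real.sq_sqrt (Nat.cast_nonneg D)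
  simp only [emb_one_apply, emb_zero_apply, tracePairing, QuadraticAlgebra.trace_def]
  simp
  ring_nf
  rw [hs]
  ring

/-- The diagonal action `ρ_z(k)(c₁, c₂) = (k c₁, k^σ c₂)` on `ℂ²`. -/
def diagRho (D : ℕ) : quadOrder D →+* Module.End ℂ V :=
  ((Matrix.toLinAlgEquiv' : Matrix (Fin 2) (Fin 2) ℂ ≃ₐ[ℂ] Module.End ℂ V) :
      Matrix (Fin 2) (Fin 2) ℂ →+* Module.End ℂ V).comp
    ((Matrix.diagonalRingHom (Fin 2) ℂ).comp
      (RingHom.pi fun i => (Complex.ofRealHom.comp (emb D i)).comp (quadOrder D).subtype))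

theorem diagRho_apply {D : ℕ} (k : quadOrder D) (c : V) (i : Fin 2) :
    diagRho D k c i = (emb D i k : ℂ) * c i := by
  simp [diagRho, Matrix.mulVec_diagonal]

/-- The triple `(A_z, H_z, ρ_z)` with `A_z = ℂ² / φ_z(𝓞_D ⊕ (1/√D) 𝔞)`. -/
def torusAt {D : ℕ} (𝔞 : Ideal (quadOrder D)) (z : ℍ × ℍ) : TorusData D where
  lattice := (pairModule 𝔞).map (phi D z).toIntLinearMap
  form := torusForm z
  rho := diagRho D

/-- The locus `X_𝔞` of the isomorphism classes `[(A_z, H_z, ρ_z)]`, `z ∈ ℍ²`. -/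
def component {D : ℕ} (d₁ d₂ : ℕ) (𝔞 : Ideal (quadOrder D)) : Set (ModuliSpace D d₁ d₂) :=
  {c | ∃ (z : ℍ × ℍ) (h : (torusAt 𝔞 z).IsRM d₁ d₂), c = ModuliSpace.mk ⟨torusAt 𝔞 z, h⟩}

/-! ### Hilbert modular surfaces -/

/-- The group `SL₂(𝓞_D ⊕ (1/√D) 𝔞)` of the matrices `(a, b; c, d)` of determinant `1` over `K`
with `a, d ∈ 𝓞_D`, `c ∈ I` and `b ∈ I⁻¹ = {x | x I ⊆ 𝓞_D}`, where `I = (1/√D) 𝔞`. -/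
def hilbertSL {D : ℕ} (𝔞 : Ideal (quadOrder D)) : Subgroup SL(2, K D) where
  carrier := {M | M 0 0 ∈ quadOrder D ∧ (∀ y ∈ scaledIdeal 𝔞, M 0 1 * y ∈ quadOrder D) ∧
    M 1 0 ∈ scaledIdeal 𝔞 ∧ M 1 1 ∈ quadOrder D}
  one_mem' := by simp
  mul_mem' := by
    rintro M N ⟨a, b, c, d⟩ ⟨a', b', c', d'⟩
    have hsm : ∀ {x y : K D}, x ∈ quadOrder D → y ∈ scaledIdeal 𝔞 → x * y ∈ scaledIdeal 𝔞 :=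
      fun {x y} hx hy => (scaledIdeal 𝔞).smul_mem (⟨x, hx⟩ : quadOrder D) hy
    simp only [Set.mem_ofPred_eq, Matrix.SpecialLinearGroup.coe_mul, Matrix.mul_apply,
      Fin.sum_univ_two]
    refine ⟨add_mem (mul_mem a a') (b _ c'), fun y hy => ?_,
      add_mem (by rw [mul_comm]; exact hsm a' c) (hsm d c'), add_mem ?_ (mul_mem d d')⟩
    · rw [add_mul]
      refine add_mem ?_ ?_
      · rw [mul_assoc]; exact mul_mem a (b' y hy)
      · rw [mul_assoc]; exact b _ (hsm d' hy)
    · rw [mul_comm]; exact b' _ c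
  inv_mem' := by
    rintro M ⟨a, b, c, d⟩
    simp only [Set.mem_ofPred_eq, Matrix.SpecialLinearGroup.coe_inv, Matrix.adjugate_fin_two,
      Matrix.of_apply, Matrix.cons_val_zero, Matrix.cons_val_one, Matrix.cons_val']
    exact ⟨d, fun y hy => by simpa using b y hy, neg_mem c, a⟩

/-- The subgroup `{1, -1}` of `SL₂(𝓞_D ⊕ (1/√D) 𝔞)`. -/
def plusMinusOne {D : ℕ} (𝔞 : Ideal (quadOrder D)) : Subgroup (hilbertSL 𝔞) :=
  (Subgroup.zpowers (-1 : SL(2, K D))).subgroupOf (hilbertSL 𝔞)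

theorem mem_plusMinusOne {D : ℕ} (𝔞 : Ideal (quadOrder D)) (M : hilbertSL 𝔞) :
    M ∈ plusMinusOne 𝔞 ↔ (M : SL(2, K D)) = 1 ∨ (M : SL(2, K D)) = -1 := by
  rw [plusMinusOne, Subgroup.mem_subgroupOf, Subgroup.mem_zpowers_iff]
  constructor
  · rintro ⟨k, hk⟩
    rw [← hk]
    rcases Int.even_or_odd k with h | h
    · exact .inl h.neg_one_zpow
    · obtain ⟨m, rfl⟩ := h
      right
      rw [zpow_add, zpow_mul]
      norm_num
  · rintro (h | h)
    · exact ⟨0, by simp [h]⟩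
    · exact ⟨1, by simp [h]⟩

instance {D : ℕ} (𝔞 : Ideal (quadOrder D)) : (plusMinusOne 𝔞).Normal where
  conj_mem M hM g := by
    rw [mem_plusMinusOne] at hM ⊢
    rcases hM with h | h <;> simp [h]

/-- The Hilbert modular group `PSL₂(𝓞_D ⊕ (1/√D) 𝔞)`. -/
abbrev HilbertPSL {D : ℕ} (𝔞 : Ideal (quadOrder D)) : Type := hilbertSL 𝔞 ⧸ plusMinusOne 𝔞

/-- The action of `SL₂(K)` on `ℍ²`: `M (z₁, z₂) = (M z₁, M^σ z₂)`. -/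
def slPerm (D : ℕ) : SL(2, K D) →* Equiv.Perm (ℍ × ℍ) where
  toFun M := Equiv.prodCongr
    (MulAction.toPerm (Matrix.SpecialLinearGroup.map (emb D 0) M : SL(2, ℝ)))
    (MulAction.toPerm (Matrix.SpecialLinearGroup.map (emb D 1) M : SL(2, ℝ)))
  map_one' := by ext z <;> simp
  map_mul' M N := by ext z <;> simp [mul_smul]

theorem slPerm_neg_one (D : ℕ) : slPerm D (-1) = 1 := by
  have h : ∀ i, (Matrix.SpecialLinearGroup.map (emb D i) (-1) : SL(2, ℝ)) = -1 := by
    intro i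
    ext a b
    fin_cases a <;> fin_cases b <;> simp
  have h' : ∀ τ : ℍ, (-1 : SL(2, ℝ)) • τ = τ := fun τ => by
    ext1
    rw [UpperHalfPlane.coe_specialLinearGroup_apply]
    simp
  ext z <;> simp [slPerm, h, h']

/-- The induced action of `PSL₂(𝓞_D ⊕ (1/√D) 𝔞)` on `ℍ²`. -/
def pslPerm {D : ℕ} (𝔞 : Ideal (quadOrder D)) : HilbertPSL 𝔞 →* Equiv.Perm (ℍ × ℍ) :=
  QuotientGroup.lift (plusMinusOne 𝔞) ((slPerm D).comp (hilbertSL 𝔞).subtype) (by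
    intro M hM
    rcases (mem_plusMinusOne 𝔞 M).1 hM with h | h <;> simp [h, slPerm_neg_one])

instance {D : ℕ} (𝔞 : Ideal (quadOrder D)) : MulAction (HilbertPSL 𝔞) (ℍ × ℍ) :=
  MulAction.compHom (ℍ × ℍ) (pslPerm 𝔞)

/-- The Hilbert modular surface `PSL₂(𝓞_D ⊕ (1/√D) 𝔞) \ ℍ²`, with the quotient topology. -/
abbrev HilbertSurface {D : ℕ} (𝔞 : Ideal (quadOrder D)) : Type :=
  Quotient (MulAction.orbitRel (HilbertPSL 𝔞) (ℍ × ℍ))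

/-- The class `[z]` of `z ∈ ℍ²`. -/
def HilbertSurface.mk {D : ℕ} (𝔞 : Ideal (quadOrder D)) (z : ℍ × ℍ) : HilbertSurface 𝔞 :=
  Quotient.mk _ z

/-- `g` is holomorphic on the open subset `S` of `PSL₂(𝓞_D ⊕ (1/√D) 𝔞) \ ℍ²`: its pullback to
`ℍ²` is holomorphic on the preimage of `S`. -/
def HilbertSurface.HolomorphicOn {D : ℕ} {𝔞 : Ideal (quadOrder D)} (S : Set (HilbertSurface 𝔞))
    (g : HilbertSurface 𝔞 → ℂ) : Prop :=
  ∀ z : ℍ × ℍ, HilbertSurface.mk 𝔞 z ∈ S →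
    AnalyticAt ℂ (fun w : ℂ × ℂ => g (HilbertSurface.mk 𝔞
      (UpperHalfPlane.ofComplex w.1, UpperHalfPlane.ofComplex w.2))) ((z.1 : ℂ), (z.2 : ℂ))

end

end RealMult

/-!
Real multiplication makes the lattice `Λ` of a triple `(A, H, ρ)` a module over `𝓞_D` of rank two,
on which `Im H` is of the form `tr (B / √D)` for an `𝓞_D`-bilinear alternating form `B`. The proof
shows that the symplectic module `Λ` has a normal form `𝓞_D ⊕ (1/√D) 𝔞`, where the ideal `𝔞` is an
isomorphism invariant, and that the complex structures on a given module are parametrized by `ℍ²`.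

*Normal form.* Properness of `ρ` says that no `(γ - r) / p` acts on `Λ`, that is, `γ` is not a
scalar on `Λ / pΛ`. A linear map which is not a scalar has a vector which is not an eigenvector,
and its line over `𝓞_D` is saturated at `p` (`exists_saturatedAt`); by approximation there is one
vector whose line is saturated at all primes (`exists_saturatedAt_forall`). As `𝓞_D` is Gorenstein,
a saturated line is a direct summand (`exists_functional_of_saturatedAt`), and the alternating form
identifies the complement with `(1/√D) 𝔞`. Such an identification is called a frame, and every
surface has one (`TorusData.IsRM.exists_isFrame`). In coordinates in which `𝓞_D` acts diagonally
(`TorusData.IsRM.exists_coordinates`), a surface with a frame becomes `(A_z, H_z, ρ_z)`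
(`IsFrame.exists_isIso`); conversely, all these triples have real multiplication (`isRM_torusAt`).
An isomorphism between the surfaces at `z` and `z'` is a matrix of determinant `1` over `K` which
maps one module `𝓞_D ⊕ (1/√D) 𝔞` onto the other; so it forces the ideals to be equal and the points
to be equivalent under the Hilbert modular group (`eq_and_exists_of_isIso`,
`isIso_torusAt_slPerm`).

*Analytic structure.* The surfaces at the points of `ℍ²` form a holomorphic family
(`isHolomorphicFamily_tautFamily`), and any holomorphic family has a holomorphic period map to
`ℍ²`, because a frame at one point propagates over the base
(`IsHolomorphicFamily.exists_periodMap`). Hence the map `ℍ² → X_𝔞` is continuous and open, and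
holomorphic functions on `X_𝔞` are those with holomorphic pullback (`isOpenMap_classifying`,
`holomorphicOn_iff`), which gives the isomorphism with the Hilbert modular surface. The loci `X_𝔞`
are open and disjoint, hence closed, and irreducible by the identity theorem on the connected
manifold `ℍ²` (`isIrredAnalytic_component`); so they are the irreducible components.

*Counting.* An ideal of type `(d₁, d₁ n)` has the form `d₁ (n, γ - r)`, where `r` is a root modulo
`n` of the minimal polynomial of `γ` (`ncard_idealHasType`). At a prime not dividing the conductor
the maximal order is generated by `γ` up to an index prime to it (`isMonogenicAt_maxGen`), so the
prime is inert, ramified or split according to whether the polynomial has no root, a double root or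
simple roots modulo `p`. Simple roots lift to all powers of `p` and double roots do not lift modulo
`p²`, so by the Chinese remainder theorem there are `2 ^ s` roots modulo `n` under the prime factor
condition, and none otherwise (`numRoots_eq`).
-/

namespace RealMult

noncomputable section

/-! ### Coordinates, norms and traces in the order `𝓞_D` -/

/-- `D` is a discriminant and not a square. -/
class IsNonsquareDisc (D : ℕ) : Prop where
  mod_four : D % 4 = 0 ∨ D % 4 = 1
  not_isSquare : ¬ IsSquare D

/-- The norm `(D² - D) / 4` of `γ`. -/
def gamNorm (D : ℕ) : ℤ := ((D : ℤ) ^ 2 - D) / 4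

theorem four_mul_gamNorm (D : ℕ) [h : IsNonsquareDisc D] : 4 * gamNorm D = (D : ℤ) ^ 2 - D := by
  have h4 : ((D : ℤ) ^ 2 - D) % 4 = 0 := by
    have h : (D : ℤ) % 4 = 0 ∨ (D : ℤ) % 4 = 1 := by have := h.mod_four; omega
    rcases h with h | h <;> simp [pow_two, Int.sub_emod, Int.mul_emod, h]
  unfold gamNorm; omega

theorem gam_mul_gam (D : ℕ) [IsNonsquareDisc D] :
    gam D * gam D = (D : K D) * gam D - (gamNorm D : K D) := by
  have h : 4 * (gamNorm D : ℚ) = (D : ℚ) ^ 2 - D := by exact_mod_cast four_mul_gamNorm D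
  ext
  · simp [gam]; linarith
  · simp [gam]; ring

theorem gam_mem (D : ℕ) : gam D ∈ quadOrder D := Subring.subset_closure rfl

/-- The generator `γ` of `𝓞_D`, as an element of `𝓞_D`. -/
def gen (D : ℕ) : quadOrder D := ⟨gam D, gam_mem D⟩

@[simp] theorem coe_gen (D : ℕ) : (gen D : K D) = gam D := rfl

theorem gen_mul_gen (D : ℕ) [IsNonsquareDisc D] :
    gen D * gen D = (D : quadOrder D) * gen D - (gamNorm D : quadOrder D) := by
  ext1; simpa using gam_mul_gam D

theorem star_gam (D : ℕ) : star (gam D) = (D : K D) - gam D := by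
  ext <;> simp [gam]
  ring

variable {D : ℕ}

theorem exists_eq_add_mul_gen [h : IsNonsquareDisc D] (x : quadOrder D) :
    ∃ a b : ℤ, x = a + b * gen D := by
  obtain ⟨a, b, h⟩ := (mem_quadOrder_iff h.mod_four x.1).1 x.2
  exact ⟨a, b, by ext1; simpa using h⟩

theorem add_mul_gam_inj {a b a' b' : ℚ}
    (h : (a : K D) + b * gam D = a' + b' * gam D) : a = a' ∧ b = b' := by
  have h1 := congrArg QuadraticAlgebra.im h
  have h2 := congrArg QuadraticAlgebra.re h
  simp [gam] at h1 h2
  refine ⟨?_, h1⟩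
  subst h1
  linarith

theorem ratCast_intCast (a : ℤ) : ((a : ℚ) : K D) = (a : K D) := rfl

theorem add_mul_gen_inj {a b a' b' : ℤ}
    (h : (a : quadOrder D) + b * gen D = a' + b' * gen D) : a = a' ∧ b = b' := by
  have := congrArg (fun x : quadOrder D => (x : K D)) h
  have := add_mul_gam_inj (a := a) (b := b) (a' := a') (b' := b')
    (by simpa only [ratCast_intCast, Subring.coe_add, Subring.coe_mul,
      SubringClass.coe_intCast, coe_gen] using this)
  exact_mod_cast this

theorem star_mem [h : IsNonsquareDisc D] {x : K D} (hx : x ∈ quadOrder D) :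
    star x ∈ quadOrder D := by
  obtain ⟨a, b, rfl⟩ := (mem_quadOrder_iff h.mod_four x).1 hx
  simp only [star_add, star_mul, star_gam]
  have h1 : ∀ a : ℤ, star (a : K D) = a := fun a => by ext <;> simp
  rw [h1, h1]
  exact add_mem (intCast_mem _ _)
    (mul_mem (sub_mem (natCast_mem _ _) (gam_mem D)) (intCast_mem _ _))

/-- The coefficient of `γ` of an element `x` of `𝓞_D`. Since `tr(1 / √D) = 0` and
`tr(γ / √D) = 1`, it equals `tr(x / √D)`. -/
def genCoeff (D : ℕ) [IsNonsquareDisc D] : quadOrder D →+ ℤ :=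
  have h (x : quadOrder D) : ∃ b a : ℤ, x = a + b * gen D := by
    obtain ⟨a, b, h⟩ := exists_eq_add_mul_gen x
    exact ⟨b, a, h⟩
  AddMonoidHom.mk' (fun x => (h x).choose) fun x y => by
    obtain ⟨a, ha⟩ := (h x).choose_spec
    obtain ⟨b, hb⟩ := (h y).choose_spec
    obtain ⟨c, hc⟩ := (h (x + y)).choose_spec
    generalize (h (x + y)).choose = k at *
    generalize (h x).choose = k₁ at *
    generalize (h y).choose = k₂ at *
    refine (add_mul_gen_inj (a := c) (a' := a + b) (D := D) ?_).2
    rw [← hc, ha, hb]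
    push_cast; ring

theorem genCoeff_add_mul_gen [IsNonsquareDisc D] (a b : ℤ) :
    genCoeff D ((a : quadOrder D) + (b : quadOrder D) * gen D) = b := by
  have h : ∃ b' a' : ℤ, (a : quadOrder D) + (b : quadOrder D) * gen D = a' + b' * gen D :=
    ⟨b, a, rfl⟩
  obtain ⟨c, hc⟩ := h.choose_spec
  exact (add_mul_gen_inj hc).2.symm

theorem cast_ne_zero (D : ℕ) [IsNonsquareDisc D] : (D : ℚ) ≠ 0 := by
  rintro h
  have : D = 0 := by exact_mod_cast h
  exact (IsNonsquareDisc.not_isSquare (D := D)) (by simp [this])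

theorem trace_invSqrt_mul [IsNonsquareDisc D] (x : quadOrder D) :
    QuadraticAlgebra.trace (invSqrt D * (x : K D)) = genCoeff D x := by
  obtain ⟨a, b, rfl⟩ := exists_eq_add_mul_gen x
  rw [genCoeff_add_mul_gen]
  have hD := cast_ne_zero D
  simp [QuadraticAlgebra.trace_def, invSqrt, gam]
  field_simp

theorem sqrt_pos (D : ℕ) [IsNonsquareDisc D] : 0 < Real.sqrt D := by
  have : D ≠ 0 := by exact_mod_cast cast_ne_zero D
  exact Real.sqrt_pos.2 (by exact_mod_cast Nat.pos_of_ne_zero this)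

theorem irrational_sqrt (D : ℕ) [h : IsNonsquareDisc D] : Irrational (Real.sqrt D) := by
  rw [irrational_sqrt_natCast_iff]
  exact h.not_isSquare

theorem emb_zero_injective (D : ℕ) [IsNonsquareDisc D] : Function.Injective (emb D 0) := by
  rw [injective_iff_map_eq_zero]
  intro x hx
  rw [emb_zero_apply] at hx
  have him : x.im = 0 := by
    by_contra h
    refine irrational_sqrt D ⟨-x.re / x.im, ?_⟩
    have : (x.im : ℝ) ≠ 0 := by exact_mod_cast h
    push_cast
    field_simp
    linarith
  have hre : x.re = 0 := by
    rw [him] at hx; simpa using hx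
  ext <;> simp [him, hre]

theorem emb_injective (D : ℕ) [IsNonsquareDisc D] (i : Fin 2) : Function.Injective (emb D i) := by
  fin_cases i
  · exact emb_zero_injective D
  · intro x y hxy
    simp only [Fin.mk_one, emb_one_apply] at hxy
    exact star_injective (emb_zero_injective D hxy)

theorem emb_ratCast (i : Fin 2) (a : ℚ) : emb D i (a : K D) = a := by
  fin_cases i
  · simp [emb_zero_apply]
  · simp [emb_one_apply, emb_zero_apply]

theorem trace_eq_emb_add (x : K D) :
    ((QuadraticAlgebra.trace x : ℚ) : ℝ) = emb D 0 x + emb D 1 x := by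
  rw [emb_one_apply, emb_zero_apply, emb_zero_apply]
  simp [QuadraticAlgebra.trace_def]; ring

instance (D : ℕ) [IsNonsquareDisc D] : IsDomain (K D) :=
  (emb_injective D 0).isDomain (emb D 0)

theorem exists_int_mul_mem [IsNonsquareDisc D] (k : K D) :
    ∃ N : ℕ, 0 < N ∧ (N : K D) * k ∈ quadOrder D := by
  -- write `k = a + b γ` with rational `a`, `b` and clear the denominators
  set b : ℚ := 2 * k.im
  set a : ℚ := k.re - D * k.im
  have hk : k = (a : K D) + b * gam D := by
    ext <;> simp [gam, a, b] <;> ring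
  refine ⟨a.den * b.den, Nat.mul_pos a.den_pos b.den_pos, ?_⟩
  have ha : (a.den : K D) * (a : K D) = (a.num : K D) := by
    have := Rat.den_mul_eq_num a
    ext <;> simp [this]
  have hb : (b.den : K D) * (b : K D) = (b.num : K D) := by
    have := Rat.den_mul_eq_num b
    ext <;> simp [this]
  have : ((a.den * b.den : ℕ) : K D) * k =
      b.den * (a.num : K D) + a.den * (b.num : K D) * gam D := by
    rw [← ha, ← hb]; conv_lhs => rw [hk]
    push_cast; ring
  rw [this]
  exact add_mem (mul_mem (natCast_mem _ _) (intCast_mem _ _))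
    (mul_mem (mul_mem (natCast_mem _ _) (intCast_mem _ _)) (gam_mem D))

/-- Every nonzero element of `𝓞_D` divides a nonzero integer, namely its norm `x^σ x`. -/
theorem exists_mul_eq_int [IsNonsquareDisc D] {x : quadOrder D} (hx : x ≠ 0) :
    ∃ (x' : quadOrder D) (N : ℤ), N ≠ 0 ∧ x' * x = N := by
  refine ⟨⟨star x.1, star_mem x.2⟩, ?_⟩
  obtain ⟨a, b, rfl⟩ := exists_eq_add_mul_gen x
  have h1 : ∀ a : ℤ, star (a : K D) = a := fun a => by ext <;> simp
  have key : (⟨star ((a : quadOrder D) + b * gen D).1, star_mem (Subtype.prop _)⟩ : quadOrder D) *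
      (a + b * gen D) = ((a ^ 2 + D * a * b + gamNorm D * b ^ 2 : ℤ) : quadOrder D) := by
    ext1
    simp only [Subring.coe_mul, Subring.coe_add, SubringClass.coe_intCast, coe_gen, star_add,
      star_mul, h1, star_gam]
    push_cast
    linear_combination (-(b : K D) ^ 2) * gam_mul_gam D
  refine ⟨_, ?_, key⟩
  intro h0
  rw [h0] at key
  simp only [Int.cast_zero, mul_eq_zero] at key
  rcases key with h | h
  · apply hx
    have := congrArg Subtype.val h
    ext1
    exact star_injective (by simpa using this)
  · exact hx h

theorem exists_mul_eq_one [IsNonsquareDisc D] {k : K D} (hk : k ≠ 0) : ∃ k' : K D, k' * k = 1 := by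
  obtain ⟨N, hN, hNk⟩ := exists_int_mul_mem k
  have h0 : (⟨(N : K D) * k, hNk⟩ : quadOrder D) ≠ 0 := by
    intro h
    have := congrArg Subtype.val h
    simp [hk] at this
    omega
  obtain ⟨x', M, hM, h⟩ := exists_mul_eq_int h0
  have h := congrArg Subtype.val h
  simp at h
  refine ⟨((1 / M : ℚ) : K D) * x' * N, ?_⟩
  have hM' : ((1 / M : ℚ) : K D) * (M : K D) = 1 := by
    have : (M : ℚ) ≠ 0 := by exact_mod_cast hM
    ext <;> simp [this, QuadraticAlgebra.re_one, QuadraticAlgebra.im_one]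
  linear_combination ((1 / M : ℚ) : K D) * h + hM'

theorem invSqrt_ne_zero (D : ℕ) [IsNonsquareDisc D] : invSqrt D ≠ 0 := by
  intro h
  have := congrArg QuadraticAlgebra.im h
  simp [invSqrt] at this
  exact cast_ne_zero D (by exact_mod_cast this)

/-- `√D`, as an element of `𝓞_D`. -/
def sqrtElt (D : ℕ) : quadOrder D := 2 * gen D - D

theorem invSqrt_mul_sqrtElt (D : ℕ) [IsNonsquareDisc D] : invSqrt D * (sqrtElt D : K D) = 1 := by
  have := cast_ne_zero D
  have h2 : ((2 : quadOrder D) : K D) = 2 := rfl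
  ext <;> simp [sqrtElt, invSqrt, gam, h2, QuadraticAlgebra.re_one, QuadraticAlgebra.im_one,
    QuadraticAlgebra.re_ofNat, QuadraticAlgebra.im_ofNat]
  · field_simp
  · right; ring

theorem coe_sqrtElt (D : ℕ) : (sqrtElt D : K D) = ⟨0, 1⟩ := by
  have h2 : ((2 : quadOrder D) : K D) = 2 := rfl
  ext <;> simp [sqrtElt, gam, h2, QuadraticAlgebra.re_ofNat, QuadraticAlgebra.im_ofNat]
  ring

/-- The trace form is nondegenerate: it suffices to pair with the basis `1`, `γ` of `K`. -/
theorem trace_mul_eq_zero [IsNonsquareDisc D] {y : K D}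
    (h₁ : QuadraticAlgebra.trace y = 0) (h₂ : QuadraticAlgebra.trace (gam D * y) = 0) : y = 0 := by
  simp [QuadraticAlgebra.trace_def, gam] at h₁ h₂
  have := cast_ne_zero D
  ext
  · simpa using h₁
  · rw [h₁] at h₂
    have h₃ : (D : ℚ) * y.im = 0 := by linarith
    simpa [this] using h₃

/-! ### A free direct summand of rank one in a module over `𝓞_D` -/

section Module

variable {Λ : Type*} [AddCommGroup Λ] [Module (quadOrder D) Λ]

/-- The submodule `pΛ`. -/
def multiples (Λ : Type*) [AddCommGroup Λ] [Module (quadOrder D) Λ] (p : ℤ) :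
    Submodule (quadOrder D) Λ :=
  LinearMap.range (LinearMap.lsmul (quadOrder D) Λ (p : quadOrder D))

theorem mem_multiples {p : ℤ} {v : Λ} :
    v ∈ multiples (D := D) Λ p ↔ ∃ v', (p : quadOrder D) • v' = v := by
  simp [multiples]

theorem intCast_dvd {a b : ℤ} (h : a ∣ b) : (a : quadOrder D) ∣ (b : quadOrder D) :=
  map_dvd (Int.castRingHom (quadOrder D)) h

theorem mem_multiples_of_dvd {p : ℤ} {k : quadOrder D} (h : (p : quadOrder D) ∣ k) (v : Λ) :
    k • v ∈ multiples (D := D) Λ p := by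
  obtain ⟨k', rfl⟩ := h
  exact mem_multiples.2 ⟨k' • v, (mul_smul _ _ _).symm⟩

theorem mem_multiples_of_smul {p c : ℤ} (hc : IsCoprime c p) {v : Λ}
    (h : (c : quadOrder D) • v ∈ multiples (D := D) Λ p) : v ∈ multiples (D := D) Λ p := by
  obtain ⟨x, y, hxy⟩ := hc
  have : v = (x : quadOrder D) • ((c : quadOrder D) • v)
      + ((p : quadOrder D) * (y : quadOrder D)) • v := by
    rw [smul_smul, ← add_smul]
    have : (x : quadOrder D) * c + p * y = 1 := by
      rw [mul_comm (p : quadOrder D)]; exact_mod_cast congrArg (Int.cast : ℤ → quadOrder D) hxy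
    rw [this, one_smul]
  rw [this]
  exact add_mem (Submodule.smul_mem _ _ h) (mem_multiples_of_dvd (dvd_mul_right _ _) _)

theorem dvd_of_dvd_mul_int {p c : ℤ} (hc : IsCoprime c p) {k : quadOrder D}
    (h : (p : quadOrder D) ∣ k * c) : (p : quadOrder D) ∣ k :=
  (IsCoprime.intCast (R := quadOrder D) hc).symm.dvd_of_dvd_mul_right h

/-- The line `𝓞_D u` is saturated in `Λ` at the prime `p`: the map `𝓞_D / p → Λ / p`, `k ↦ k u`,
is injective. -/
def SaturatedAt (p : ℤ) (u : Λ) : Prop :=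
  ∀ k : quadOrder D, k • u ∈ multiples (D := D) Λ p → (p : quadOrder D) ∣ k

theorem SaturatedAt.congr {p : ℤ} {u v : Λ} (hu : SaturatedAt (D := D) p u)
    (h : v - u ∈ multiples (D := D) Λ p) : SaturatedAt (D := D) p v := by
  intro k hk
  apply hu
  have : k • u = k • v - k • (v - u) := by rw [smul_sub]; abel
  rw [this]
  exact sub_mem hk (Submodule.smul_mem _ _ h)

theorem SaturatedAt.smul {p c : ℤ} {u : Λ} (hu : SaturatedAt (D := D) p u)
    (hc : IsCoprime c p) : SaturatedAt (D := D) p ((c : quadOrder D) • u) := by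
  intro k hk
  rw [smul_smul] at hk
  exact dvd_of_dvd_mul_int hc (hu _ hk)

theorem int_isCoprime_of_prime {p : ℕ} (hp : p.Prime) {c : ℤ} (h : ¬ (p : ℤ) ∣ c) :
    IsCoprime c p :=
  ((Nat.prime_iff_prime_int.1 hp).irreducible.coprime_iff_not_dvd.2 h).symm

/-- If `γ` does not act as a scalar on `Λ / pΛ`, then some line is saturated at `p`: otherwise
every vector of `Λ / pΛ` would be an eigenvector of `γ`. -/
theorem exists_saturatedAt [IsNonsquareDisc D] {p : ℕ} (hp : p.Prime)
    (h : ∀ r : ℤ, ∃ v : Λ, (gen D - r) • v ∉ multiples (D := D) Λ p) :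
    ∃ u : Λ, SaturatedAt (D := D) p u := by
  by_contra! hcon
  -- every vector is an eigenvector of `γ` modulo `p`: divide a relation `(a + b γ) u ∈ pΛ` by `b`,
  -- unless `p ∣ b`, when already `u ∈ pΛ`
  have eig : ∀ u : Λ, ∃ r : ℤ, (gen D - r) • u ∈ multiples (D := D) Λ p := by
    intro u
    have := hcon u
    simp only [SaturatedAt, not_forall] at this
    obtain ⟨k, hk, hpk⟩ := this
    obtain ⟨a, b, rfl⟩ := exists_eq_add_mul_gen k
    by_cases hb : (p : ℤ) ∣ b
    · refine ⟨0, ?_⟩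
      have ha : ¬ (p : ℤ) ∣ a := fun ha =>
        hpk (dvd_add (intCast_dvd ha) (dvd_mul_of_dvd_left (intCast_dvd hb) _))
      have : u ∈ multiples (D := D) Λ p := by
        refine mem_multiples_of_smul (int_isCoprime_of_prime hp ha) ?_
        have h2 : (a : quadOrder D) • u = (a + b * gen D : quadOrder D) • u
            - ((b : quadOrder D) * gen D) • u := by rw [add_smul]; abel
        rw [h2]
        exact sub_mem hk (mem_multiples_of_dvd (dvd_mul_of_dvd_left (intCast_dvd hb) _) _)
      exact Submodule.smul_mem _ _ this
    · obtain ⟨x, y, hxy⟩ := int_isCoprime_of_prime hp hb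
      refine ⟨-(x * a), ?_⟩
      have h1 : (x : quadOrder D) * b + y * (p : ℤ) = 1 := by
        exact_mod_cast congrArg (Int.cast : ℤ → quadOrder D) hxy
      have h2 : gen D - ((-(x * a) : ℤ) : quadOrder D)
          = (x : quadOrder D) * (a + b * gen D) + ((p : ℤ) : quadOrder D) * (y * gen D) := by
        push_cast at h1 ⊢
        linear_combination (-gen D) * h1
      rw [h2, add_smul, mul_smul]
      exact add_mem (Submodule.smul_mem _ _ hk) (mem_multiples_of_dvd (dvd_mul_right _ _) _)
  -- hence all eigenvalues agree, by comparing the eigenvalues of `u`, `v` and `u + v`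
  have key : ∃ r : ℤ, ∀ v : Λ, (gen D - r) • v ∈ multiples (D := D) Λ p := by
    by_cases hall : ∀ u : Λ, u ∈ multiples (D := D) Λ p
    · exact ⟨0, fun v => hall _⟩
    push Not at hall
    obtain ⟨u, hu⟩ := hall
    obtain ⟨r, hr⟩ := eig u
    refine ⟨r, fun v => ?_⟩
    obtain ⟨s, hs⟩ := eig v
    obtain ⟨t, ht⟩ := eig (u + v)
    have hcomb : ((r - t : ℤ) : quadOrder D) • u + ((s - t : ℤ) : quadOrder D) • v
        ∈ multiples (D := D) Λ p := by
      have : ((r - t : ℤ) : quadOrder D) • u + ((s - t : ℤ) : quadOrder D) • v =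
          (gen D - t) • (u + v) - (gen D - r) • u - (gen D - s) • v := by
        push_cast
        module
      rw [this]
      exact sub_mem (sub_mem ht hr) hs
    by_cases hst : (p : ℤ) ∣ s - t
    · have hrt : (p : ℤ) ∣ r - t := by
        by_contra hrt
        refine hu (mem_multiples_of_smul (int_isCoprime_of_prime hp hrt) ?_)
        refine (Submodule.add_mem_iff_left _ ?_).1 hcomb
        exact mem_multiples_of_dvd (intCast_dvd hst) _
      have : (gen D - r) • v = (gen D - s) • v + ((s - t - (r - t) : ℤ) : quadOrder D) • v := by
        push_cast; module
      rw [this]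
      exact add_mem hs (mem_multiples_of_dvd (intCast_dvd (dvd_sub hst hrt)) _)
    · refine mem_multiples_of_smul (int_isCoprime_of_prime hp hst) ?_
      have : ((s - t : ℤ) : quadOrder D) • (gen D - r) • v = (gen D - r) •
          (((r - t : ℤ) : quadOrder D) • u + ((s - t : ℤ) : quadOrder D) • v)
          - ((r - t : ℤ) : quadOrder D) • (gen D - r) • u := by
        module
      rw [this]
      exact sub_mem (Submodule.smul_mem _ _ hcomb) (Submodule.smul_mem _ _ hr)
  obtain ⟨r, hr⟩ := key
  obtain ⟨v, hv⟩ := h r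
  exact hv (hr v)

/-- Vectors with saturated lines at finitely many primes are combined by the Chinese remainder
theorem, since saturation at `p` depends on the vector modulo `p` only. -/
theorem exists_saturatedAt_finset
    (h : ∀ p : ℕ, p.Prime → ∃ u : Λ, SaturatedAt (D := D) p u) (s : Finset ℕ)
    (hs : ∀ p ∈ s, p.Prime) : ∃ u : Λ, ∀ p ∈ s, SaturatedAt (D := D) p u := by
  induction s using Finset.induction_on with
  | empty => exact ⟨0, by simp⟩
  | insert p s hps ih =>
    obtain ⟨v, hv⟩ := ih fun q hq => hs q (Finset.mem_insert_of_mem hq)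
    have hp := hs p (Finset.mem_insert_self _ _)
    obtain ⟨u, hu⟩ := h p hp
    have hcop : ∀ q ∈ s, Nat.Coprime p q := fun q hq =>
      (Nat.coprime_primes hp (hs q (Finset.mem_insert_of_mem hq))).2 fun h => hps (h ▸ hq)
    refine ⟨((∏ q ∈ s, q : ℕ) : ℤ) • u + (p : ℤ) • v, fun q hq => ?_⟩
    simp only [← Int.cast_smul_eq_zsmul (quadOrder D)]
    rcases Finset.mem_insert.1 hq with rfl | hq
    · refine SaturatedAt.congr (SaturatedAt.smul hu (c := ((∏ q ∈ s, q : ℕ) : ℤ)) ?_) ?_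
      · exact Nat.isCoprime_iff_coprime.2 (Nat.Coprime.prod_left fun i hi => (hcop i hi).symm)
      · rw [add_sub_cancel_left]
        exact mem_multiples_of_dvd (D := D) dvd_rfl v
    · refine SaturatedAt.congr
        (SaturatedAt.smul (hv q hq) (c := p) (Nat.isCoprime_iff_coprime.2 (hcop q hq))) ?_
      rw [add_sub_cancel_right]
      exact mem_multiples_of_dvd (D := D) (intCast_dvd
        (Int.natCast_dvd_natCast.2 (Finset.dvd_prod_of_mem (fun q => q) hq))) u

/-- Approximation: if there are saturated lines at each prime and `Λ` carries a nonzero alternating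
form, then some line is saturated at all primes. A vector `v` which is saturated at the primes
dividing the norm of `B(u₁, u₂)` is corrected by a multiple of `u₂`, so that at each other prime
its pairing with `u₁` or with `u₂` is prime to `p`. -/
theorem exists_saturatedAt_forall [IsNonsquareDisc D]
    (h : ∀ p : ℕ, p.Prime → ∃ u : Λ, SaturatedAt (D := D) p u)
    (B : Λ →ₗ[quadOrder D] Λ →ₗ[quadOrder D] quadOrder D) (hB : ∀ v, B v v = 0)
    (hne : ∃ u v, B u v ≠ 0) :
    ∃ u : Λ, ∀ p : ℕ, p.Prime → SaturatedAt (D := D) p u := by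
  obtain ⟨u₁, u₂, hδ⟩ := hne
  obtain ⟨δ', M, hM, hδM⟩ := exists_mul_eq_int hδ
  have hMO : (M : quadOrder D) ≠ 0 := by
    rw [← hδM]
    refine mul_ne_zero ?_ hδ
    rintro rfl
    rw [zero_mul] at hδM
    have := add_mul_gen_inj (D := D) (a := 0) (b := 0) (a' := M) (b' := 0) (by simpa using hδM)
    exact hM this.1.symm
  -- a vector which is good at the primes dividing `M`
  obtain ⟨v, hv, hvu⟩ : ∃ v : Λ, (∀ p ∈ M.natAbs.primeFactors, SaturatedAt (D := D) p v) ∧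
      B v u₂ ≠ 0 := by
    obtain ⟨v, hv⟩ := exists_saturatedAt_finset h M.natAbs.primeFactors
      fun p hp => Nat.prime_of_mem_primeFactors hp
    by_cases h0 : B v u₂ = 0
    · refine ⟨v + (M : quadOrder D) • u₁, fun p hp => (hv p hp).congr ?_, ?_⟩
      · rw [add_sub_cancel_left]
        exact mem_multiples_of_dvd (intCast_dvd
          (Int.natCast_dvd.2 (Nat.dvd_of_mem_primeFactors hp))) _
      · simp [h0, hMO, hδ]
    · exact ⟨v, hv, h0⟩
  obtain ⟨α', N, hN, hαN⟩ := exists_mul_eq_int hvu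
  -- the primes at which the value of the form at `(v, u₂)` does not show saturation
  set m : ℕ := ∏ p ∈ N.natAbs.primeFactors \ M.natAbs.primeFactors, p with hm
  have hcop : IsCoprime (M ^ 2) (m : ℤ) := by
    refine IsCoprime.pow_left ?_
    rw [hm, Nat.cast_prod]
    refine IsCoprime.prod_right fun p hp => ?_
    rw [Finset.mem_sdiff] at hp
    have hpp := Nat.prime_of_mem_primeFactors hp.1
    refine int_isCoprime_of_prime hpp fun hd => hp.2 ?_
    exact Nat.mem_primeFactors.2 ⟨hpp, Int.natCast_dvd.1 hd, by simpa using hM⟩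
  obtain ⟨s, t, hst⟩ := hcop
  have hst' : (s : quadOrder D) * M ^ 2 + t * (m : ℤ) = 1 := by
    exact_mod_cast congrArg (Int.cast : ℤ → quadOrder D) hst
  -- the correction term makes `δ' B(u₁, u)` congruent to `1` modulo `m`
  set b := δ' * B u₁ v
  set y : quadOrder D := s * (1 - b)
  refine ⟨v + ((M : quadOrder D) * y) • u₂, fun p hp => ?_⟩
  by_cases hpM : (p : ℤ) ∣ M
  · refine (hv p (Nat.mem_primeFactors.2 ⟨hp, Int.natCast_dvd.1 hpM, by simpa using hM⟩)).congr ?_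
    rw [add_sub_cancel_left]
    exact mem_multiples_of_dvd (dvd_mul_of_dvd_left
      (intCast_dvd hpM) _) _
  intro k hk
  obtain ⟨v', hv'⟩ := mem_multiples.1 hk
  by_cases hpN : (p : ℤ) ∣ N
  · have hpm : (p : ℤ) ∣ (m : ℤ) := by
      refine Int.natCast_dvd_natCast.2 (Finset.dvd_prod_of_mem _ (Finset.mem_sdiff.2 ⟨?_, ?_⟩))
      · exact Nat.mem_primeFactors.2 ⟨hp, Int.natCast_dvd.1 hpN, by simpa using hN⟩
      · exact fun h => hpM (Int.natCast_dvd.2 (Nat.dvd_of_mem_primeFactors h))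
    have h1 := congrArg (B u₁) hv'
    simp only [map_smul, map_add, smul_eq_mul] at h1
    have h2 : k = ((p : ℤ) : quadOrder D) * (δ' * B u₁ v')
        + ((m : ℤ) : quadOrder D) * (k * (t * (1 - b))) := by
      have e1 : δ' * B u₁ u₂ = M := hδM
      have e2 : δ' * B u₁ v = b := rfl
      have e3 : y = s * (1 - b) := rfl
      linear_combination (-δ') * h1 - k * M * y * e1 - k * e2 - k * (M : quadOrder D) ^ 2 * e3
        - k * (1 - b) * hst'
    rw [h2]
    exact dvd_add (dvd_mul_right _ _) (dvd_mul_of_dvd_left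
      (intCast_dvd hpm) _)
  · refine dvd_of_dvd_mul_int (int_isCoprime_of_prime hp hpN) ?_
    have h1 := congrArg (fun w => B w u₂) hv'
    simp only [map_smul, map_add, smul_eq_mul, LinearMap.smul_apply, LinearMap.add_apply,
      hB, mul_zero, add_zero] at h1
    refine ⟨α' * B v' u₂, ?_⟩
    linear_combination (-α') * h1 - k * hαN

variable [Module.IsTorsionFree ℤ Λ]

/-- A line which is saturated at all primes is a pure subgroup of `Λ`. -/
theorem dvd_of_saturatedAt {u : Λ} (hu : ∀ p : ℕ, p.Prime → SaturatedAt (D := D) p u)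
    {n : ℕ} (hn : n ≠ 0) (k : quadOrder D) (v : Λ) (h : k • u = n • v) :
    ∃ k' : quadOrder D, k = n * k' ∧ v = k' • u := by
  induction n using Nat.recOnMul generalizing k v with
  | zero => exact absurd rfl hn
  | one => exact ⟨k, by simp, by simpa using h.symm⟩
  | prime p hp =>
    obtain ⟨k', hk'⟩ := hu p hp k (mem_multiples.2 ⟨v, by
      rw [h, Int.cast_natCast, Nat.cast_smul_eq_nsmul]⟩)
    refine ⟨k', by simpa using hk', ?_⟩
    rw [hk', mul_smul, Int.cast_natCast, Nat.cast_smul_eq_nsmul, ← natCast_zsmul,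
      ← natCast_zsmul] at h
    exact (smul_right_injective Λ (by exact_mod_cast hn : (p : ℤ) ≠ 0) h).symm
  | mul a b ha hb =>
    obtain ⟨k₁, rfl, h₁⟩ := ha (left_ne_zero_of_mul hn) k (b • v) (by rw [h, mul_smul])
    obtain ⟨k₂, rfl, h₂⟩ := hb (right_ne_zero_of_mul hn) k₁ v h₁.symm
    exact ⟨k₂, by push_cast; ring, h₂⟩

/-- The order `𝓞_D` is Gorenstein: a saturated line `𝓞_D u` is a direct summand. A `ℤ`-linear
functional `λ` with `λ(x u) = tr(x / √D)` exists since `Λ / 𝓞_D u` is torsion free; it is turned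
into the `𝓞_D`-linear functional `v ↦ λ(γ v) - γ^σ λ(v)`. -/
theorem exists_functional_of_saturatedAt [IsNonsquareDisc D] [Module.Finite ℤ Λ] {u : Λ}
    (hu : ∀ p : ℕ, p.Prime → SaturatedAt (D := D) p u) :
    ∃ l : Λ →ₗ[quadOrder D] quadOrder D, l u = 1 := by
  let f : quadOrder D →ₗ[ℤ] Λ := (LinearMap.toSpanSingleton (quadOrder D) Λ u).restrictScalars ℤ
  have hf : ∀ k, f k = k • u := fun k => rfl
  have hfinj : Function.Injective f := by
    rw [← LinearMap.ker_eq_bot, LinearMap.ker_eq_bot']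
    intro k hk
    by_contra hk0
    obtain ⟨k', N, hN, h⟩ := exists_mul_eq_int hk0
    have h0 : (N : quadOrder D) • u = 0 := by rw [← h, mul_smul, ← hf, hk, smul_zero]
    have hu0 : u = 0 := by
      rw [Int.cast_smul_eq_zsmul] at h0
      exact (smul_eq_zero.1 h0).resolve_left hN
    obtain ⟨c, hc, -⟩ := dvd_of_saturatedAt hu (n := 2) two_ne_zero 1 0 (by simp [hu0])
    obtain ⟨a, b, rfl⟩ := exists_eq_add_mul_gen c
    have := (add_mul_gen_inj (D := D) (a := 1) (b := 0) (a' := 2 * a) (b' := 2 * b) (by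
      push_cast at hc ⊢; linear_combination hc)).1
    omega
  have : Module.IsTorsionFree ℤ (Λ ⧸ LinearMap.range f) := by
    rw [Module.isTorsionFree_iff_smul_eq_zero]
    intro n x hn
    obtain ⟨v, rfl⟩ := Submodule.Quotient.mk_surjective _ x
    by_cases hn0 : n = 0
    · exact .inl hn0
    right
    rw [← Submodule.Quotient.mk_smul, Submodule.Quotient.mk_eq_zero] at hn
    rw [Submodule.Quotient.mk_eq_zero]
    have : n.natAbs • v ∈ LinearMap.range f := by
      rcases Int.natAbs_eq n with h | h
      · rw [h, natCast_zsmul] at hn; exact hn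
      · rw [h, neg_smul, natCast_zsmul, neg_mem_iff] at hn; exact hn
    obtain ⟨k, hk⟩ := this
    obtain ⟨k', -, hk'⟩ := dvd_of_saturatedAt hu (n := n.natAbs) (by omega) k v hk
    exact ⟨k', hk'.symm⟩
  -- a splitting `s` of `Λ → Λ / 𝓞_D u` over `ℤ`, and the resulting retraction `g` onto `𝓞_D`
  obtain ⟨s, hs⟩ := Module.projective_lifting_property (LinearMap.range f).mkQ LinearMap.id
    (Submodule.mkQ_surjective _)
  let e := LinearEquiv.ofInjective f hfinj
  let g : Λ →ₗ[ℤ] quadOrder D := e.symm.toLinearMap ∘ₗ LinearMap.codRestrict (LinearMap.range f)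
    (LinearMap.id - s ∘ₗ (LinearMap.range f).mkQ) (fun v => by
      rw [← Submodule.Quotient.mk_eq_zero, ← Submodule.mkQ_apply]
      have := LinearMap.congr_fun hs ((LinearMap.range f).mkQ v)
      simp only [LinearMap.comp_apply, LinearMap.id_apply] at this
      simp only [LinearMap.sub_apply, LinearMap.id_apply, LinearMap.comp_apply, map_sub]
      rw [this, sub_self])
  have hg : ∀ k : quadOrder D, g (k • u) = k := by
    intro k
    apply e.injective
    ext1
    have : (LinearMap.range f).mkQ (k • u) = 0 := by
      rw [← LinearMap.mem_ker, Submodule.ker_mkQ]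
      exact ⟨k, rfl⟩
    simp [g, this, e, hf]
  let lam : Λ →+ ℤ := (genCoeff D).comp g.toAddMonoidHom
  have hlam : ∀ k : quadOrder D, lam (k • u) = genCoeff D k := fun k =>
    congrArg (genCoeff D) (hg k)
  let l₀ : Λ → quadOrder D := fun v => (lam (gen D • v) : quadOrder D) - D * (lam v : quadOrder D)
    + (lam v : quadOrder D) * gen D
  have hadd : ∀ v w, l₀ (v + w) = l₀ v + l₀ w := by
    intro v w
    simp only [l₀, smul_add, map_add, Int.cast_add]
    ring
  have hgen : ∀ v, l₀ (gen D • v) = gen D * l₀ v := by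
    intro v
    have : gen D • gen D • v = (D : ℤ) • (gen D • v) - (gamNorm D) • v := by
      rw [smul_smul, gen_mul_gen, sub_smul, mul_smul, Nat.cast_smul_eq_nsmul,
        Int.cast_smul_eq_zsmul, natCast_zsmul]
    simp only [l₀, this, map_sub, map_zsmul]
    push_cast
    simp only [smul_eq_mul]
    push_cast
    linear_combination (-(lam v : quadOrder D)) * gen_mul_gen D
  have hint : ∀ (a : ℤ) v, l₀ ((a : quadOrder D) • v) = a * l₀ v := by
    intro a v
    simp only [l₀, Int.cast_smul_eq_zsmul, smul_comm (gen D) a v, map_zsmul, smul_eq_mul]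
    push_cast
    ring
  refine ⟨{ toFun := l₀, map_add' := hadd, map_smul' := ?_ }, ?_⟩
  · intro x v
    obtain ⟨a, b, rfl⟩ := exists_eq_add_mul_gen x
    rw [add_smul, hadd, mul_smul, hint, hint, hgen]
    simp only [RingHom.id_apply, smul_eq_mul]
    ring
  · have h1 : lam u = 0 := by
      have := hlam 1
      rw [one_smul] at this
      rw [this]
      simpa using genCoeff_add_mul_gen (D := D) 1 0
    have h2 : lam (gen D • u) = 1 := by
      rw [hlam]
      simpa using genCoeff_add_mul_gen (D := D) 0 1
    simp [l₀, h1, h2]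

end Module

/-! ### Eigencoordinates on the universal cover -/

/-- The diagonal action of the field `K` on `ℂ²`, which extends `diagRho`. -/
def act (D : ℕ) : K D →+* Module.End ℂ V :=
  ((Matrix.toLinAlgEquiv' : Matrix (Fin 2) (Fin 2) ℂ ≃ₐ[ℂ] Module.End ℂ V) :
      Matrix (Fin 2) (Fin 2) ℂ →+* Module.End ℂ V).comp
    ((Matrix.diagonalRingHom (Fin 2) ℂ).comp
      (RingHom.pi fun i => Complex.ofRealHom.comp (emb D i)))

theorem act_apply (k : K D) (c : V) (i : Fin 2) : act D k c i = (emb D i k : ℂ) * c i := by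
  simp [act, Matrix.mulVec_diagonal]

theorem diagRho_eq_act (x : quadOrder D) : diagRho D x = act D x := by
  refine LinearMap.ext fun c => ?_
  ext i
  rw [diagRho_apply, act_apply]

theorem emb_gam_sub_emb_gam (D : ℕ) : emb D 0 (gam D) - emb D 1 (gam D) = Real.sqrt D := by
  simp [emb_one_apply, emb_zero_apply, gam]; ring

theorem irrational_emb_gam [IsNonsquareDisc D] (i : Fin 2) : Irrational (emb D i (gam D)) := by
  rintro ⟨q, hq⟩
  rw [← emb_ratCast (D := D) i] at hq
  have := congrArg QuadraticAlgebra.im (emb_injective D i hq)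
  simp [gam] at this

/-- No lattice vector is an eigenvector of `γ`: its images under the powers of `γ - ⌊c⌋`, where
`c` is the eigenvalue, would tend to zero. -/
theorem TorusData.IsRM.eq_zero_of_eigenvector {T : TorusData D} {d₁ d₂ : ℕ} (hT : T.IsRM d₁ d₂)
    {v : V} (hv : v ∈ T.lattice) {c : ℝ} (hc : Irrational c)
    (h : T.rho (gen D) v = (c : ℂ) • v) : v = 0 := by
  by_contra hv0
  have hd := hT.discrete
  have hopen : IsOpen ({0} : Set T.lattice) := isOpen_discrete _
  rw [Metric.isOpen_singleton_iff] at hopen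
  obtain ⟨ε, hε, hball⟩ := hopen
  set m : ℤ := ⌊c⌋
  have h0 : 0 < c - m := by
    refine lt_of_le_of_ne (sub_nonneg.2 (Int.floor_le c)) fun h => hc ⟨m, ?_⟩
    push_cast; linarith
  have h1 : c - m < 1 := by linarith [Int.lt_floor_add_one c]
  have hpow : ∀ k : ℕ, (((c - m : ℝ) : ℂ) ^ k) • v ∈ T.lattice := by
    intro k
    induction k with
    | zero => simpa using hv
    | succ k ih =>
      have h2 := hT.maps (gen D - (m : quadOrder D)) _ ih
      rw [map_smul, map_sub, map_intCast, LinearMap.sub_apply, h] at h2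
      convert h2 using 1
      have : ((m : Module.End ℂ V) v) = ((m : ℝ) : ℂ) • v := by
        ext i
        simp
      rw [this]
      push_cast
      rw [pow_succ, mul_smul, sub_smul]
  have hlim : Filter.Tendsto (fun k : ℕ => (((c - m : ℝ) : ℂ) ^ k) • v) Filter.atTop (nhds 0) := by
    have := tendsto_pow_atTop_nhds_zero_of_norm_lt_one (x := ((c - m : ℝ) : ℂ)) (by
      rw [Complex.norm_real, Real.norm_of_nonneg h0.le]; exact h1)
    simpa using this.smul_const v
  obtain ⟨k, hk⟩ := ((Metric.tendsto_nhds.1 hlim) ε hε).exists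
  have := hball ⟨_, hpow k⟩ (by simpa [Subtype.dist_eq] using hk)
  have h3 : (((c - m : ℝ) : ℂ) ^ k) • v = 0 := congrArg Subtype.val this
  rcases smul_eq_zero.1 h3 with h4 | h4
  · exact h0.ne' (Complex.ofReal_eq_zero.1 (by
      by_contra h5; exact pow_ne_zero k h5 h4))
  · exact hv0 h4

/-- Eigencoordinates of `(A, H, ρ)` in which the lattice vector `v` is `(1, 1)`: the action of
`𝓞_D` becomes diagonal, and so does the Hermitian form. -/
theorem TorusData.IsRM.exists_coordinates [IsNonsquareDisc D] {T : TorusData D} {d₁ d₂ : ℕ}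
    (hT : T.IsRM d₁ d₂) {v : V} (hv : v ∈ T.lattice) (hv0 : v ≠ 0) :
    ∃ (F : V ≃ₗ[ℂ] V) (h : Fin 2 → ℝ), (∀ i, F v i = 1) ∧
      (∀ (x : quadOrder D) (w : V), F (T.rho x w) = diagRho D x (F w)) ∧ (∀ i, 0 < h i) ∧
      ∀ w w' : V, T.form w w' = ∑ i, (h i : ℂ) * (F w i * conj (F w' i)) := by
  -- the eigenvalues of `γ` are its two real conjugates `g i`
  set g : Fin 2 → ℝ := fun i => emb D i (gam D) with hg
  set s : ℝ := Real.sqrt D with hs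
  have hs0 : (s : ℂ) ≠ 0 := by exact_mod_cast (sqrt_pos D).ne'
  have hgs : (g 0 : ℂ) - g 1 = s := by exact_mod_cast emb_gam_sub_emb_gam D
  set G := T.rho (gen D) with hG
  have hGG : ∀ w, G (G w) = ((g 0 : ℂ) + g 1) • G w - ((g 0 : ℂ) * g 1) • w := by
    intro w
    have h1 : G * G = (D : Module.End ℂ V) * G - (gamNorm D : Module.End ℂ V) := by
      rw [hG, ← map_mul, gen_mul_gen]; simp
    have h2 := LinearMap.congr_fun h1 w
    have e1 : g 0 + g 1 = D := by
      simp [hg, emb_one_apply, emb_zero_apply, gam]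
      ring
    have e2 : g 0 * g 1 = gamNorm D := by
      have h4 : (4 : ℝ) * gamNorm D = (D : ℝ) ^ 2 - D := by exact_mod_cast four_mul_gamNorm D
      have hs : Real.sqrt D ^ 2 = D := Real.sq_sqrt (Nat.cast_nonneg D)
      simp [hg, emb_one_apply, emb_zero_apply, gam]
      nlinarith
    have e1' : (g 0 : ℂ) + g 1 = D := by exact_mod_cast e1
    have e2' : (g 0 : ℂ) * g 1 = gamNorm D := by exact_mod_cast e2
    rw [e1', e2']
    ext i
    have := congrFun h2 i
    simpa using this
  -- the components of `v` in the two eigenspaces; neither vanishes, as otherwise `v` would be an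
  -- eigenvector in the lattice
  set e : Fin 2 → V := ![(s : ℂ)⁻¹ • (G v - (g 1 : ℂ) • v), (s : ℂ)⁻¹ • ((g 0 : ℂ) • v - G v)]
    with he
  have he0 : e 0 = (s : ℂ)⁻¹ • (G v - (g 1 : ℂ) • v) := rfl
  have he1 : e 1 = (s : ℂ)⁻¹ • ((g 0 : ℂ) • v - G v) := rfl
  have heig : ∀ i, G (e i) = (g i : ℂ) • e i := by
    refine Fin.forall_fin_two.2 ⟨?_, ?_⟩
    · rw [he0, map_smul, map_sub, map_smul, hGG]
      module
    · rw [he1, map_smul, map_sub, map_smul, hGG]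
      module
  have hsum : e 0 + e 1 = v := by
    rw [he0, he1, ← smul_add]
    have : G v - (g 1 : ℂ) • v + ((g 0 : ℂ) • v - G v) = (s : ℂ) • v := by
      rw [← hgs]; module
    rw [this, smul_smul, inv_mul_cancel₀ hs0, one_smul]
  have hne : ∀ i, e i ≠ 0 := by
    refine Fin.forall_fin_two.2 ⟨fun h0 => ?_, fun h0 => ?_⟩
    · refine hv0 (hT.eq_zero_of_eigenvector hv (irrational_emb_gam (D := D) 1) ?_)
      rw [he0, smul_eq_zero, inv_eq_zero, or_iff_right hs0, sub_eq_zero] at h0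
      exact h0
    · refine hv0 (hT.eq_zero_of_eigenvector hv (irrational_emb_gam (D := D) 0) ?_)
      rw [he1, smul_eq_zero, inv_eq_zero, or_iff_right hs0, sub_eq_zero] at h0
      exact h0.symm
  have hgne : (g 0 : ℂ) ≠ g 1 := by
    intro h; rw [h, sub_self] at hgs; exact hs0 hgs.symm
  have hli : LinearIndependent ℂ e := by
    have : e = ![e 0, e 1] := by ext i j; fin_cases i <;> rfl
    rw [this, LinearIndependent.pair_iff]
    intro a b hab
    have h1 := congrArg G hab
    simp only [map_add, map_smul, heig, map_zero] at h1
    have h2 : (a * (g 0 - g 1)) • e 0 = 0 := by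
      have : (a * ((g 0 : ℂ) - g 1)) • e 0 = (a • (g 0 : ℂ) • e 0 + b • (g 1 : ℂ) • e 1)
        - (g 1 : ℂ) • (a • e 0 + b • e 1) := by module
      rw [this, h1, hab]; simp
    have ha : a = 0 := by
      simpa [hne 0, sub_eq_zero, hgne] using h2
    refine ⟨ha, ?_⟩
    rw [ha] at hab
    simpa [hne 1] using hab
  set b := basisOfLinearIndependentOfCardEqFinrank hli (by simp) with hb
  have hbe : ∀ i, b i = e i := fun i => by simp [hb]
  have hdec : ∀ w, w = b.equivFun w 0 • e 0 + b.equivFun w 1 • e 1 := by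
    intro w
    conv_lhs => rw [← b.sum_equivFun w]
    simp [Fin.sum_univ_two, hbe]
  have hFe : ∀ i j, b.equivFun (e i) j = if i = j then 1 else 0 := by
    intro i j
    rw [← hbe, b.equivFun_self]
  have hFG : ∀ w i, b.equivFun (G w) i = g i * b.equivFun w i := by
    intro w i
    conv_lhs => rw [hdec w]
    simp only [map_add, map_smul, heig, Pi.add_apply, Pi.smul_apply, hFe, smul_eq_mul]
    fin_cases i <;> simp [mul_comm]
  -- the eigenspaces are orthogonal since `γ` is self-adjoint
  have hH : ∀ i j, i ≠ j → T.form (e i) (e j) = 0 := by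
    intro i j hij
    have := hT.selfAdjoint (gen D) (e i) (e j)
    rw [← hG, heig, heig, map_smul, LinearMap.smul_apply, map_smulₛₗ] at this
    simp only [Complex.conj_ofReal, smul_eq_mul] at this
    have h1 : (g i : ℂ) ≠ g j := by
      fin_cases i <;> fin_cases j <;> first | exact absurd rfl hij | exact hgne | exact hgne.symm
    have h2 : ((g i : ℂ) - g j) * T.form (e i) (e j) = 0 := by linear_combination this
    exact (mul_eq_zero.1 h2).resolve_left (sub_ne_zero.2 h1)
  refine ⟨b.equivFun, fun i => (T.form (e i) (e i)).re, ?_, ?_, fun i => hT.pos _ (hne i), ?_⟩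
  · intro i
    rw [← hsum, map_add, Pi.add_apply, hFe, hFe]
    fin_cases i <;> simp
  · intro x w
    obtain ⟨p, q, rfl⟩ := exists_eq_add_mul_gen x
    ext i
    rw [diagRho_apply, map_add, map_mul, map_intCast, map_intCast, LinearMap.add_apply, map_add,
      Pi.add_apply, Module.End.mul_apply]
    have hi : ∀ (p : ℤ) (w : V), ((p : Module.End ℂ V) w) = (p : ℂ) • w := fun p w => by
      ext i; simp
    rw [hi, hi, map_smul, map_smul, Pi.smul_apply, Pi.smul_apply, hFG]
    simp only [smul_eq_mul, Subring.coe_add, SubringClass.coe_intCast, Subring.coe_mul, coe_gen,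
      map_add, map_mul, map_intCast]
    push_cast
    ring
  · intro w w'
    have hre : ∀ i, (((T.form (e i) (e i)).re : ℝ) : ℂ) = T.form (e i) (e i) := fun i =>
      Complex.conj_eq_iff_re.1 (hT.hermitian (e i) (e i)).symm
    conv_lhs => rw [hdec w, hdec w']
    simp only [map_add, LinearMap.add_apply, map_smul, LinearMap.smul_apply, map_smulₛₗ,
      hH 0 1 (by decide), hH 1 0 (by decide), Fin.sum_univ_two, hre, smul_eq_mul]
    ring

/-! ### Frames -/

theorem mem_pairModule {𝔞 : Ideal (quadOrder D)} {u : K D × K D} :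
    u ∈ pairModule 𝔞 ↔ u.1 ∈ quadOrder D ∧ u.2 ∈ scaledIdeal 𝔞 := Iff.rfl

theorem smul_mem_pairModule {𝔞 : Ideal (quadOrder D)} {u : K D × K D} (hu : u ∈ pairModule 𝔞)
    (x : quadOrder D) : (x : K D) • u ∈ pairModule 𝔞 :=
  ⟨(quadOrder D).mul_mem x.2 hu.1, (scaledIdeal 𝔞).smul_mem x hu.2⟩

theorem tracePairing_eq_emb (u v : K D × K D) :
    (tracePairing u v : ℝ) = ∑ i, emb D i (v.1 * u.2 - u.1 * v.2) := by
  rw [tracePairing, trace_eq_emb_add, Fin.sum_univ_two]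

theorem eq_zero_of_tracePairing [IsNonsquareDisc D] {u : K D × K D}
    (h : ∀ v, tracePairing u v = 0) : u = 0 := by
  ext1
  · apply trace_mul_eq_zero
    · have := h (0, -1)
      simpa [tracePairing] using this
    · have := h (0, -gam D)
      simpa [tracePairing, mul_comm] using this
  · apply trace_mul_eq_zero
    · have := h (1, 0)
      simpa [tracePairing] using this
    · have := h (gam D, 0)
      simpa [tracePairing] using this

/-- A frame of `(A, H, ρ)`: an `𝓞_D`-linear identification `j` of `𝓞_D ⊕ (1/√D) 𝔞` with the lattice
which turns the trace pairing into `Im H`. It is encoded through its extension to `K²`; injectivity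
follows from the nondegeneracy of the trace pairing. -/
structure IsFrame (T : TorusData D) (𝔞 : Ideal (quadOrder D)) (j : K D × K D →+ V) : Prop where
  mem_lattice : ∀ v, v ∈ T.lattice ↔ ∃ u ∈ pairModule 𝔞, j u = v
  map_rho : ∀ (x : quadOrder D) u, j ((x : K D) • u) = T.rho x (j u)
  form : ∀ u v, (T.form (j u) (j v)).im = tracePairing u v

theorem IsFrame.injective [IsNonsquareDisc D] {T : TorusData D} {𝔞 : Ideal (quadOrder D)}
    {j : K D × K D →+ V} (hj : IsFrame T 𝔞 j) : Function.Injective j := by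
  rw [injective_iff_map_eq_zero]
  intro u hu
  refine eq_zero_of_tracePairing fun v => ?_
  have := hj.form u v
  rw [hu, map_zero, LinearMap.zero_apply, Complex.zero_im] at this
  exact_mod_cast this.symm

theorem phi_apply (z : ℍ × ℍ) (u : K D × K D) (i : Fin 2) :
    phi D z u i = (emb D i u.1 : ℂ) + (emb D i u.2 : ℂ) * ((![(z.1 : ℂ), (z.2 : ℂ)] : V) i) := by
  fin_cases i <;> rfl

theorem torusForm_apply (z : ℍ × ℍ) (v w : V) :
    torusForm z v w = v 0 * conj (w 0) / (z.1.im : ℂ) + v 1 * conj (w 1) / (z.2.im : ℂ) := rfl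

theorem phi_smul (z : ℍ × ℍ) (k : K D) (u : K D × K D) :
    phi D z (k • u) = act D k (phi D z u) := by
  ext i
  rw [act_apply, phi_apply, phi_apply]
  simp only [Prod.smul_fst, Prod.smul_snd, smul_eq_mul, map_mul]
  push_cast
  ring

theorem isFrame_phi (𝔞 : Ideal (quadOrder D)) (z : ℍ × ℍ) : IsFrame (torusAt 𝔞 z) 𝔞 (phi D z) where
  mem_lattice v := Iff.rfl
  map_rho x u := by rw [phi_smul, ← diagRho_eq_act]; rfl
  form u v := torusForm_phi_im z u v

/-- Isometric lattices have the same types. The values of the two forms may lie in different rings;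
only their integral values matter. -/
theorem hasType_of_equiv {M M' R R' : Type} [AddCommGroup M] [AddCommGroup M'] [Ring R] [Ring R']
    {Λ : Submodule ℤ M} {Λ' : Submodule ℤ M'} {E : M → M → R} {E' : M' → M' → R'} (e : Λ ≃ₗ[ℤ] Λ')
    (he : ∀ (u v : Λ) (n : ℤ), E u v = n → E' (e u) (e v) = n) {d₁ d₂ : ℕ}
    (h : HasType Λ E d₁ d₂) : HasType Λ' E' d₁ d₂ := by
  obtain ⟨b, hb⟩ := h
  refine ⟨b.map e, fun i j => ⟨?_, ?_, ?_, ?_⟩⟩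
  · simpa using he (b (.inl i)) (b (.inl j)) 0 (by simpa using (hb i j).1)
  · simpa using he (b (.inr i)) (b (.inr j)) 0 (by simpa using (hb i j).2.1)
  · simpa using he (b (.inl i)) (b (.inr j)) (if i = j then ((![d₁, d₂] i : ℕ) : ℤ) else 0)
      (by rw [(hb i j).2.2.1]; split_ifs <;> simp)
  · simpa using he (b (.inr j)) (b (.inl i)) (-(if i = j then ((![d₁, d₂] i : ℕ) : ℤ) else 0))
      (by rw [(hb i j).2.2.2]; split_ifs <;> simp)

/-- The identification of the lattices given by a frame. -/
def IsFrame.equiv [IsNonsquareDisc D] {T : TorusData D} {𝔞 : Ideal (quadOrder D)}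
    {j : K D × K D →+ V} (hj : IsFrame T 𝔞 j) : pairModule 𝔞 ≃ₗ[ℤ] T.lattice :=
  LinearEquiv.ofBijective ((j.toIntLinearMap.comp (pairModule 𝔞).subtype).codRestrict T.lattice
    fun u => (hj.mem_lattice _).2 ⟨u, u.2, rfl⟩)
    ⟨fun u v h => Subtype.ext (hj.injective (congrArg Subtype.val h)), fun v => by
      obtain ⟨u, hu, h⟩ := (hj.mem_lattice v.1).1 v.2
      exact ⟨⟨u, hu⟩, Subtype.ext h⟩⟩

theorem IsFrame.coe_equiv [IsNonsquareDisc D] {T : TorusData D} {𝔞 : Ideal (quadOrder D)}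
    {j : K D × K D →+ V} (hj : IsFrame T 𝔞 j) (u : pairModule 𝔞) : (hj.equiv u : V) = j u := rfl

theorem IsFrame.hasType_iff [IsNonsquareDisc D] {T : TorusData D} {𝔞 : Ideal (quadOrder D)}
    {j : K D × K D →+ V} (hj : IsFrame T 𝔞 j) {d₁ d₂ : ℕ} :
    HasType T.lattice (fun v w => (T.form v w).im) d₁ d₂ ↔ IdealHasType 𝔞 d₁ d₂ := by
  constructor
  · refine hasType_of_equiv hj.equiv.symm fun u v n h => ?_
    obtain ⟨u, rfl⟩ := hj.equiv.surjective u
    obtain ⟨v, rfl⟩ := hj.equiv.surjective v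
    rw [hj.coe_equiv, hj.coe_equiv, hj.form] at h
    rw [hj.equiv.symm_apply_apply, hj.equiv.symm_apply_apply]
    exact_mod_cast h
  · refine hasType_of_equiv hj.equiv fun u v n h => ?_
    rw [hj.coe_equiv, hj.coe_equiv, hj.form, h]
    simp

theorem exists_ne_zero_mem {T : TorusData D} {d₁ d₂ : ℕ} (hT : T.IsRM d₁ d₂) :
    ∃ v ∈ T.lattice, v ≠ 0 := by
  by_contra! h
  have h1 : (T.lattice : Set V) ⊆ {0} := fun v hv => h v hv
  have h2 := Submodule.span_mono (R := ℝ) h1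
  rw [hT.span_top, Submodule.span_singleton_eq_bot.2 rfl, top_le_iff] at h2
  exact bot_ne_top h2

/-- The point `z ∈ ℍ²` of a frame: `T` is isomorphic to the surface at `z`. In eigencoordinates
with `j (1, 0) = (1, 1)` it is the vector `j (0, 1)`. Applying `γ` minus its `(1 - i)`-th conjugate
isolates the `i`-th eigencomponent up to a factor, so that `z i` is characterized without
coordinates; this form of the statement shows that `z` varies holomorphically in families. -/
theorem IsFrame.exists_isIso [IsNonsquareDisc D] {T : TorusData D} {𝔞 : Ideal (quadOrder D)}
    {j : K D × K D →+ V} (hj : IsFrame T 𝔞 j) {d₁ d₂ : ℕ} (hT : T.IsRM d₁ d₂) :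
    ∃ z : ℍ × ℍ, IsIso T (torusAt 𝔞 z) ∧ ∀ i : Fin 2,
      T.rho (gen D) (j (1, 0)) - (emb D (1 - i) (gam D) : ℂ) • j (1, 0) ≠ 0 ∧
      T.rho (gen D) (j (0, 1)) - (emb D (1 - i) (gam D) : ℂ) • j (0, 1) =
        ((![(z.1 : ℂ), (z.2 : ℂ)] : V) i) •
          (T.rho (gen D) (j (1, 0)) - (emb D (1 - i) (gam D) : ℂ) • j (1, 0)) := by
  have hmem : j (1, 0) ∈ T.lattice :=
    (hj.mem_lattice _).2 ⟨(1, 0), ⟨(quadOrder D).one_mem, (scaledIdeal 𝔞).zero_mem⟩, rfl⟩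
  have hne : j (1, 0) ≠ 0 := by
    rw [Ne, map_eq_zero_iff j hj.injective]
    simp
  obtain ⟨F, h, hF1, hF, hpos, hform⟩ := hT.exists_coordinates hmem hne
  set w : V := F (j (0, 1)) with hw
  -- `j` is linear over `K`, by clearing denominators
  have hlin : ∀ (k : K D) (u : K D × K D), F (j (k • u)) = act D k (F (j u)) := by
    intro k u
    obtain ⟨N, hN, hNk⟩ := exists_int_mul_mem k
    have h1 := hj.map_rho ⟨_, hNk⟩ u
    have h2 := hj.map_rho ((N : ℕ) : quadOrder D) (k • u)
    rw [smul_smul] at h2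
    have h3 := h2.symm.trans h1
    have h4 := congrArg F h3
    rw [hF, hF, diagRho_eq_act, diagRho_eq_act] at h4
    simp only [map_mul, map_natCast, Module.End.mul_apply, SubringClass.coe_natCast] at h4
    ext i
    have h5 := congrFun h4 i
    have hN' : (N : ℂ) ≠ 0 := by exact_mod_cast hN.ne'
    simpa [hN'] using h5
  have hc : ∀ (u : K D × K D) i, F (j u) i = (emb D i u.1 : ℂ) + emb D i u.2 * w i := by
    intro u i
    have : u = u.1 • ((1, 0) : K D × K D) + u.2 • ((0, 1) : K D × K D) := by ext1 <;> simp
    conv_lhs => rw [this]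
    rw [map_add, map_add, hlin, hlin, Pi.add_apply, act_apply, act_apply, hF1, mul_one]
  -- compare the values of the form at `(1, 0)` and `(0, y)`, for `y = 1` and `y = γ`
  have hw1 : ∀ i, h i * (w i).im = 1 := by
    have key : ∀ y : K D, ∑ i, emb D i y * (1 - h i * (w i).im) = 0 := by
      intro y
      have h1 := hj.form (1, 0) (0, y)
      rw [hform, tracePairing_eq_emb] at h1
      simp only [hc, Complex.im_sum] at h1
      simp only [Fin.sum_univ_two] at h1 ⊢
      simp at h1
      linarith
    have k1 := key 1
    have k2 := key (gam D)
    simp only [Fin.sum_univ_two, map_one, one_mul] at k1 k2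
    have hs : emb D 0 (gam D) - emb D 1 (gam D) ≠ 0 := by
      rw [emb_gam_sub_emb_gam]; exact (sqrt_pos D).ne'
    have k3 : (emb D 0 (gam D) - emb D 1 (gam D)) * (1 - h 0 * (w 0).im) = 0 := by
      linear_combination k2 - emb D 1 (gam D) * k1
    have k4 := (mul_eq_zero.1 k3).resolve_left hs
    refine Fin.forall_fin_two.2 ⟨by linarith, by linarith⟩
  have hwpos : ∀ i, 0 < (w i).im := by
    intro i
    have := hw1 i
    have hp := hpos i
    by_contra hle
    nlinarith
  set z : ℍ × ℍ := (⟨w 0, hwpos 0⟩, ⟨w 1, hwpos 1⟩) with hz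
  have hzw : (![(z.1 : ℂ), (z.2 : ℂ)] : V) = w := by
    ext i; fin_cases i <;> rfl
  have hphi : ∀ u, F (j u) = phi D z u := by
    intro u
    ext i
    rw [hc, phi_apply, hzw]
  refine ⟨z, ⟨F, fun v => ?_, fun v v' => ?_, fun x v => hF x v⟩, fun i => ?_⟩
  · rw [hj.mem_lattice, (isFrame_phi 𝔞 z).mem_lattice]
    refine exists_congr fun u => and_congr_right fun _ => ?_
    rw [← hphi, F.injective.eq_iff]
  · rw [hform]
    have e : ∀ i, (h i : ℂ) = ((w i).im : ℂ)⁻¹ := by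
      intro i
      rw [← Complex.ofReal_inv]
      congr 1
      exact eq_inv_of_mul_eq_one_left (hw1 i)
    change torusForm z (F v) (F v') = _
    rw [torusForm_apply, Fin.sum_univ_two, e, e, div_eq_inv_mul, div_eq_inv_mul]
    rfl
  · have hs : emb D i (gam D) - emb D (1 - i) (gam D) ≠ 0 := by
      have h1 := emb_gam_sub_emb_gam D
      have h2 := sqrt_pos D
      fin_cases i <;> simp [sub_eq_zero] <;> intro h3 <;> rw [h3] at h1 <;> simp at h1 <;> linarith
    have hdiff : ∀ (u : K D × K D) l,
        F (T.rho (gen D) (j u) - (emb D (1 - i) (gam D) : ℂ) • j u) l =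
        if l = i then ((emb D i (gam D) - emb D (1 - i) (gam D) : ℝ) : ℂ) * F (j u) l else 0 := by
      intro u l
      rw [map_sub, hF, map_smul, Pi.sub_apply, diagRho_apply, Pi.smul_apply, smul_eq_mul, coe_gen,
        ← sub_mul]
      split_ifs with hl
      · rw [hl]; push_cast; rfl
      · have : l = 1 - i := by
          revert hl; fin_cases i <;> fin_cases l <;> simp
        rw [this, sub_self, zero_mul]
    constructor
    · intro h0
      have h1 := hdiff (1, 0) i
      rw [h0, map_zero, Pi.zero_apply, if_pos rfl, hF1, mul_one] at h1
      exact hs (by exact_mod_cast h1.symm)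
    · apply F.injective
      ext l
      rw [hdiff, map_smul, Pi.smul_apply, hdiff, hF1, hzw, smul_eq_mul]
      split_ifs with hl
      · rw [hl]; ring
      · simp

/-! ### Every surface with real multiplication has a frame -/

/-- Properness of `ρ`: the multiplier ring of the lattice is `𝓞_D`. Otherwise it would be a larger
order to which the action extends. -/
theorem TorusData.IsRM.mem_quadOrder_of_forall_mem [IsNonsquareDisc D] {T : TorusData D}
    {d₁ d₂ : ℕ} (hT : T.IsRM d₁ d₂) {F : V ≃ₗ[ℂ] V}
    (hF : ∀ (x : quadOrder D) (w : V), F (T.rho x w) = diagRho D x (F w)) {v₀ : V}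
    (hv₀ : v₀ ∈ T.lattice) (hv₀F : ∀ i, F v₀ i = 1) {k : K D}
    (hk : ∀ v ∈ T.lattice, F.symm (act D k (F v)) ∈ T.lattice) : k ∈ quadOrder D := by
  let S : Subring (K D) :=
    { carrier := {k | ∀ v ∈ T.lattice, F.symm (act D k (F v)) ∈ T.lattice}
      mul_mem' := fun {a b} ha hb v hv => by
        simpa using ha _ (hb v hv)
      one_mem' := fun v hv => by simpa using hv
      add_mem' := fun {a b} ha hb v hv => by
        simpa using add_mem (ha v hv) (hb v hv)
      zero_mem' := fun v hv => by simp
      neg_mem' := fun {a} ha v hv => by simpa using ha v hv }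
  have hS : ∀ k, k ∈ S ↔ ∀ v ∈ T.lattice, F.symm (act D k (F v)) ∈ T.lattice := fun k => Iff.rfl
  have hle : quadOrder D ≤ S := fun x hx => (hS x).2 fun v hv => by
    have := hF ⟨x, hx⟩ v
    rw [diagRho_eq_act] at this
    rw [← this, F.symm_apply_apply]
    exact hT.maps _ v hv
  by_contra hkO
  refine hT.proper ⟨S, lt_of_le_of_ne hle fun h => hkO (h ▸ (hS k).2 hk),
    ((F.symm.conjRingEquiv : Module.End ℂ V →+* Module.End ℂ V).comp (act D)).comp S.subtype,
    ⟨?_, ?_⟩, ?_, fun x v hv => ?_, fun x => ?_⟩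
  · -- `S` embeds into the lattice by `k ↦ k v₀`
    have := hT.discrete
    let f : S.toAddSubgroup.toIntSubmodule →ₗ[ℤ] T.lattice := AddMonoidHom.toIntLinearMap
      { toFun := fun k => ⟨F.symm (act D k.1 (F v₀)), k.2 v₀ hv₀⟩
        map_zero' := by ext1; simp
        map_add' := fun a b => by ext1; simp }
    have hf : Function.Injective f := by
      intro a b hab
      have h1 := F.symm.injective (congrArg Subtype.val hab)
      have h2 := congrFun h1 0
      rw [act_apply, act_apply, hv₀F, mul_one, mul_one] at h2
      exact Subtype.ext (emb_injective D 0 (by exact_mod_cast h2))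
    have h1 : Module.Finite ℤ S.toAddSubgroup.toIntSubmodule := Module.Finite.of_injective f hf
    have h2 := Module.Finite.iff_fg.1 h1
    exact (Submodule.fg_iff_addSubgroup_fg _).1 h2
  · rw [eq_top_iff]
    intro x _
    obtain ⟨N, hN, hNx⟩ := exists_int_mul_mem x
    have : x = (1 / (N : ℚ)) • ((N : K D) * x) := by
      have : (N : ℚ) ≠ 0 := by exact_mod_cast hN.ne'
      ext <;> simp <;> field_simp
    rw [this]
    exact Submodule.smul_mem _ _ (Submodule.subset_span (hle hNx))
  · intro a b hab
    have h1 := LinearMap.congr_fun hab v₀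
    have h2 : act D a (F v₀) = act D b (F v₀) := F.symm.injective h1
    have h2 := congrFun h2 0
    rw [act_apply, act_apply, hv₀F, mul_one, mul_one] at h2
    exact Subtype.ext (emb_injective D 0 (by exact_mod_cast h2))
  · exact x.2 v hv
  · refine LinearMap.ext fun v => ?_
    have := hF x v
    rw [diagRho_eq_act] at this
    change F.symm (act D x (F v)) = _
    rw [← this, F.symm_apply_apply]

/-- The action of `𝓞_D` on the lattice. -/
@[reducible] def TorusData.latticeModule (T : TorusData D)
    (h : ∀ (x : quadOrder D), ∀ v ∈ T.lattice, T.rho x v ∈ T.lattice) :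
    Module (quadOrder D) T.lattice where
  smul x v := ⟨T.rho x v, h x v v.2⟩
  one_smul v := Subtype.ext (by change T.rho 1 v = v; simp)
  mul_smul x y v := Subtype.ext (by change T.rho (x * y) v = T.rho x (T.rho y v); simp)
  smul_zero x := Subtype.ext (map_zero (T.rho x))
  smul_add x v w := Subtype.ext (map_add (T.rho x) v.1 w.1)
  add_smul x y v := Subtype.ext (by change T.rho (x + y) v = T.rho x v + T.rho y v; simp)
  zero_smul v := Subtype.ext (by change T.rho 0 v = 0; simp)

/-- A vector with nonzero `i`-th coordinate pairs nontrivially with the lattice under the `i`-th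
summand of the alternating form. -/
theorem TorusData.IsRM.exists_im_ne_zero {T : TorusData D} {d₁ d₂ : ℕ} (hT : T.IsRM d₁ d₂)
    {F : V ≃ₗ[ℂ] V} {v₀ : V} (hv₀F : ∀ i, F v₀ i ≠ 0) (i : Fin 2) :
    ∃ w ∈ T.lattice, (F v₀ i * conj (F w i)).im ≠ 0 := by
  by_contra! h
  -- otherwise the lattice lies in a real hyperplane
  let l : V →ₗ[ℝ] ℝ := Complex.imLm ∘ₗ (LinearMap.mulLeft ℝ (conj (F v₀ i))) ∘ₗ
    (LinearMap.proj i ∘ₗ (F : V →ₗ[ℂ] V)).restrictScalars ℝ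
  have hl : ∀ w, l w = (conj (F v₀ i) * F w i).im := fun w => rfl
  have h1 : Submodule.span ℝ (T.lattice : Set V) ≤ LinearMap.ker l := by
    rw [Submodule.span_le]
    intro w hw
    have := h w hw
    rw [SetLike.mem_coe, LinearMap.mem_ker, hl]
    simp at this ⊢
    linarith
  rw [hT.span_top, top_le_iff] at h1
  have h2 : l (F.symm (Complex.I • F v₀)) = 0 := by
    rw [← LinearMap.mem_ker, h1]; trivial
  rw [hl] at h2
  simp at h2
  have h3 : Complex.normSq (F v₀ i) = 0 := by rw [Complex.normSq_apply]; linarith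
  exact hv₀F i (Complex.normSq_eq_zero.1 h3)

/-- Every polarized abelian surface with real multiplication has a frame. In eigencoordinates, `Im
H` is the sum of two alternating forms `t 0` and `t 1`, which are the conjugates of `B / √D` for an
`𝓞_D`-bilinear alternating form `B` on the lattice with values in `𝓞_D`. Properness gives a line
`𝓞_D u` which is a direct summand, and `𝔞` is the ideal of the values `B(u, v)`. -/
theorem TorusData.IsRM.exists_isFrame [IsNonsquareDisc D] {T : TorusData D} {d₁ d₂ : ℕ}
    (hT : T.IsRM d₁ d₂) : ∃ (𝔞 : Ideal (quadOrder D)) (j : K D × K D →+ V), IsFrame T 𝔞 j := by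
  obtain ⟨v₀, hv₀, hv₀0⟩ := exists_ne_zero_mem hT
  obtain ⟨F, h, hF1, hF, hpos, hform⟩ := hT.exists_coordinates hv₀ hv₀0
  have hdisc := hT.discrete
  let := T.latticeModule hT.maps
  have hsm : ∀ (x : quadOrder D) (v : T.lattice), ((x • v : T.lattice) : V) = T.rho x v :=
    fun x v => rfl
  have hFsm : ∀ (x : quadOrder D) (v : T.lattice) i, F ((x • v : T.lattice) : V) i
      = emb D i x * F v i := by
    intro x v i
    rw [hsm, hF, diagRho_apply]
  -- the summands of the alternating form
  set t : Fin 2 → V → V → ℝ := fun i v w => h i * (F v i * conj (F w i)).im with ht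
  have hE : ∀ v w, (T.form v w).im = t 0 v w + t 1 v w := by
    intro v w
    rw [hform, Complex.im_sum, Fin.sum_univ_two, Complex.im_ofReal_mul, Complex.im_ofReal_mul]
  have hs2 : (emb D 0 (sqrtElt D : K D)) = Real.sqrt D := by
    rw [coe_sqrtElt, emb_zero_apply]; simp
  have hs3 : (emb D 1 (sqrtElt D : K D)) = -Real.sqrt D := by
    rw [coe_sqrtElt, emb_one_apply, emb_zero_apply]; simp
  have hsne : ∀ i, emb D i (sqrtElt D : K D) ≠ 0 := by
    have := (sqrt_pos D).ne'
    refine Fin.forall_fin_two.2 ⟨by rwa [hs2], by rw [hs3]; exact neg_ne_zero.2 this⟩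
  -- the integer values of `Im H` at `(v, w)` and `(γ v, w)` determine `B(v, w) ∈ 𝓞_D`
  have hB : ∀ v w : T.lattice, ∃ b : quadOrder D,
      ∀ i, emb D i b = emb D i (sqrtElt D : K D) * t i v w := by
    intro v w
    obtain ⟨m, hm⟩ := hT.integral v v.2 w w.2
    obtain ⟨l, hl⟩ := hT.integral _ (gen D • v).2 w w.2
    rw [hE] at hm hl
    have ht' : ∀ i, t i ((gen D • v : T.lattice) : V) w = emb D i (gam D) * t i v w := by
      intro i
      simp only [ht, hFsm, coe_gen]
      rw [mul_assoc (emb D i (gam D) : ℂ), Complex.im_ofReal_mul]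
      ring
    rw [ht', ht'] at hl
    refine ⟨(l : quadOrder D) - m * D + m * gen D, ?_⟩
    have e1 : emb D 0 (gam D) + emb D 1 (gam D) = D := by
      simp [emb_one_apply, emb_zero_apply, gam]; ring
    have e2 := emb_gam_sub_emb_gam D
    refine Fin.forall_fin_two.2 ⟨?_, ?_⟩
    · rw [hs2]
      simp only [Subring.coe_add, AddSubgroupClass.coe_sub, Subring.coe_mul,
        SubringClass.coe_intCast, SubringClass.coe_natCast, coe_gen, map_add, map_sub, map_mul,
        map_intCast, map_natCast]
      rw [← e2, ← hm, ← hl, ← e1]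
      ring
    · rw [hs3]
      simp only [Subring.coe_add, AddSubgroupClass.coe_sub, Subring.coe_mul,
        SubringClass.coe_intCast, SubringClass.coe_natCast, coe_gen, map_add, map_sub, map_mul,
        map_intCast, map_natCast]
      rw [← e2, ← hm, ← hl, ← e1]
      ring
  choose B₀ hB₀ using hB
  have hinj : ∀ {a b : quadOrder D}, (∀ i, emb D i a = emb D i b) → a = b := fun hab =>
    Subtype.ext (emb_injective D 0 (hab 0))
  let B : T.lattice →ₗ[quadOrder D] T.lattice →ₗ[quadOrder D] quadOrder D :=
    LinearMap.mk₂ (quadOrder D) B₀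
      (fun v v' w => hinj fun i => by
        simp only [Subring.coe_add, map_add, hB₀, ht, Submodule.coe_add, Pi.add_apply, add_mul,
          Complex.add_im]
        ring)
      (fun x v w => hinj fun i => by
        simp only [smul_eq_mul, Subring.coe_mul, map_mul, hB₀, ht, hFsm]
        rw [mul_assoc (emb D i x : ℂ), Complex.im_ofReal_mul]
        ring)
      (fun v w w' => hinj fun i => by
        simp only [Subring.coe_add, map_add, hB₀, ht, Submodule.coe_add, Pi.add_apply, mul_add,
          Complex.add_im])
      (fun x v w => hinj fun i => by
        simp only [smul_eq_mul, Subring.coe_mul, map_mul, hB₀, ht, hFsm, Complex.conj_ofReal]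
        rw [mul_left_comm (F v i), Complex.im_ofReal_mul]
        ring)
  have hB : ∀ v w i, emb D i (B v w) = emb D i (sqrtElt D : K D) * t i v w := hB₀
  have halt : ∀ v, B v v = 0 := fun v => hinj fun i => by
    rw [hB]
    simp only [ht, Complex.mul_conj, Complex.ofReal_im]
    simp
  have hnd : ∀ v : T.lattice, (∀ i, F v i ≠ 0) → ∃ w, B v w ≠ 0 := by
    intro v hv
    obtain ⟨w, hw, hw0⟩ := hT.exists_im_ne_zero hv 0
    refine ⟨⟨w, hw⟩, fun h0 => ?_⟩
    have := hB v ⟨w, hw⟩ 0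
    rw [h0] at this
    simp only [Subring.coe_zero, map_zero] at this
    rcases mul_eq_zero.1 this.symm with h1 | h1
    · exact hsne 0 h1
    · exact (mul_ne_zero (hpos 0).ne' hw0) h1
  -- three vectors in a plane are linearly dependent
  have hcyc : ∀ a b c : T.lattice, B a b • c + B b c • a + B c a • b = 0 := by
    intro a b c
    apply Subtype.ext
    apply F.injective
    ext i
    simp only [Submodule.coe_add, map_add, Pi.add_apply, hFsm, hB, ht, Submodule.coe_zero, map_zero,
      Pi.zero_apply]
    generalize F a i = x, F b i = y, F c i = w
    apply Complex.ext <;> simp <;> ring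
  -- if `γ - r` maps the lattice `Λ` into `pΛ`, then `(γ - r) / p` is a multiplier outside `𝓞_D`
  have hloc : ∀ p : ℕ, p.Prime → ∃ u : T.lattice, SaturatedAt (D := D) p u := by
    intro p hp
    refine exists_saturatedAt hp fun r => ?_
    by_contra! hcon
    have hp0 : (p : ℚ) ≠ 0 := by exact_mod_cast hp.ne_zero
    set κ : K D := ((1 / p : ℚ) : K D) * (gam D - r)
    have hpκ : (p : K D) * κ = gam D - r := by
      have : (p : K D) * ((1 / p : ℚ) : K D) = 1 := by
        ext <;> simp [hp0, QuadraticAlgebra.re_one, QuadraticAlgebra.im_one]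
      rw [← mul_assoc, this, one_mul]
    have hκ : κ ∈ quadOrder D := by
      refine hT.mem_quadOrder_of_forall_mem hF hv₀ hF1 fun v hv => ?_
      obtain ⟨v', hv'⟩ := mem_multiples.1 (hcon ⟨v, hv⟩)
      convert v'.2
      rw [LinearEquiv.symm_apply_eq]
      ext i
      have h1 := congrArg (fun x : T.lattice => F (x : V) i) hv'
      simp only [hFsm] at h1
      rw [act_apply]
      have h2 : emb D i (p : K D) * emb D i κ = emb D i (gam D - r) := by rw [← map_mul, hpκ]
      have hp1 : (p : ℂ) ≠ 0 := by exact_mod_cast hp.ne_zero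
      rw [map_natCast] at h2
      have h3 : (p : ℂ) * emb D i κ = emb D i (gam D - r) := by exact_mod_cast h2
      simp only [AddSubgroupClass.coe_sub, SubringClass.coe_intCast, coe_gen,
        Int.cast_natCast] at h1
      apply mul_left_cancel₀ hp1
      rw [← mul_assoc, h3, ← h1]
      simp
    obtain ⟨a, b, hab⟩ := exists_eq_add_mul_gen (⟨κ, hκ⟩ : quadOrder D)
    have h1 : ((-r : ℤ) : quadOrder D) + (1 : ℤ) * gen D = (p * a : ℤ) + (p * b : ℤ) * gen D := by
      have h2 : (p : quadOrder D) * ⟨κ, hκ⟩ = gen D - r := by ext1; simpa using hpκ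
      push_cast
      linear_combination -h2 + (p : quadOrder D) * hab
    have h2 := (add_mul_gen_inj h1).2
    exact hp.one_lt.ne' (by exact_mod_cast Int.eq_one_of_mul_eq_one_right (by positivity) h2.symm)
  have hv₀F : ∀ i, F ((⟨v₀, hv₀⟩ : T.lattice) : V) i ≠ 0 := fun i => by simp [hF1]
  obtain ⟨u, hu⟩ := exists_saturatedAt_forall hloc B halt ⟨_, hnd _ hv₀F⟩
  obtain ⟨l, hl⟩ := exists_functional_of_saturatedAt hu
  have hu0 : u ≠ 0 := by
    rintro rfl
    rw [map_zero] at hl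
    exact zero_ne_one hl
  -- a vanishing coordinate of `u` would make it an eigenvector of `γ`
  have huF : ∀ i, F u i ≠ 0 := by
    intro i h0
    refine hu0 (Subtype.ext ?_)
    refine hT.eq_zero_of_eigenvector u.2 (irrational_emb_gam (D := D) (1 - i)) ?_
    apply F.injective
    ext k
    rw [hF, diagRho_apply, map_smul, Pi.smul_apply, smul_eq_mul, coe_gen]
    by_cases hk : k = i
    · rw [hk, h0]; simp
    · have : k = 1 - i := by
        revert hk; fin_cases i <;> fin_cases k <;> simp
      rw [this]
  obtain ⟨v₁, hv₁⟩ := hnd u huF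
  -- a vector of the complement `ker l` which is not orthogonal to `u`
  obtain ⟨w₀, hlw, hδ⟩ : ∃ w₀, l w₀ = 0 ∧ B u w₀ ≠ 0 := by
    refine ⟨v₁ - l v₁ • u, by simp [hl], ?_⟩
    rw [map_sub, map_smul, halt, smul_zero, sub_zero]
    exact hv₁
  -- the component of `v` in `ker l` is `B(u, v) / B(u, w₀)` times `w₀`
  have hdec : ∀ v, B u w₀ • (v - l v • u) = B u v • w₀ := by
    intro v
    have h1 := hcyc u w₀ v
    have hneg : ∀ a b, B a b = -B b a := fun a b => by
      have := halt (a + b)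
      simp only [map_add, LinearMap.add_apply, halt, zero_add, add_zero] at this
      exact eq_neg_of_add_eq_zero_right this
    have h2 : l (B u w₀ • v + B w₀ v • u + B v u • w₀) = 0 := by rw [h1, map_zero]
    simp only [map_add, map_smul, hl, hlw, smul_eq_mul, mul_one, mul_zero, add_zero] at h2
    have h3 : B w₀ v = -(B u w₀ * l v) := by linear_combination h2
    rw [h3, hneg v u] at h1
    have : B u w₀ • (v - l v • u) - B u v • w₀ =
        B u w₀ • v + -(B u w₀ * l v) • u + -B u v • w₀ := by module
    rw [← sub_eq_zero, this, h1]
  obtain ⟨δ', hδ'⟩ := exists_mul_eq_one (k := (B u w₀ : K D)) (by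
    intro h0; exact hδ (Subtype.ext h0))
  have hδe : ∀ i, emb D i δ' * emb D i (B u w₀) = 1 := fun i => by rw [← map_mul, hδ', map_one]
  have hinv : ∀ i, emb D i (invSqrt D) * emb D i (sqrtElt D : K D) = 1 := fun i => by
    rw [← map_mul, invSqrt_mul_sqrtElt, map_one]
  have hdecF : ∀ (v : T.lattice) i,
      F v i - emb D i (l v) * F u i = emb D i (δ' * B u v) * F w₀ i := by
    intro v i
    have h1 := congrArg (fun x : T.lattice => F (x : V) i) (hdec v)
    simp only [hFsm, Submodule.coe_sub, map_sub, Pi.sub_apply] at h1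
    have h2 : (emb D i δ' : ℂ) * emb D i (B u w₀) = 1 := by exact_mod_cast hδe i
    rw [map_mul]
    push_cast
    linear_combination (emb D i δ' : ℂ) * h1 - (F v i - emb D i (l v) * F u i) * h2
  -- the image of `(0, 1)`, normalized so that `Im H` becomes the trace pairing
  let c : Fin 2 → ℂ := fun i => -(emb D i ((sqrtElt D : K D) * δ') : ℂ) * F w₀ i
  let j : K D × K D →+ V := (F.symm : V →+ V).comp
    { toFun := fun x i => (emb D i x.1 : ℂ) * F u i + (emb D i x.2 : ℂ) * c i
      map_zero' := by ext i; simp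
      map_add' := fun x y => by ext i; simp; ring }
  have hj : ∀ x i, F (j x) i = (emb D i x.1 : ℂ) * F u i + (emb D i x.2 : ℂ) * c i := by
    intro x i
    exact congrFun (F.apply_symm_apply _) i
  have hjl : ∀ (x : quadOrder D) (v : T.lattice),
      F (j ((x : K D), invSqrt D * (-B u v : quadOrder D))) =
        F ((x • u + (v - l v • u) : T.lattice) : V) := by
    intro x v
    ext i
    rw [hj]
    simp only [Submodule.coe_add, map_add, Pi.add_apply, hFsm, Submodule.coe_sub, map_sub,
      Pi.sub_apply, hdecF, c]
    have h2 : (emb D i (invSqrt D) : ℂ) * emb D i (sqrtElt D : K D) = 1 := by exact_mod_cast hinv i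
    simp only [Subring.coe_neg, map_mul, map_neg]
    push_cast
    linear_combination (emb D i δ' : ℂ) * emb D i (B u v) * F w₀ i * h2
  refine ⟨LinearMap.range (B u), j, ⟨fun v => ⟨fun hv => ?_, ?_⟩, fun x y => ?_, fun x y => ?_⟩⟩
  · refine ⟨((l ⟨v, hv⟩ : K D), invSqrt D * (-B u ⟨v, hv⟩ : quadOrder D)), ⟨(l ⟨v, hv⟩).2, ?_⟩, ?_⟩
    · exact (mem_scaledIdeal _ _).2 ⟨_, neg_mem (LinearMap.mem_range_self (B u) _), rfl⟩
    · apply F.injective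
      rw [hjl]
      simp
  · rintro ⟨⟨x, y⟩, ⟨hx, hy⟩, rfl⟩
    obtain ⟨a, ⟨v, rfl⟩, rfl⟩ := (mem_scaledIdeal _ _).1 hy
    have h1 := hjl ⟨x, hx⟩ (-v)
    rw [map_neg, neg_neg] at h1
    have h2 := F.injective h1
    simp only at h2
    rw [h2]
    exact Subtype.prop _
  · apply F.injective
    ext i
    rw [hF, diagRho_apply, hj, hj]
    simp only [Prod.smul_fst, Prod.smul_snd, smul_eq_mul, map_mul]
    push_cast
    ring
  · rw [hE, tracePairing_eq_emb, Fin.sum_univ_two]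
    have key : ∀ i, t i (j x) (j y) = emb D i (y.1 * x.2 - x.1 * y.2) := by
      intro i
      have h1 : h i * (F u i * conj (c i)).im = -1 := by
        have h2 := hB u w₀ i
        have h3 := hinv i
        have h4 := hδe i
        simp only [ht] at h2
        have h5 : (F u i * conj (c i)).im =
            -(emb D i (sqrtElt D : K D) * emb D i δ') * (F u i * conj (F w₀ i)).im := by
          have : F u i * conj (c i) =
              ((-(emb D i (sqrtElt D : K D) * emb D i δ') : ℝ) : ℂ) * (F u i * conj (F w₀ i)) := by
            simp only [c, map_mul, map_neg, Complex.conj_ofReal]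
            push_cast
            ring
          rw [this, Complex.im_ofReal_mul]
        rw [h5]
        linear_combination (-emb D i δ') * h2.symm - h4
      simp only [ht, hj, map_add, map_sub, map_mul, Complex.conj_ofReal]
      have h6 : ((emb D i x.1 * F u i + emb D i x.2 * c i) *
          (emb D i y.1 * conj (F u i) + emb D i y.2 * conj (c i))).im =
          (emb D i x.1 * emb D i y.2 - emb D i x.2 * emb D i y.1) * (F u i * conj (c i)).im := by
        simp
        ring
      rw [h6]
      linear_combination (emb D i x.1 * emb D i y.2 - emb D i x.2 * emb D i y.1) * h1
    rw [key, key]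

/-! ### The surfaces `(A_z, H_z, ρ_z)` have real multiplication -/

theorem exists_int_tracePairing [IsNonsquareDisc D] {𝔞 : Ideal (quadOrder D)} {u v : K D × K D}
    (hu : u ∈ pairModule 𝔞) (hv : v ∈ pairModule 𝔞) : ∃ n : ℤ, tracePairing u v = n := by
  obtain ⟨a, -, ha⟩ := (mem_scaledIdeal _ _).1 hu.2
  obtain ⟨b, -, hb⟩ := (mem_scaledIdeal _ _).1 hv.2
  refine ⟨genCoeff D (⟨v.1, hv.1⟩ * a - ⟨u.1, hu.1⟩ * b), ?_⟩
  rw [← trace_invSqrt_mul, tracePairing]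
  congr 1
  simp only [AddSubgroupClass.coe_sub, Subring.coe_mul]
  linear_combination v.1 * ha - u.1 * hb

/-- The pairing of a real combination of lattice vectors with a lattice vector. -/
theorem torusForm_phi_sum {n : Type} [Fintype n] (z : ℍ × ℍ) (b : n → K D × K D) (g : n → ℝ)
    (v : K D × K D) :
    (torusForm z (∑ k, g k • phi D z (b k)) (phi D z v)).im
      = ∑ k, g k * (tracePairing (b k) v : ℝ) := by
  rw [map_sum, LinearMap.sum_apply, Complex.im_sum]
  refine Finset.sum_congr rfl fun k _ => ?_
  have : g k • phi D z (b k) = (g k : ℂ) • phi D z (b k) := by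
    ext i; simp
  rw [this, map_smul, LinearMap.smul_apply, smul_eq_mul, Complex.im_ofReal_mul, torusForm_phi_im]

/-- A symplectic basis of `𝓞_D ⊕ (1/√D) 𝔞` becomes a real basis of `ℂ²`, since the form is
nondegenerate. -/
theorem linearIndependent_phi {𝔞 : Ideal (quadOrder D)} {d₁ d₂ : ℕ} (hd₁ : 0 < d₁) (hd₂ : 0 < d₂)
    (b : Module.Basis (Fin 2 ⊕ Fin 2) ℤ (pairModule 𝔞))
    (hb : ∀ i j : Fin 2,
      tracePairing (b (.inl i)) (b (.inl j) : K D × K D) = 0 ∧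
      tracePairing (b (.inr i)) (b (.inr j) : K D × K D) = 0 ∧
      tracePairing (b (.inl i)) (b (.inr j) : K D × K D)
        = (if i = j then ((![d₁, d₂] i : ℕ) : ℚ) else 0) ∧
      tracePairing (b (.inr j)) (b (.inl i) : K D × K D)
        = -(if i = j then ((![d₁, d₂] i : ℕ) : ℚ) else 0)) (z : ℍ × ℍ) :
    LinearIndependent ℝ (fun k => phi D z (b k)) := by
  rw [Fintype.linearIndependent_iff]
  intro g hg
  have key : ∀ v : K D × K D, ∑ k, g k * (tracePairing (b k) v : ℝ) = 0 := by
    intro v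
    rw [← torusForm_phi_sum z (fun k => b k) g v, hg]
    simp
  have hd : ∀ i : Fin 2, ((![d₁, d₂] i : ℕ) : ℝ) ≠ 0 :=
    Fin.forall_fin_two.2 ⟨by simpa using hd₁.ne', by simpa using hd₂.ne'⟩
  rintro (i | i)
  · have h1 := key (b (.inr i))
    rw [Fintype.sum_sum_type] at h1
    simp only [(hb _ _).2.2.1, (hb _ _).2.1] at h1
    have h2 := hd i
    fin_cases i <;> simp at h1 h2 <;> simpa [h2] using h1
  · have h1 := key (b (.inl i))
    rw [Fintype.sum_sum_type] at h1
    simp only [(hb _ _).2.2.2, (hb _ _).1] at h1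
    have h2 := hd i
    fin_cases i <;> simp at h1 h2 <;> simpa [h2] using h1

/-- If the trace pairing is of type `(d₁, d₂)`, then all surfaces `(A_z, H_z, ρ_z)` have real
multiplication. The action is proper because the lattice contains the image of `(1, 0)`: an element
`s` which acts on it maps `(1, 0)` to `(s, 0)`, so `s ∈ 𝓞_D`. -/
theorem isRM_torusAt [IsNonsquareDisc D] {𝔞 : Ideal (quadOrder D)} {d₁ d₂ : ℕ} (hd₁ : 0 < d₁)
    (hd₂ : 0 < d₂) (h : IdealHasType 𝔞 d₁ d₂) (z : ℍ × ℍ) : (torusAt 𝔞 z).IsRM d₁ d₂ := by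
  have hfr := isFrame_phi 𝔞 z
  have hlat : ∀ v, v ∈ (torusAt 𝔞 z).lattice ↔ ∃ u ∈ pairModule 𝔞, phi D z u = v :=
    hfr.mem_lattice
  obtain ⟨b, hb⟩ := h
  have hli := linearIndependent_phi hd₁ hd₂ b hb z
  set B : Module.Basis (Fin 2 ⊕ Fin 2) ℝ V := basisOfLinearIndependentOfCardEqFinrank hli (by
    rw [finrank_real_of_complex]; simp)
  have hspan : (torusAt 𝔞 z).lattice = Submodule.span ℤ (Set.range B) := by
    have h1 : Set.range B =
        (phi D z).toIntLinearMap '' ((pairModule 𝔞).subtype '' Set.range b) := by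
      rw [← Set.range_comp, ← Set.range_comp]
      congr 1
      ext1 k
      simp [B]
    rw [h1, Submodule.span_image, Submodule.span_image, b.span_eq, Submodule.map_top,
      Submodule.range_subtype]
    rfl
  refine
    { discrete := by rw [hspan]; infer_instance
      span_top := ?_
      hermitian := fun v w => ?_
      pos := fun v hv => ?_
      integral := ?_
      type := hfr.hasType_iff.2 ⟨b, hb⟩
      injective := fun x y hxy => ?_
      maps := ?_
      selfAdjoint := fun x v w => ?_
      proper := ?_ }
  · rw [hspan, Submodule.span_span_of_tower, B.span_eq]
  · change torusForm z w v = conj (torusForm z v w)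
    simp only [torusForm_apply, map_add, map_div₀, map_mul, Complex.conj_conj, Complex.conj_ofReal]
    ring
  · change 0 < (torusForm z v v).re
    rw [torusForm_apply, Complex.mul_conj, Complex.mul_conj, ← Complex.ofReal_div,
      ← Complex.ofReal_div, ← Complex.ofReal_add, Complex.ofReal_re]
    have h1 := z.1.im_pos
    have h2 := z.2.im_pos
    by_cases h0 : v 0 = 0
    · have h3 : v 1 ≠ 0 := fun h3 => hv (by ext i; fin_cases i <;> simp [h0, h3])
      exact add_pos_of_nonneg_of_pos (div_nonneg (Complex.normSq_nonneg _) h1.le)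
        (div_pos (Complex.normSq_pos.2 h3) h2)
    · exact add_pos_of_pos_of_nonneg (div_pos (Complex.normSq_pos.2 h0) h1)
        (div_nonneg (Complex.normSq_nonneg _) h2.le)
  · intro v hv w hw
    obtain ⟨u, hu, rfl⟩ := (hlat v).1 hv
    obtain ⟨u', hu', rfl⟩ := (hlat w).1 hw
    obtain ⟨n, hn⟩ := exists_int_tracePairing hu hu'
    exact ⟨n, by rw [hfr.form, hn]; simp⟩
  · have h1 := congrFun (LinearMap.congr_fun hxy (fun _ => 1)) 0
    change diagRho D x (fun _ => 1) 0 = diagRho D y (fun _ => 1) 0 at h1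
    rw [diagRho_apply, diagRho_apply] at h1
    exact Subtype.ext (emb_injective D 0 (by simpa using h1))
  · intro x v hv
    obtain ⟨u, hu, rfl⟩ := (hlat v).1 hv
    exact (hlat _).2 ⟨(x : K D) • u, smul_mem_pairModule hu x, hfr.map_rho x u⟩
  · change torusForm z (diagRho D x v) w = torusForm z v (diagRho D x w)
    simp only [torusForm_apply, diagRho_apply, map_mul, Complex.conj_ofReal]
    ring
  · rintro ⟨S, hS, ρ', -, -, hρ, hext⟩
    refine absurd (fun s hs => ?_) (not_le_of_gt hS)
    obtain ⟨N, hN, hNs⟩ := exists_int_mul_mem s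
    have hmem := hρ ⟨s, hs⟩ (phi D z (1, 0))
      ((hlat _).2 ⟨(1, 0), ⟨(quadOrder D).one_mem, (scaledIdeal 𝔞).zero_mem⟩, rfl⟩)
    obtain ⟨u, hu, hus⟩ := (hlat _).1 hmem
    -- the operator `ρ' s` is determined by `ρ' (N s)`
    have h1 : phi D z ((N : K D) • u) = phi D z ((N : K D) * s, 0) := by
      have h2 := LinearMap.congr_fun (hext ⟨_, hNs⟩) (phi D z (1, 0))
      have h3 := hfr.map_rho ⟨_, hNs⟩ (1, 0)
      rw [← h2] at h3
      have h4 : (⟨(N : K D) * s, hS.le hNs⟩ : S) = (N : S) * ⟨s, hs⟩ := Subtype.ext (by simp)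
      simp only at h3
      rw [h4, map_mul, map_natCast, Module.End.mul_apply, ← hus] at h3
      rw [phi_smul, map_natCast]
      simpa using h3.symm
    have h2 := hfr.injective h1
    have h3 : (N : K D) * u.1 = N * s := congrArg Prod.fst h2
    have hN0 : (N : K D) ≠ 0 := by exact_mod_cast hN.ne'
    rw [← mul_left_cancel₀ hN0 h3]
    exact hu.1

/-! ### Isomorphisms and the Hilbert modular group -/

/-- The point `z ∈ ℍ²` as a vector of `ℂ²`. -/
def pt (z : ℍ × ℍ) : V := ![(z.1 : ℂ), (z.2 : ℂ)]

@[simp] theorem pt_zero (z : ℍ × ℍ) : pt z 0 = z.1 := rfl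

@[simp] theorem pt_one (z : ℍ × ℍ) : pt z 1 = z.2 := rfl

theorem pt_injective : Function.Injective pt := by
  intro z z' h
  ext1
  · exact UpperHalfPlane.ext (congrFun h 0)
  · exact UpperHalfPlane.ext (congrFun h 1)

theorem phi_apply_pt (z : ℍ × ℍ) (u : K D × K D) (i : Fin 2) :
    phi D z u i = (emb D i u.1 : ℂ) + (emb D i u.2 : ℂ) * pt z i := phi_apply z u i

theorem mobius_denom_ne_zero [IsNonsquareDisc D] {M : SL(2, K D)} (z : ℍ × ℍ) (i : Fin 2) :
    (emb D i (M 1 0) : ℂ) * pt z i + emb D i (M 1 1) ≠ 0 := by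
  have hcd : (![emb D i (M 1 0), emb D i (M 1 1)] : Fin 2 → ℝ) ≠ 0 := by
    intro h
    have h0 : emb D i (M 1 0) = 0 := congrFun h 0
    have h1 : emb D i (M 1 1) = 0 := congrFun h 1
    rw [map_eq_zero_iff _ (emb_injective D i)] at h0 h1
    have := M.det_coe
    rw [Matrix.det_fin_two, h0, h1] at this
    simp at this
  fin_cases i
  · exact UpperHalfPlane.linear_ne_zero z.1 hcd
  · exact UpperHalfPlane.linear_ne_zero z.2 hcd

/-- The action of `M` in coordinates, with cleared denominator. -/
theorem slPerm_mul_denom [IsNonsquareDisc D] (M : SL(2, K D)) (z : ℍ × ℍ) (i : Fin 2) :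
    pt (slPerm D M z) i * ((emb D i (M 1 0) : ℂ) * pt z i + emb D i (M 1 1)) =
      (emb D i (M 0 0) : ℂ) * pt z i + emb D i (M 0 1) := by
  have h := mobius_denom_ne_zero (M := M) z i
  rw [← eq_div_iff h]
  fin_cases i
  · exact UpperHalfPlane.coe_specialLinearGroup_apply
      (Matrix.SpecialLinearGroup.map (emb D 0) M : SL(2, ℝ)) z.1
  · exact UpperHalfPlane.coe_specialLinearGroup_apply
      (Matrix.SpecialLinearGroup.map (emb D 1) M : SL(2, ℝ)) z.2

theorem slPerm_im [IsNonsquareDisc D] (M : SL(2, K D)) (z : ℍ × ℍ) (i : Fin 2) :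
    (pt (slPerm D M z) i).im *
      Complex.normSq ((emb D i (M 1 0) : ℂ) * pt z i + emb D i (M 1 1)) = (pt z i).im := by
  have h := slPerm_mul_denom M z i
  set w := pt (slPerm D M z) i
  set f := (emb D i (M 1 0) : ℂ) * pt z i + emb D i (M 1 1) with hf
  have hdet : emb D i (M 0 0) * emb D i (M 1 1) - emb D i (M 0 1) * emb D i (M 1 0) = 1 := by
    rw [← map_mul, ← map_mul, ← map_sub, ← Matrix.det_fin_two, M.det_coe, map_one]
  have h1 : w.im * Complex.normSq f = (w * f * conj f).im := by
    rw [mul_assoc, Complex.mul_conj, mul_comm w, Complex.im_ofReal_mul, mul_comm]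
  rw [h1, h, hf]
  simp
  linear_combination (pt z i).im * hdet

theorem torusForm_apply_pt (z : ℍ × ℍ) (v w : V) :
    torusForm z v w = ∑ i, v i * conj (w i) / ((pt z i).im : ℂ) := by
  rw [Fin.sum_univ_two]; rfl

/-- The surfaces at `M z` and at `z` are isomorphic for `M` in the Hilbert modular group: the
isomorphism multiplies the coordinates by the automorphy factors `c z + d`. -/
theorem isIso_torusAt_slPerm [IsNonsquareDisc D] {𝔞 : Ideal (quadOrder D)} {M : SL(2, K D)}
    (hM : M ∈ hilbertSL 𝔞) (z : ℍ × ℍ) : IsIso (torusAt 𝔞 (slPerm D M z)) (torusAt 𝔞 z) := by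
  obtain ⟨h00, h01, h10, h11⟩ := hM
  set f : Fin 2 → ℂ := fun i => (emb D i (M 1 0) : ℂ) * pt z i + emb D i (M 1 1) with hf
  have hf0 : ∀ i, f i ≠ 0 := mobius_denom_ne_zero z
  have hdet : M 0 0 * M 1 1 - M 0 1 * M 1 0 = 1 := by
    rw [← Matrix.det_fin_two, M.det_coe]
  have hsm : ∀ {x y : K D}, x ∈ quadOrder D → y ∈ scaledIdeal 𝔞 → x * y ∈ scaledIdeal 𝔞 :=
    fun {x y} hx hy => (scaledIdeal 𝔞).smul_mem (⟨x, hx⟩ : quadOrder D) hy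
  let F : V ≃ₗ[ℂ] V := LinearEquiv.piCongrRight fun i => LinearEquiv.smulOfNeZero ℂ ℂ (f i) (hf0 i)
  have hF : ∀ v i, F v i = f i * v i := fun v i => rfl
  have hphi : ∀ x y : K D, F (phi D (slPerm D M z) (x, y)) =
      phi D z (M 1 1 * x + M 0 1 * y, M 1 0 * x + M 0 0 * y) := by
    intro x y
    ext i
    have h1 := slPerm_mul_denom M z i
    rw [hF, phi_apply_pt, phi_apply_pt]
    simp only [map_add, map_mul, hf]
    push_cast
    linear_combination (emb D i y : ℂ) * h1
  refine ⟨F, fun v => ?_, fun v w => ?_, fun x v => ?_⟩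
  · rw [(isFrame_phi 𝔞 _).mem_lattice, (isFrame_phi 𝔞 _).mem_lattice]
    constructor
    · rintro ⟨⟨x, y⟩, ⟨hx, hy⟩, rfl⟩
      refine ⟨_, ⟨?_, ?_⟩, (hphi x y).symm⟩
      · exact (quadOrder D).add_mem ((quadOrder D).mul_mem h11 hx) (h01 _ hy)
      · refine (scaledIdeal 𝔞).add_mem ?_ (hsm h00 hy)
        rw [mul_comm]
        exact hsm hx h10
    · rintro ⟨⟨x, y⟩, ⟨hx, hy⟩, hv⟩
      refine ⟨(M 0 0 * x - M 0 1 * y, -M 1 0 * x + M 1 1 * y), ⟨?_, ?_⟩, ?_⟩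
      · exact (quadOrder D).sub_mem ((quadOrder D).mul_mem h00 hx) (h01 _ hy)
      · refine (scaledIdeal 𝔞).add_mem ?_ (hsm h11 hy)
        rw [mul_comm]
        exact hsm hx ((scaledIdeal 𝔞).neg_mem h10)
      · apply F.injective
        rw [hphi, ← hv]
        congr 1
        ext1
        · linear_combination x * hdet
        · linear_combination y * hdet
  · change torusForm z (F v) (F w) = torusForm (slPerm D M z) v w
    rw [torusForm_apply_pt, torusForm_apply_pt]
    refine Finset.sum_congr rfl fun i _ => ?_
    have h1 := slPerm_im M z i
    have h2 : ((pt (slPerm D M z) i).im : ℂ) * (f i * conj (f i)) = (pt z i).im := by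
      rw [Complex.mul_conj]
      exact_mod_cast h1
    have h3 : ((pt (slPerm D M z) i).im : ℂ) ≠ 0 := by
      have : 0 < (pt (slPerm D M z) i).im := by
        fin_cases i
        · exact (slPerm D M z).1.im_pos
        · exact (slPerm D M z).2.im_pos
      exact_mod_cast this.ne'
    have h4 : conj (f i) ≠ 0 := by simpa using hf0 i
    have h5 := hf0 i
    rw [hF, hF, map_mul, ← h2]
    field_simp
  · change F (diagRho D x v) = diagRho D x (F v)
    ext i
    rw [hF, diagRho_apply, diagRho_apply, hF]
    ring

theorem exists_natCast_mem_scaledIdeal [IsNonsquareDisc D] {𝔞 : Ideal (quadOrder D)} {d₁ d₂ : ℕ}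
    (hd₁ : 0 < d₁) (h : IdealHasType 𝔞 d₁ d₂) :
    ∃ N : ℤ, N ≠ 0 ∧ (N : K D) ∈ scaledIdeal 𝔞 := by
  obtain ⟨b, hb⟩ := h
  have h1 := (hb 0 0).2.2.1
  obtain ⟨y, hy, hy0⟩ : ∃ y ∈ scaledIdeal 𝔞, y ≠ 0 := by
    by_contra! hcon
    have e1 : (b (.inl 0) : K D × K D).2 = 0 := hcon _ (b (.inl 0)).2.2
    have e2 : (b (.inr 0) : K D × K D).2 = 0 := hcon _ (b (.inr 0)).2.2
    rw [tracePairing, e1, e2] at h1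
    simp at h1
    exact hd₁.ne' (by exact_mod_cast h1.symm)
  obtain ⟨a, ha, rfl⟩ := (mem_scaledIdeal _ _).1 hy
  have ha0 : a ≠ 0 := by
    rintro rfl; simp at hy0
  obtain ⟨a', N, hN, haN⟩ := exists_mul_eq_int ha0
  refine ⟨N, hN, ?_⟩
  have : (N : K D) = ((sqrtElt D * a' : quadOrder D) : K D) * (invSqrt D * a) := by
    have h2 := congrArg (Subtype.val) haN
    simp only [Subring.coe_mul, SubringClass.coe_intCast] at h2 ⊢
    linear_combination (-(a' : K D) * a) * invSqrt_mul_sqrtElt D - h2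
  rw [this]
  exact (scaledIdeal 𝔞).smul_mem (sqrtElt D * a') hy

theorem scaledIdeal_injective [IsNonsquareDisc D] :
    Function.Injective (scaledIdeal : Ideal (quadOrder D) → _) := by
  refine Submodule.map_injective_of_injective fun a b hab => ?_
  simp only [LinearMap.toSpanSingleton_apply, Subring.smul_def, smul_eq_mul] at hab
  exact Subtype.ext (mul_right_cancel₀ (invSqrt_ne_zero D) hab)

/-- The ideal is an invariant of the surface, and the points of `ℍ²` with the same surface are
equivalent. The isomorphism yields a symplectic, that is unimodular, matrix `g` over `K` which
maps `𝓞_D ⊕ I` onto `𝓞_D ⊕ I'`; the ideal generated by the determinants of pairs of vectors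
recovers `I`. -/
theorem eq_and_exists_of_isIso [IsNonsquareDisc D] {𝔞 𝔞' : Ideal (quadOrder D)} {d₁ d₂ : ℕ}
    (hd₁ : 0 < d₁) (h𝔞 : IdealHasType 𝔞 d₁ d₂) {z z' : ℍ × ℍ}
    (h : IsIso (torusAt 𝔞 z) (torusAt 𝔞' z')) :
    𝔞 = 𝔞' ∧ ∃ M ∈ hilbertSL 𝔞', slPerm D M z' = z := by
  obtain ⟨F, h1, h2, h3⟩ := h
  have h2' : ∀ v w, torusForm z' (F v) (F w) = torusForm z v w := h2
  have h3' : ∀ (x : quadOrder D) v, F (diagRho D x v) = diagRho D x (F v) := h3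
  -- `F` is diagonal
  obtain ⟨f, hf⟩ : ∃ f : Fin 2 → ℂ, ∀ v i, F v i = f i * v i := by
    refine ⟨fun i => F (Pi.single i 1) i, fun v i => ?_⟩
    have hoff : ∀ k l : Fin 2, l ≠ k → F (Pi.single k 1) l = 0 := by
      intro k l hlk
      have e1 : diagRho D (gen D) (Pi.single k 1)
          = (emb D k (gam D) : ℂ) • (Pi.single k 1 : V) := by
        ext m
        rw [diagRho_apply, Pi.smul_apply, smul_eq_mul, coe_gen]
        by_cases hm : m = k
        · rw [hm]
        · simp [hm]
      have e2 := h3' (gen D) (Pi.single k 1)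
      rw [e1, map_smul] at e2
      have e3 := congrFun e2 l
      rw [Pi.smul_apply, diagRho_apply, smul_eq_mul, coe_gen] at e3
      have e4 : (emb D k (gam D) : ℂ) - emb D l (gam D) ≠ 0 := by
        have e5 := emb_gam_sub_emb_gam D
        have e6 := sqrt_pos D
        rw [← Complex.ofReal_sub, Complex.ofReal_ne_zero]
        intro e7
        fin_cases k <;> fin_cases l <;> simp at hlk e7 <;> linarith
      refine (mul_eq_zero.1
        (?_ : ((emb D k (gam D) : ℂ) - emb D l (gam D)) * _ = 0)).resolve_left e4
      linear_combination e3
    have hv : v = ∑ k, v k • (Pi.single k 1 : V) := by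
      ext l; simp [Finset.sum_apply, Pi.single_apply]
    conv_lhs => rw [hv]
    rw [map_sum, Finset.sum_apply, Finset.sum_eq_single i]
    · rw [map_smul, Pi.smul_apply, smul_eq_mul, mul_comm]
    · intro k _ hk
      rw [map_smul, Pi.smul_apply, hoff k i hk.symm, smul_zero]
    · simp
  have hact : ∀ (k : K D) v, F (act D k v) = act D k (F v) := by
    intro k v
    ext i
    rw [hf, act_apply, act_apply, hf]
    ring
  have hlat : ∀ u, u ∈ pairModule 𝔞 ↔ F (phi D z u) ∈ (torusAt 𝔞' z').lattice := by
    intro u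
    rw [← h1, (isFrame_phi 𝔞 z).mem_lattice]
    refine ⟨fun hu => ⟨u, hu, rfl⟩, ?_⟩
    rintro ⟨u', hu', he⟩
    rwa [← (isFrame_phi 𝔞 z).injective he]
  -- `p` and `q` are the images of `(1, 0)` and `(0, 1)` in `K²`; the second vector need not be in
  -- the lattice, but an integral multiple of it is
  obtain ⟨p, hp, hpF⟩ := ((isFrame_phi 𝔞' z').mem_lattice _).1
    ((hlat (1, 0)).1 ⟨(quadOrder D).one_mem, (scaledIdeal 𝔞).zero_mem⟩)
  obtain ⟨q, hqF⟩ : ∃ q, phi D z' q = F (phi D z (0, 1)) := by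
    obtain ⟨N, hN, hNI⟩ := exists_natCast_mem_scaledIdeal hd₁ h𝔞
    obtain ⟨q, -, hq⟩ := ((isFrame_phi 𝔞' z').mem_lattice _).1
      ((hlat (0, N)).1 ⟨(quadOrder D).zero_mem, hNI⟩)
    obtain ⟨N', hN'⟩ := exists_mul_eq_one (k := (N : K D)) (by exact_mod_cast hN)
    refine ⟨N' • q, ?_⟩
    rw [phi_smul, hq, ← hact, ← phi_smul]
    congr 2
    ext1
    · simp
    · simpa using hN'
  have hg : ∀ x y : K D, F (phi D z (x, y)) = phi D z' (x • p + y • q) := by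
    intro x y
    have : ((x, y) : K D × K D) = x • (1, 0) + y • (0, 1) := by ext1 <;> simp
    rw [this, map_add, map_add, phi_smul, phi_smul, hact, hact, map_add, phi_smul, phi_smul,
      hpF, hqF]
  have hmem : ∀ x y : K D, (x, y) ∈ pairModule 𝔞 ↔ x • p + y • q ∈ pairModule 𝔞' := by
    intro x y
    rw [hlat, hg, (isFrame_phi 𝔞' z').mem_lattice]
    constructor
    · rintro ⟨u', hu', he⟩
      rwa [← (isFrame_phi 𝔞' z').injective he]
    · exact fun hu => ⟨_, hu, rfl⟩
  -- the determinant is `1`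
  have hdet : p.1 * q.2 - q.1 * p.2 = 1 := by
    have htr : ∀ y : K D, QuadraticAlgebra.trace (y * (p.1 * q.2 - q.1 * p.2 - 1)) = 0 := by
      intro y
      have e1 := torusForm_phi_im z ((1 : K D), (0 : K D)) ((0 : K D), y)
      rw [← h2', hg, hg, torusForm_phi_im] at e1
      have e2 : tracePairing ((1 : K D) • p + (0 : K D) • q) ((0 : K D) • p + y • q) =
        tracePairing ((1 : K D), (0 : K D)) ((0 : K D), y) := by exact_mod_cast e1
      rw [tracePairing, tracePairing, ← sub_eq_zero, ← map_sub] at e2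
      refine neg_eq_zero.1 ((map_neg _ _).symm.trans (Eq.trans (congrArg _ ?_) e2))
      simp only [Prod.fst_add, Prod.snd_add, Prod.smul_fst, Prod.smul_snd, smul_eq_mul]
      ring
    have e3 := trace_mul_eq_zero (by simpa using htr 1) (htr (gam D))
    linear_combination e3
  have hinv : ∀ x' y' : K D, (x', y') ∈ pairModule 𝔞' ↔
      (q.2 * x' - q.1 * y', -p.2 * x' + p.1 * y') ∈ pairModule 𝔞 := by
    intro x' y'
    rw [hmem]
    have : (q.2 * x' - q.1 * y') • p + (-p.2 * x' + p.1 * y') • q = (x', y') := by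
      ext1
      · simp only [Prod.fst_add, Prod.smul_fst, smul_eq_mul]
        linear_combination x' * hdet
      · simp only [Prod.snd_add, Prod.smul_snd, smul_eq_mul]
        linear_combination y' * hdet
    rw [this]
  have hi1 := (hinv 1 0).1 ⟨(quadOrder D).one_mem, (scaledIdeal 𝔞').zero_mem⟩
  simp only [mul_one, mul_zero, sub_zero, add_zero] at hi1
  have hsm : ∀ {𝔞 : Ideal (quadOrder D)} {x y : K D},
      x ∈ quadOrder D → y ∈ scaledIdeal 𝔞 → x * y ∈ scaledIdeal 𝔞 :=
    fun {𝔞 x y} hx hy => (scaledIdeal 𝔞).smul_mem (⟨x, hx⟩ : quadOrder D) hy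
  have hI : scaledIdeal 𝔞 = scaledIdeal 𝔞' := by
    ext y
    constructor
    · intro hy
      have e1 := (hmem 0 y).1 ⟨(quadOrder D).zero_mem, hy⟩
      rw [zero_smul, zero_add] at e1
      have : y = p.1 * (y • q).2 - (y • q).1 * p.2 := by
        simp only [Prod.smul_fst, Prod.smul_snd, smul_eq_mul]
        linear_combination (-y) * hdet
      rw [this]
      exact sub_mem (hsm hp.1 e1.2) (hsm e1.1 hp.2)
    · intro hy
      have e1 := (hinv 0 y).1 ⟨(quadOrder D).zero_mem, hy⟩
      have : y = q.2 * (-p.2 * 0 + p.1 * y) - (q.2 * 0 - q.1 * y) * (-p.2) := by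
        linear_combination (-y) * hdet
      rw [this]
      exact sub_mem (hsm hi1.1 e1.2) (hsm e1.1 hi1.2)
  have h𝔞 := scaledIdeal_injective hI
  refine ⟨h𝔞, ⟨!![q.2, q.1; p.2, p.1], ?_⟩, ⟨hi1.1, fun y hy => ?_, hp.2, hp.1⟩, ?_⟩
  · rw [Matrix.det_fin_two]
    simp only [Matrix.of_apply, Matrix.cons_val', Matrix.cons_val_zero, Matrix.cons_val_one]
    linear_combination hdet
  · have e1 := (hmem 0 y).1 ⟨(quadOrder D).zero_mem, hI ▸ hy⟩
    rw [zero_smul, zero_add] at e1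
    have := e1.1
    rw [Prod.smul_fst, smul_eq_mul, mul_comm] at this
    exact this
  · apply pt_injective
    ext i
    set M : SL(2, K D) := ⟨!![q.2, q.1; p.2, p.1], _⟩ with hM
    have hne := mobius_denom_ne_zero (M := M) z' i
    have e1 := slPerm_mul_denom M z' i
    apply mul_right_cancel₀ hne
    rw [e1]
    have e2 := congrFun hpF i
    have e3 := congrFun hqF i
    rw [hf, phi_apply_pt, phi_apply_pt] at e2 e3
    simp only [map_zero, map_one, Complex.ofReal_zero, Complex.ofReal_one, zero_mul, add_zero,
      mul_one, zero_add, one_mul] at e2 e3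
    have m00 : M 0 0 = q.2 := rfl
    have m01 : M 0 1 = q.1 := rfl
    have m10 : M 1 0 = p.2 := rfl
    have m11 : M 1 1 = p.1 := rfl
    rw [m00, m01, m10, m11]
    linear_combination e3 - pt z i * e2

/-! ### The tautological family over `ℍ²` -/

/-- A point of `ℂ²` with coordinates in the upper half plane, as a point of `ℍ²`. -/
def ofVec (w : Fin 2 → ℂ) : ℍ × ℍ :=
  (UpperHalfPlane.ofComplex (w 0), UpperHalfPlane.ofComplex (w 1))

/-- The open subset `ℍ²` of `ℂ²`. -/
def upperSet : Set (Fin 2 → ℂ) := {w | ∀ i, 0 < (w i).im}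

theorem isOpen_upperSet : IsOpen upperSet := by
  have : upperSet = ⋂ i, {w : Fin 2 → ℂ | 0 < (w i).im} := by ext w; simp [upperSet]
  rw [this]
  exact isOpen_iInter_of_finite fun i => isOpen_lt (by fun_prop) (by fun_prop)

theorem isPreconnected_upperSet : IsPreconnected upperSet := by
  refine Convex.isPreconnected fun x hx y hy a b ha hb hab i => ?_
  simp only [Pi.add_apply, Pi.smul_apply, Complex.add_im, Complex.smul_im, smul_eq_mul]
  rcases ha.eq_or_lt with rfl | ha
  · have : b = 1 := by linarith
    simpa [this] using hy i
  · exact add_pos_of_pos_of_nonneg (mul_pos ha (hx i)) (mul_nonneg hb (hy i).le)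

theorem pt_mem_upperSet (z : ℍ × ℍ) : pt z ∈ upperSet :=
  Fin.forall_fin_two.2 ⟨z.1.im_pos, z.2.im_pos⟩

theorem ofVec_pt (z : ℍ × ℍ) : ofVec (pt z) = z := by
  simp [ofVec]

theorem pt_ofVec {w : Fin 2 → ℂ} (hw : w ∈ upperSet) : pt (ofVec w) = w := by
  ext i
  fin_cases i
  · simp [ofVec, UpperHalfPlane.ofComplex_apply_of_im_pos (hw 0)]
  · simp [ofVec, UpperHalfPlane.ofComplex_apply_of_im_pos (hw 1)]

theorem continuous_pt : Continuous pt := by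
  refine continuous_pi (Fin.forall_fin_two.2 ⟨?_, ?_⟩)
  · exact UpperHalfPlane.continuous_coe.comp continuous_fst
  · exact UpperHalfPlane.continuous_coe.comp continuous_snd

theorem isInducing_pt : Topology.IsInducing pt := by
  have h : Topology.IsInducing (Prod.map ((↑) : ℍ → ℂ) ((↑) : ℍ → ℂ)) :=
    UpperHalfPlane.isEmbedding_coe.isInducing.prodMap UpperHalfPlane.isEmbedding_coe.isInducing
  have h2 : pt = (Homeomorph.finTwoArrow (X := ℂ)).symm ∘ Prod.map ((↑) : ℍ → ℂ) ((↑) : ℍ → ℂ) := by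
    ext z i; fin_cases i <;> rfl
  rw [h2]
  exact (Homeomorph.isInducing _).comp h

section Taut

variable [IsNonsquareDisc D] {𝔞 : Ideal (quadOrder D)} {d₁ d₂ : ℕ}

/-- The surfaces `(A_z, H_z, ρ_z)` parametrized by `ℍ² ⊆ ℂ²`. -/
def tautFamily (h : ∀ z, (torusAt 𝔞 z).IsRM d₁ d₂) (w : Fin 2 → ℂ) : Surface D d₁ d₂ :=
  ⟨torusAt 𝔞 (ofVec w), h _⟩

theorem isHolomorphicFamily_tautFamily (h𝔞 : IdealHasType 𝔞 d₁ d₂)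
    (h : ∀ z, (torusAt 𝔞 z).IsRM d₁ d₂) :
    IsHolomorphicFamily upperSet (tautFamily h) := by
  obtain ⟨b₀, -⟩ := h𝔞
  set b : Module.Basis (Fin 4) ℤ (pairModule 𝔞) := b₀.reindex finSumFinEquiv
  choose E hE using fun i j : Fin 4 => exists_int_tracePairing (b i).2 (b j).2
  refine ⟨isOpen_upperSet, fun k w i => (emb D i (b k : K D × K D).1 : ℂ)
    + (emb D i (b k : K D × K D).2 : ℂ) * w i, E,
    fun x i j => b.repr ⟨(x : K D) • (b j : K D × K D), smul_mem_pairModule (b j).2 x⟩ i,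
    fun k w _ => ?_, fun w hw => ?_⟩
  · rw [analyticAt_pi_iff]
    intro i
    exact analyticAt_const.add (analyticAt_const.mul
      ((ContinuousLinearMap.proj (R := ℂ) (φ := fun _ : Fin 2 => ℂ) i).analyticAt w))
  have hPer : ∀ k, (fun i => (emb D i (b k : K D × K D).1 : ℂ)
      + (emb D i (b k : K D × K D).2 : ℂ) * w i) = phi D (ofVec w) (b k) := by
    intro k
    ext i
    rw [phi_apply_pt, pt_ofVec hw]
  simp only [hPer]
  set z := ofVec w
  have hfr := isFrame_phi 𝔞 z
  refine ⟨?_, ?_, fun i j => ?_, fun x j => ?_⟩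
  · have := (b.linearIndependent.map' _ (pairModule 𝔞).ker_subtype).map' (phi D z).toIntLinearMap
      (LinearMap.ker_eq_bot.2 hfr.injective)
    exact this
  · have h1 : Set.range (fun k => phi D z (b k))
        = (phi D z).toIntLinearMap '' ((pairModule 𝔞).subtype '' Set.range b) := by
      rw [← Set.range_comp, ← Set.range_comp]
      rfl
    rw [h1, Submodule.span_image, Submodule.span_image, b.span_eq, Submodule.map_top,
      Submodule.range_subtype]
    rfl
  · rw [show (tautFamily h w).1 = torusAt 𝔞 z from rfl, hfr.form, hE]
    simp
  · rw [show (tautFamily h w).1 = torusAt 𝔞 z from rfl, ← hfr.map_rho]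
    have h1 := b.sum_repr ⟨(x : K D) • (b j : K D × K D), smul_mem_pairModule (b j).2 x⟩
    have h2 := congrArg (fun u : pairModule 𝔞 => phi D z u) h1
    simp only at h2
    rw [← h2, AddSubmonoidClass.coe_finsetSum, map_sum]
    refine Finset.sum_congr rfl fun i _ => ?_
    rw [Submodule.coe_smul, map_zsmul]

end Taut

/-! ### The period map of a holomorphic family -/

/-- The ratio of two proportional holomorphic vector-valued functions is holomorphic. -/
theorem analyticAt_of_smul_eq {n m : ℕ} {X Y : (Fin n → ℂ) → (Fin m → ℂ)} {ζ : (Fin n → ℂ) → ℂ}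
    {w₀ : Fin n → ℂ} (hX : AnalyticAt ℂ X w₀) (hY : AnalyticAt ℂ Y w₀) (h0 : X w₀ ≠ 0)
    (h : ∀ᶠ w in nhds w₀, Y w = ζ w • X w) : AnalyticAt ℂ ζ w₀ := by
  obtain ⟨k, hk⟩ := Function.ne_iff.1 h0
  have hXk := analyticAt_pi_iff.1 hX k
  have hYk := analyticAt_pi_iff.1 hY k
  refine (hYk.fun_div hXk hk).congr ?_
  filter_upwards [h, hXk.continuousAt.eventually_ne hk] with w hw hwk
  rw [hw, Pi.smul_apply, smul_eq_mul, mul_div_cancel_right₀ _ hwk]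

/-- Since the alternating form and the action of `𝓞_D` are constant in the basis of period vectors,
a frame at one point of the base, written in that basis, is a frame at every point. Hence a single
ideal `𝔞` occurs in the family, and the points of `ℍ²` of these frames form a holomorphic period map
`ζ`. -/
theorem IsHolomorphicFamily.exists_periodMap [IsNonsquareDisc D] {d₁ d₂ n : ℕ}
    {U : Set (Fin n → ℂ)} {T : (Fin n → ℂ) → Surface D d₁ d₂} (hT : IsHolomorphicFamily U T)
    {w₀ : Fin n → ℂ} (hw₀ : w₀ ∈ U) :
    ∃ (𝔞 : Ideal (quadOrder D)) (ζ : (Fin n → ℂ) → ℍ × ℍ), IdealHasType 𝔞 d₁ d₂ ∧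
      (∀ w ∈ U, IsIso (T w).1 (torusAt 𝔞 (ζ w))) ∧
      ∀ w ∈ U, ∀ i, AnalyticAt ℂ (fun w => pt (ζ w) i) w := by
  obtain ⟨hU, Per, E, R, hPer, hw⟩ := hT
  have hspan : ∀ w ∈ U, ⊤ ≤ Submodule.span ℝ (Set.range fun j => Per j w) := by
    intro w hwU
    rw [← (T w).2.span_top, ← (hw w hwU).2.1, Submodule.span_span_of_tower]
  have hli := linearIndependent_of_top_le_span_of_card_eq_finrank (hspan w₀ hw₀)
    (by rw [finrank_real_of_complex]; simp)
  set b := Module.Basis.mk hli (hspan w₀ hw₀)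
  have hb : ∀ k, b k = Per k w₀ := fun k => by simp [b]
  obtain ⟨𝔞, j₀, hj₀⟩ := (T w₀).2.exists_isFrame
  -- the coordinates of the frame at `w₀` with respect to the period vectors
  let A : K D × K D →+ (Fin 4 → ℝ) := (b.equivFun : V →+ (Fin 4 → ℝ)).comp j₀
  let j : (Fin n → ℂ) → K D × K D →+ V := fun w =>
    { toFun := fun u => ∑ k, (A u k : ℂ) • Per k w
      map_zero' := by simp
      map_add' := fun u v => by
        simp only [map_add, Pi.add_apply, Complex.ofReal_add, add_smul, Finset.sum_add_distrib] }
  have hj : ∀ w u, j w u = ∑ k, (A u k : ℂ) • Per k w := fun _ _ => rfl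
  have hcs : ∀ (r : ℝ) (v : V), (r : ℂ) • v = r • v := fun r v => by ext i; simp
  have hjw₀ : ∀ u, j w₀ u = j₀ u := by
    intro u
    rw [hj]
    conv_rhs => rw [← b.sum_equivFun (j₀ u)]
    exact Finset.sum_congr rfl fun k _ => by rw [hb, hcs]; rfl
  have huniq : ∀ c c' : Fin 4 → ℝ, ∑ k, c k • Per k w₀ = ∑ k, c' k • Per k w₀ → c = c' := by
    intro c c' h
    simp only [← hb] at h
    rw [← b.equivFun_symm_apply, ← b.equivFun_symm_apply] at h
    exact b.equivFun.symm.injective h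
  have hform : ∀ w ∈ U, ∀ u v, ((T w).1.form (j w u) (j w v)).im =
      ∑ k, ∑ l, A u k * A v l * (E k l : ℝ) := by
    intro w hwU u v
    rw [hj, hj, map_sum (T w).1.form, LinearMap.sum_apply, Complex.im_sum]
    refine Finset.sum_congr rfl fun k _ => ?_
    rw [map_sum, Complex.im_sum]
    refine Finset.sum_congr rfl fun l _ => ?_
    rw [map_smulₛₗ, Complex.conj_ofReal, map_smul (T w).1.form, LinearMap.smul_apply, smul_eq_mul,
      smul_eq_mul, Complex.im_ofReal_mul, Complex.im_ofReal_mul, (hw w hwU).2.2.1]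
    ring
  have hrho : ∀ w ∈ U, ∀ (x : quadOrder D) u, (T w).1.rho x (j w u) =
      ∑ i, (∑ k, (R x i k : ℝ) * A u k) • Per i w := by
    intro w hwU x u
    rw [hj, map_sum]
    simp only [map_smul, (hw w hwU).2.2.2, Finset.sum_smul, Finset.smul_sum]
    rw [Finset.sum_comm]
    refine Finset.sum_congr rfl fun i _ => Finset.sum_congr rfl fun k _ => ?_
    rw [hcs, mul_comm, mul_smul]
    congr 1
    ext m
    simp
  have hfr : ∀ w ∈ U, IsFrame (T w).1 𝔞 (j w) := by
    intro w hwU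
    refine ⟨fun v => ?_, fun x u => ?_, fun u v => ?_⟩
    · -- membership in the lattices means integrality of the coefficients
      have hmem : ∀ w ∈ U, ∀ v, v ∈ (T w).1.lattice ↔ ∃ c : Fin 4 → ℤ, ∑ k, c k • Per k w = v := by
        intro w hwU v
        rw [← (hw w hwU).2.1, Submodule.mem_span_range_iff_exists_fun]
      have hint : ∀ (c : Fin 4 → ℤ) w, ∑ k, c k • Per k w = ∑ k, (c k : ℝ) • Per k w :=
        fun c w => Finset.sum_congr rfl fun k _ => by ext m; simp
      have hA : ∀ u (c : Fin 4 → ℤ), ∑ k, c k • Per k w₀ = j₀ u ↔ ∀ k, A u k = c k := by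
        intro u c
        rw [hint, ← hjw₀, hj]
        simp only [hcs]
        constructor
        · exact fun h k => (congrFun (huniq _ _ h) k).symm
        · exact fun h => Finset.sum_congr rfl fun k _ => by rw [h]
      rw [hmem w hwU]
      constructor
      · rintro ⟨c, rfl⟩
        obtain ⟨u, hu, he⟩ := (hj₀.mem_lattice _).1 ((hmem w₀ hw₀ _).2 ⟨c, rfl⟩)
        refine ⟨u, hu, ?_⟩
        rw [hj, hint]
        exact Finset.sum_congr rfl fun k _ => by rw [(hA u c).1 he.symm, hcs]
      · rintro ⟨u, hu, rfl⟩
        obtain ⟨c, hc⟩ := (hmem w₀ hw₀ _).1 ((hj₀.mem_lattice _).2 ⟨u, hu, rfl⟩)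
        refine ⟨c, ?_⟩
        rw [hj, hint]
        exact Finset.sum_congr rfl fun k _ => by rw [(hA u c).1 hc, hcs]
    · have h1 := hj₀.map_rho x u
      rw [← hjw₀, ← hjw₀, hrho w₀ hw₀, hj] at h1
      simp only [hcs] at h1
      have h2 := huniq _ _ h1
      rw [hrho w hwU, hj]
      simp only [hcs]
      exact Finset.sum_congr rfl fun k _ => by rw [congrFun h2 k]
    · rw [hform w hwU, ← hform w₀ hw₀, hjw₀, hjw₀, hj₀.form]
  choose! ζ hζ using fun w (hwU : w ∈ U) => (hfr w hwU).exists_isIso (T w).2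
  refine ⟨𝔞, ζ, hj₀.hasType_iff.1 (T w₀).2.type, fun w hwU => (hζ w hwU).1, fun w₁ hw₁ i => ?_⟩
  have hjan : ∀ u, AnalyticAt ℂ (fun w => j w u) w₁ := by
    intro u
    simp only [hj]
    exact Finset.analyticAt_fun_sum _ fun k _ => (hPer k w₁ hw₁).fun_const_smul
  have hgen : ∀ w ∈ U, ∀ u, (T w).1.rho (gen D) (j w u) = j w ((gen D : K D) • u) :=
    fun w hwU u => ((hfr w hwU).map_rho (gen D) u).symm
  refine analyticAt_of_smul_eq
    (X := fun w => j w ((gen D : K D) • (1, 0)) - (emb D (1 - i) (gam D) : ℂ) • j w (1, 0))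
    (Y := fun w => j w ((gen D : K D) • (0, 1)) - (emb D (1 - i) (gam D) : ℂ) • j w (0, 1))
    ((hjan _).fun_sub (hjan _).fun_const_smul) ((hjan _).fun_sub (hjan _).fun_const_smul) ?_ ?_
  · have := ((hζ w₁ hw₁).2 i).1
    rwa [hgen w₁ hw₁] at this
  · filter_upwards [hU.mem_nhds hw₁] with w hwU
    have := ((hζ w hwU).2 i).2
    rwa [hgen w hwU, hgen w hwU] at this

/-! ### The loci `X_𝔞` and their uniformization by `ℍ²` -/

section Uniformization

variable {d₁ d₂ : ℕ}

theorem mk_eq_mk_iff (T T' : Surface D d₁ d₂) :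
    ModuliSpace.mk T = ModuliSpace.mk T' ↔ IsIso T.1 T'.1 :=
  Quotient.eq (r := surfaceSetoid D d₁ d₂)

/-- The classifying map `z ↦ [(A_z, H_z, ρ_z)]` from `ℍ²` to the moduli space. -/
def classifying {𝔞 : Ideal (quadOrder D)} (h : ∀ z, (torusAt 𝔞 z).IsRM d₁ d₂) (z : ℍ × ℍ) :
    ModuliSpace D d₁ d₂ :=
  ModuliSpace.mk ⟨torusAt 𝔞 z, h z⟩

theorem component_eq_range {𝔞 : Ideal (quadOrder D)} (h : ∀ z, (torusAt 𝔞 z).IsRM d₁ d₂) :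
    component d₁ d₂ 𝔞 = Set.range (classifying h) := by
  ext c
  constructor
  · rintro ⟨z, -, rfl⟩
    exact ⟨z, rfl⟩
  · rintro ⟨z, rfl⟩
    exact ⟨z, h z, rfl⟩

theorem mk_tautFamily_pt {𝔞 : Ideal (quadOrder D)} (h : ∀ z, (torusAt 𝔞 z).IsRM d₁ d₂) (z : ℍ × ℍ) :
    ModuliSpace.mk (tautFamily h (pt z)) = classifying h z := by
  simp only [tautFamily, ofVec_pt, classifying]

theorem continuous_slPerm (M : SL(2, K D)) : Continuous (slPerm D M) :=
  ((continuous_const_smul (Matrix.SpecialLinearGroup.map (emb D 0) M : SL(2, ℝ))).comp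
    continuous_fst).prodMk
  ((continuous_const_smul (Matrix.SpecialLinearGroup.map (emb D 1) M : SL(2, ℝ))).comp
    continuous_snd)

variable [IsNonsquareDisc D]

theorem exists_mem_component (hd₁ : 0 < d₁) (hd₂ : 0 < d₂) (c : ModuliSpace D d₁ d₂) :
    ∃ 𝔞, IdealHasType 𝔞 d₁ d₂ ∧ c ∈ component d₁ d₂ 𝔞 := by
  induction c using Quotient.inductionOn with
  | h T =>
    obtain ⟨𝔞, j, hj⟩ := T.2.exists_isFrame
    obtain ⟨z, hz, -⟩ := hj.exists_isIso T.2
    have ht := hj.hasType_iff.1 T.2.type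
    exact ⟨𝔞, ht, z, isRM_torusAt hd₁ hd₂ ht z, (mk_eq_mk_iff _ _).2 hz⟩

theorem pairwiseDisjoint_component (hd₁ : 0 < d₁) :
    {𝔞 : Ideal (quadOrder D) | IdealHasType 𝔞 d₁ d₂}.PairwiseDisjoint (component d₁ d₂) := by
  intro 𝔞 h𝔞 𝔞' _ hne
  refine Set.disjoint_left.2 ?_
  rintro c ⟨z, h, rfl⟩ ⟨z', h', he⟩
  exact hne (eq_and_exists_of_isIso hd₁ h𝔞 ((mk_eq_mk_iff _ _).1 he)).1

theorem iUnion_component (hd₁ : 0 < d₁) (hd₂ : 0 < d₂) :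
    (⋃ 𝔞 ∈ {𝔞 : Ideal (quadOrder D) | IdealHasType 𝔞 d₁ d₂}, component d₁ d₂ 𝔞) = Set.univ :=
  Set.eq_univ_of_forall fun c => by
    obtain ⟨𝔞, h, hc⟩ := exists_mem_component hd₁ hd₂ c
    exact Set.mem_biUnion h hc

variable {𝔞 : Ideal (quadOrder D)} (h : ∀ z, (torusAt 𝔞 z).IsRM d₁ d₂)

theorem classifying_eq_iff (hd₁ : 0 < d₁) (h𝔞 : IdealHasType 𝔞 d₁ d₂) {z z' : ℍ × ℍ} :
    classifying h z = classifying h z' ↔ ∃ M ∈ hilbertSL 𝔞, slPerm D M z' = z := by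
  constructor
  · exact fun he => (eq_and_exists_of_isIso hd₁ h𝔞 ((mk_eq_mk_iff _ _).1 he)).2
  · rintro ⟨M, hM, rfl⟩
    exact (mk_eq_mk_iff _ _).2 (isIso_torusAt_slPerm hM z')

theorem continuous_classifying (h𝔞 : IdealHasType 𝔞 d₁ d₂) : Continuous (classifying h) := by
  refine continuous_def.2 fun S hS => ?_
  have h1 := hS 2 upperSet (tautFamily h) (isHolomorphicFamily_tautFamily h𝔞 h)
  convert h1.preimage continuous_pt using 1
  ext z
  simp only [Set.mem_preimage, Set.mem_ofPred_eq, mk_tautFamily_pt, pt_mem_upperSet, true_and]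

/-- A family which meets the image of an open set `W ⊆ ℍ²` has near such a point a continuous period
map to `ℍ²`, which can be moved into `W` by an element of the Hilbert modular group. -/
theorem isOpenMap_classifying (hd₁ : 0 < d₁) (h𝔞 : IdealHasType 𝔞 d₁ d₂) :
    IsOpenMap (classifying h) := by
  intro W hW n U T hT
  rw [isOpen_iff_mem_nhds]
  rintro w₀ ⟨hw₀, z₀, hz₀, he⟩
  obtain ⟨𝔞', ζ, -, hiso, han⟩ := hT.exists_periodMap hw₀
  obtain ⟨rfl, M, hM, hMz⟩ := eq_and_exists_of_isIso hd₁ h𝔞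
    (((mk_eq_mk_iff _ _).1 he).trans (hiso w₀ hw₀))
  have hζ : ContinuousAt ζ w₀ := by
    rw [isInducing_pt.continuousAt_iff, continuousAt_pi]
    exact fun i => (han w₀ hw₀ i).continuousAt
  have hc : ContinuousAt (fun w => slPerm D M (ζ w)) w₀ :=
    (continuous_slPerm M).continuousAt.comp hζ
  have hW' : ∀ᶠ w in nhds w₀, slPerm D M (ζ w) ∈ W :=
    hc.eventually_mem (hW.mem_nhds (by rwa [hMz]))
  filter_upwards [hW', hT.1.mem_nhds hw₀] with w hw hwU
  exact ⟨hwU, _, hw, (mk_eq_mk_iff _ _).2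
    ((isIso_torusAt_slPerm hM (ζ w)).trans (hiso w hwU).symm)⟩

theorem isOpen_component (hd₁ : 0 < d₁) (hd₂ : 0 < d₂) (h𝔞 : IdealHasType 𝔞 d₁ d₂) :
    IsOpen (component d₁ d₂ 𝔞) := by
  rw [component_eq_range (isRM_torusAt hd₁ hd₂ h𝔞), ← Set.image_univ]
  exact isOpenMap_classifying _ hd₁ h𝔞 _ isOpen_univ

theorem isClopen_component (hd₁ : 0 < d₁) (hd₂ : 0 < d₂) (h𝔞 : IdealHasType 𝔞 d₁ d₂) :
    IsClopen (component d₁ d₂ 𝔞) := by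
  refine ⟨⟨?_⟩, isOpen_component hd₁ hd₂ h𝔞⟩
  have : (component d₁ d₂ 𝔞)ᶜ = ⋃ 𝔟 ∈ {𝔟 | IdealHasType 𝔟 d₁ d₂ ∧ 𝔟 ≠ 𝔞}, component d₁ d₂ 𝔟 := by
    ext c
    simp only [Set.mem_compl_iff, Set.mem_iUnion, exists_prop]
    constructor
    · intro hc
      obtain ⟨𝔟, hb, hcb⟩ := exists_mem_component hd₁ hd₂ c
      exact ⟨𝔟, ⟨hb, by rintro rfl; exact hc hcb⟩, hcb⟩
    · rintro ⟨𝔟, ⟨hb, hne⟩, hcb⟩ hc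
      exact Set.disjoint_left.1 (pairwiseDisjoint_component hd₁ hb h𝔞 hne) hcb hc
  rw [this]
  exact isOpen_biUnion fun 𝔟 hb => isOpen_component hd₁ hd₂ hb.1

/-- Holomorphic functions on the moduli space are those with holomorphic pullback to `ℍ²`. -/
theorem holomorphicOn_iff (hd₁ : 0 < d₁) (h𝔞 : IdealHasType 𝔞 d₁ d₂)
    {S : Set (ModuliSpace D d₁ d₂)} (hS : S ⊆ component d₁ d₂ 𝔞) (f : ModuliSpace D d₁ d₂ → ℂ) :
    HolomorphicOn S f ↔ ∀ z, classifying h z ∈ S →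
      AnalyticAt ℂ (fun w => f (classifying h (ofVec w))) (pt z) := by
  constructor
  · intro hf z hz
    refine hf 2 upperSet (tautFamily h) (isHolomorphicFamily_tautFamily h𝔞 h) (pt z)
      ⟨pt_mem_upperSet z, ?_⟩
    rwa [mk_tautFamily_pt]
  · rintro hf n U T hT w₀ ⟨hw₀, hw₀S⟩
    obtain ⟨𝔞', ζ, -, hiso, han⟩ := hT.exists_periodMap hw₀
    obtain ⟨z₀, hz₀, he⟩ := hS hw₀S
    obtain ⟨rfl, -⟩ := eq_and_exists_of_isIso hd₁ h𝔞
      (((mk_eq_mk_iff _ _).1 he).symm.trans (hiso w₀ hw₀))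
    have hmk : ∀ w ∈ U, ModuliSpace.mk (T w) = classifying h (ζ w) := fun w hw =>
      (mk_eq_mk_iff _ _).2 (hiso w hw)
    have hpt : AnalyticAt ℂ (fun w => pt (ζ w)) w₀ := analyticAt_pi_iff.2 (han w₀ hw₀)
    have h1 := hf (ζ w₀) (by rwa [← hmk w₀ hw₀])
    refine (h1.comp_of_eq hpt rfl).congr ?_
    filter_upwards [hT.1.mem_nhds hw₀] with w hw
    simp only [Function.comp_apply, ofVec_pt, hmk w hw]

end Uniformization

/-! ### The isomorphism with the Hilbert modular surface -/

section HilbertSurface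

variable {d₁ d₂ : ℕ} {𝔞 : Ideal (quadOrder D)}

theorem hilbertSurface_mk_eq_mk_iff (z z' : ℍ × ℍ) :
    HilbertSurface.mk 𝔞 z = HilbertSurface.mk 𝔞 z' ↔ ∃ M ∈ hilbertSL 𝔞, slPerm D M z' = z := by
  refine Quotient.eq.trans ?_
  rw [MulAction.orbitRel_apply, MulAction.mem_orbit_iff]
  constructor
  · rintro ⟨g, hg⟩
    obtain ⟨M, rfl⟩ := QuotientGroup.mk_surjective g
    exact ⟨M, M.2, hg⟩
  · rintro ⟨M, hM, hz⟩
    exact ⟨((⟨M, hM⟩ : hilbertSL 𝔞) : HilbertPSL 𝔞), hz⟩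

/-- The isomorphism `[z] ↦ [(A_z, H_z, ρ_z)]` from the Hilbert modular surface onto `X_𝔞`, as a
homeomorphism: it is induced by the continuous open map `classifying`. -/
theorem exists_homeomorph [IsNonsquareDisc D] (hd₁ : 0 < d₁) (h𝔞 : IdealHasType 𝔞 d₁ d₂)
    (h : ∀ z, (torusAt 𝔞 z).IsRM d₁ d₂) :
    ∃ Φ : HilbertSurface 𝔞 ≃ₜ component d₁ d₂ 𝔞,
      ∀ z, (Φ (HilbertSurface.mk 𝔞 z) : ModuliSpace D d₁ d₂) = classifying h z := by
  let φ : ℍ × ℍ → component d₁ d₂ 𝔞 := fun z => ⟨classifying h z, z, h z, rfl⟩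
  have hiff : ∀ z z', φ z = φ z' ↔ HilbertSurface.mk 𝔞 z = HilbertSurface.mk 𝔞 z' := fun z z' => by
    rw [hilbertSurface_mk_eq_mk_iff, ← classifying_eq_iff h hd₁ h𝔞, Subtype.ext_iff]
  have hcont : Continuous φ := (continuous_classifying h h𝔞).subtype_mk _
  have hopen : IsOpenMap φ := fun W hW => by
    have h1 := (isOpenMap_classifying h hd₁ h𝔞 W hW).preimage
      (continuous_subtype_val (p := (· ∈ component d₁ d₂ 𝔞)))
    convert h1 using 1
    ext c
    simp only [Set.mem_image, Set.mem_preimage, φ, Subtype.ext_iff]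
  let Ψ : HilbertSurface 𝔞 → component d₁ d₂ 𝔞 :=
    Quotient.lift φ fun z z' hz => (hiff z z').2 (Quotient.sound hz)
  have hΨ : Function.Bijective Ψ := by
    constructor
    · intro q q'
      induction q, q' using Quotient.inductionOn₂ with
      | h z z' => exact fun he => (hiff z z').1 he
    · rintro ⟨c, z, hz, rfl⟩
      exact ⟨HilbertSurface.mk 𝔞 z, rfl⟩
  have hΨc : Continuous Ψ := hcont.quotient_lift _
  have hΨo : IsOpenMap Ψ := fun W hW => by
    have h1 := hopen _ (hW.preimage continuous_quotient_mk')
    convert h1 using 1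
    ext c
    constructor
    · rintro ⟨q, hq, rfl⟩
      induction q using Quotient.inductionOn with
      | h z => exact ⟨z, hq, rfl⟩
    · rintro ⟨z, hz, rfl⟩
      exact ⟨_, hz, rfl⟩
  exact ⟨(Equiv.ofBijective Ψ hΨ).toHomeomorphOfContinuousOpen hΨc hΨo, fun z => rfl⟩

/-- Holomorphy in the coordinates of `ℂ × ℂ` and in those of `Fin 2 → ℂ`. -/
theorem analyticAt_pt_iff (g : ℍ × ℍ → ℂ) (z : ℍ × ℍ) :
    AnalyticAt ℂ (fun w => g (ofVec w)) (pt z) ↔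
      AnalyticAt ℂ (fun w : ℂ × ℂ => g (UpperHalfPlane.ofComplex w.1, UpperHalfPlane.ofComplex w.2))
        ((z.1 : ℂ), (z.2 : ℂ)) := by
  let e := ContinuousLinearEquiv.finTwoArrow ℂ ℂ
  constructor
  · intro hg
    exact hg.comp_of_eq (e.symm.analyticAt ((z.1 : ℂ), (z.2 : ℂ))) (by ext i; fin_cases i <;> rfl)
  · intro hg
    exact hg.comp_of_eq (e.analyticAt (pt z)) rfl

end HilbertSurface

/-! ### Irreducible components -/

section Irreducible

variable {d₁ d₂ : ℕ}

/-- The identity theorem for a set which is locally the zero set of analytic functions: if it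
contains a nonempty open subset of a connected set, then it contains that set. -/
theorem subset_of_mem_interior {n : ℕ} {s A : Set (Fin n → ℂ)} (hs : IsPreconnected s)
    (hA : ∀ x ∈ s, ∃ N ∈ nhds x, ∃ F : Set ((Fin n → ℂ) → ℂ), (∀ f ∈ F, AnalyticOnNhd ℂ f N) ∧
      A ∩ N = {y ∈ N | ∀ f ∈ F, f y = 0}) {x₀ : Fin n → ℂ} (hx₀ : x₀ ∈ s)
    (hx₀A : x₀ ∈ interior A) : s ⊆ A := by
  refine (hs.subset_of_closure_inter_subset isOpen_interior ⟨x₀, hx₀, hx₀A⟩ ?_).trans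
    interior_subset
  rintro x ⟨hxA, hxs⟩
  obtain ⟨N, hN, F, hF, hAN⟩ := hA x hxs
  obtain ⟨ε, hε, hball⟩ := Metric.mem_nhds_iff.1 hN
  obtain ⟨y, hyB, hyA⟩ := mem_closure_iff.1 hxA _ Metric.isOpen_ball (Metric.mem_ball_self hε)
  have hzero : ∀ f ∈ F, Set.EqOn f 0 (Metric.ball x ε) := fun f hf => by
    refine ((hF f hf).mono hball).eqOn_zero_of_preconnected_of_eventuallyEq_zero
      (convex_ball x ε).isPreconnected hyB ?_
    filter_upwards [isOpen_interior.mem_nhds hyA, Metric.isOpen_ball.mem_nhds hyB] with y' h1 h2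
    have h3 : y' ∈ A ∩ N := ⟨interior_subset h1, hball h2⟩
    rw [hAN] at h3
    exact h3.2 f hf
  refine mem_interior.2 ⟨_, fun y' hy' => ?_, Metric.isOpen_ball, Metric.mem_ball_self hε⟩
  have h3 : y' ∈ A ∩ N := by
    rw [hAN]
    exact ⟨hball hy', fun f hf => hzero f hf hy'⟩
  exact h3.1

/-- Analytic subsets pull back to analytic subsets under the classifying map of a family. -/
theorem IsAnalyticSubset.pullback {Z : Set (ModuliSpace D d₁ d₂)} (hZ : IsAnalyticSubset Z) {n : ℕ}
    {U : Set (Fin n → ℂ)} {T : (Fin n → ℂ) → Surface D d₁ d₂} (hT : IsHolomorphicFamily U T)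
    {x : Fin n → ℂ} (hx : x ∈ U) :
    ∃ N ∈ nhds x, ∃ F : Set ((Fin n → ℂ) → ℂ), (∀ f ∈ F, AnalyticOnNhd ℂ f N) ∧
      {w | ModuliSpace.mk (T w) ∈ Z} ∩ N = {y ∈ N | ∀ f ∈ F, f y = 0} := by
  obtain ⟨S, hS, hxS, F, -, hF, hZS⟩ := hZ (ModuliSpace.mk (T x))
  refine ⟨{w | w ∈ U ∧ ModuliSpace.mk (T w) ∈ S}, (hS n U T hT).mem_nhds ⟨hx, hxS⟩,
    (fun f w => f (ModuliSpace.mk (T w))) '' F, ?_, ?_⟩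
  · rintro _ ⟨f, hf, rfl⟩
    exact hF f hf n U T hT
  · ext w
    simp only [Set.mem_inter_iff, Set.mem_ofPred_eq, Set.forall_mem_image]
    have := Set.ext_iff.1 hZS (ModuliSpace.mk (T w))
    simp only [Set.mem_inter_iff, Set.mem_ofPred_eq] at this
    tauto

theorem isAnalyticSubset_univ : IsAnalyticSubset (Set.univ : Set (ModuliSpace D d₁ d₂)) :=
  fun x => ⟨Set.univ, isOpen_univ, trivial, ∅, Set.finite_empty, by simp, by simp⟩

theorem HolomorphicOn.mono {S S' : Set (ModuliSpace D d₁ d₂)} {f : ModuliSpace D d₁ d₂ → ℂ}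
    (hf : HolomorphicOn S f) (h : S' ⊆ S) : HolomorphicOn S' f :=
  fun n U T hT => (hf n U T hT).mono fun _ hw => ⟨hw.1, h hw.2⟩

theorem IsAnalyticSubset.inter_isClopen {Z W : Set (ModuliSpace D d₁ d₂)} (hZ : IsAnalyticSubset Z)
    (hW : IsClopen W) : IsAnalyticSubset (Z ∩ W) := by
  intro x
  by_cases hx : x ∈ W
  · obtain ⟨S, hS, hxS, F, hFfin, hF, hZS⟩ := hZ x
    refine ⟨S ∩ W, hS.inter hW.isOpen, ⟨hxS, hx⟩, F, hFfin,
      fun f hf => (hF f hf).mono Set.inter_subset_left, ?_⟩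
    ext y
    have := Set.ext_iff.1 hZS y
    simp only [Set.mem_inter_iff, Set.mem_ofPred_eq] at this ⊢
    tauto
  · refine ⟨Wᶜ, hW.compl.isOpen, hx, {fun _ => 1}, Set.finite_singleton _, ?_, ?_⟩
    · rintro f rfl n U T hT w hw
      exact analyticAt_const
    · ext y
      simp only [Set.mem_inter_iff, Set.mem_ofPred_eq, Set.mem_compl_iff, Set.mem_singleton_iff,
        forall_eq, one_ne_zero, and_false, iff_false]
      tauto

/-- An irreducible analytic subset lies on one side of every open and closed subset. -/
theorem IsIrredAnalytic.subset_of_isClopen {Z W : Set (ModuliSpace D d₁ d₂)}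
    (hZ : IsIrredAnalytic Z) (hW : IsClopen W) (hne : (Z ∩ W).Nonempty) : Z ⊆ W := by
  rcases hZ.2.2 (Z ∩ W) (Z ∩ Wᶜ) (hZ.1.inter_isClopen hW) (hZ.1.inter_isClopen hW.compl)
    (by rw [← Set.inter_union_distrib_left, Set.union_compl_self, Set.inter_univ]) with h | h
  · exact fun x hx => (h ▸ hx : x ∈ Z ∩ W).2
  · obtain ⟨x, hx, hxW⟩ := hne
    rw [h] at hx
    exact absurd hxW hx.2

variable [IsNonsquareDisc D] {𝔞 : Ideal (quadOrder D)}

/-- The locus `X_𝔞` is irreducible since it is the image of the connected manifold `ℍ²`. -/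
theorem isIrredAnalytic_component (hd₁ : 0 < d₁) (hd₂ : 0 < d₂) (h𝔞 : IdealHasType 𝔞 d₁ d₂) :
    IsIrredAnalytic (component d₁ d₂ 𝔞) := by
  have h := isRM_torusAt hd₁ hd₂ h𝔞
  have hT := isHolomorphicFamily_tautFamily h𝔞 h
  refine ⟨?_, ?_, fun Z₁ Z₂ hZ₁ hZ₂ hZ => ?_⟩
  · simpa using isAnalyticSubset_univ.inter_isClopen (isClopen_component hd₁ hd₂ h𝔞)
  · rw [component_eq_range h]
    exact Set.range_nonempty _
  by_cases hsub : upperSet ⊆ {w | ModuliSpace.mk (tautFamily h w) ∈ Z₁}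
  · refine .inl (Set.Subset.antisymm ?_ (hZ ▸ Set.subset_union_left))
    rw [component_eq_range h]
    rintro _ ⟨z, rfl⟩
    have := hsub (pt_mem_upperSet z)
    rwa [Set.mem_ofPred_eq, mk_tautFamily_pt] at this
  right
  obtain ⟨x, hx, hxZ⟩ := Set.not_subset.1 hsub
  have hcover : ∀ w, ModuliSpace.mk (tautFamily h w) ∈ Z₁ ∪ Z₂ := fun w => by
    rw [← hZ]
    exact ⟨_, _, rfl⟩
  -- near `x` some function in a local description of `Z₁` does not vanish
  have hint : x ∈ interior {w | ModuliSpace.mk (tautFamily h w) ∈ Z₂} := by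
    obtain ⟨N, hN, F, hF, hZN⟩ := hZ₁.pullback hT hx
    have hxN : x ∉ {y ∈ N | ∀ f ∈ F, f y = 0} := hZN ▸ fun hh => hxZ hh.1
    obtain ⟨f, hf, hfx⟩ : ∃ f ∈ F, f x ≠ 0 := by
      by_contra! hcon
      exact hxN ⟨mem_of_mem_nhds hN, hcon⟩
    rw [mem_interior_iff_mem_nhds]
    filter_upwards [hN, (hF f hf x (mem_of_mem_nhds hN)).continuousAt.eventually_ne hfx]
      with y hyN hy
    refine (hcover y).resolve_left fun hy1 => hy ?_
    have : y ∈ {w | ModuliSpace.mk (tautFamily h w) ∈ Z₁} ∩ N := ⟨hy1, hyN⟩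
    rw [hZN] at this
    exact this.2 f hf
  have hall := subset_of_mem_interior isPreconnected_upperSet
    (fun y hy => hZ₂.pullback hT hy) hx hint
  refine Set.Subset.antisymm ?_ (hZ ▸ Set.subset_union_right)
  rw [component_eq_range h]
  rintro _ ⟨z, rfl⟩
  have := hall (pt_mem_upperSet z)
  rwa [Set.mem_ofPred_eq, mk_tautFamily_pt] at this

theorem setOf_isIrredComponent (hd₁ : 0 < d₁) (hd₂ : 0 < d₂) :
    {Z : Set (ModuliSpace D d₁ d₂) | IsIrredComponent Z} =
      component d₁ d₂ '' {𝔞 : Ideal (quadOrder D) | IdealHasType 𝔞 d₁ d₂} := by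
  have key : ∀ {Z : Set (ModuliSpace D d₁ d₂)} {𝔞}, IsIrredAnalytic Z → IdealHasType 𝔞 d₁ d₂ →
      (Z ∩ component d₁ d₂ 𝔞).Nonempty → Z ⊆ component d₁ d₂ 𝔞 := fun hZ h𝔞 hne =>
    hZ.subset_of_isClopen (isClopen_component hd₁ hd₂ h𝔞) hne
  ext Z
  constructor
  · intro hZ
    obtain ⟨c, hc⟩ := hZ.1.2.1
    obtain ⟨𝔞, h𝔞, hc𝔞⟩ := exists_mem_component hd₁ hd₂ c
    have hsub := key hZ.1 h𝔞 ⟨c, hc, hc𝔞⟩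
    exact ⟨𝔞, h𝔞, (hsub.antisymm (hZ.2 (isIrredAnalytic_component hd₁ hd₂ h𝔞) hsub)).symm⟩
  · rintro ⟨𝔞, h𝔞, rfl⟩
    have hirr := isIrredAnalytic_component hd₁ hd₂ h𝔞
    refine ⟨hirr, fun Z hZ hle => key hZ h𝔞 ?_⟩
    obtain ⟨c, hc⟩ := hirr.2.1
    exact ⟨c, hle hc, hc⟩

theorem injOn_component (hd₁ : 0 < d₁) (hd₂ : 0 < d₂) :
    Set.InjOn (component d₁ d₂) {𝔞 : Ideal (quadOrder D) | IdealHasType 𝔞 d₁ d₂} := by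
  intro 𝔞 h𝔞 𝔟 h𝔟 he
  by_contra hne
  obtain ⟨c, hc⟩ := (isIrredAnalytic_component hd₁ hd₂ h𝔞).2.1
  exact Set.disjoint_left.1 (pairwiseDisjoint_component hd₁ h𝔞 h𝔟 hne) hc (he ▸ hc)

end Irreducible

/-! ### The ideals of a given type -/

/-- The trace pairing as a bilinear form over `ℤ`. -/
def traceForm (D : ℕ) : K D × K D →ₗ[ℤ] K D × K D →ₗ[ℤ] ℚ :=
  LinearMap.mk₂ ℤ tracePairing
    (fun u u' v => by simp [tracePairing, mul_add, add_mul]; ring)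
    (fun c u v => by
      simp only [tracePairing, Prod.smul_fst, Prod.smul_snd, mul_smul_comm, smul_mul_assoc,
        ← smul_sub, map_zsmul])
    (fun u v v' => by simp [tracePairing, mul_add, add_mul]; ring)
    (fun c u v => by
      simp only [tracePairing, Prod.smul_fst, Prod.smul_snd, mul_smul_comm, smul_mul_assoc,
        ← smul_sub, map_zsmul])

theorem traceForm_apply (u v : K D × K D) : traceForm D u v = tracePairing u v := rfl

section UniqueType

variable {M : Type} [AddCommGroup M] {Λ : Submodule ℤ M} {B : M →ₗ[ℤ] M →ₗ[ℤ] ℚ}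

/-- The pairing with the vectors of a symplectic basis reads off the coordinates. -/
theorem pairing_sum {d₁ d₂ : ℕ} {b : Fin 2 ⊕ Fin 2 → M}
    (hb : ∀ i j : Fin 2,
      B (b (.inl i)) (b (.inl j)) = 0 ∧ B (b (.inr i)) (b (.inr j)) = 0 ∧
      B (b (.inl i)) (b (.inr j)) = (if i = j then ((![d₁, d₂] i : ℕ) : ℚ) else 0) ∧
      B (b (.inr j)) (b (.inl i)) = -(if i = j then ((![d₁, d₂] i : ℕ) : ℚ) else 0))
    (c : Fin 2 ⊕ Fin 2 → ℤ) (j : Fin 2) :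
    B (b (.inl j)) (∑ i, c i • b i) = c (.inr j) * (![d₁, d₂] j : ℕ) ∧
      B (∑ i, c i • b i) (b (.inr j)) = c (.inl j) * (![d₁, d₂] j : ℕ) ∧
      B (∑ i, c i • b i) (b (.inl j)) = -(c (.inr j) * (![d₁, d₂] j : ℕ)) := by
  have h1 := fun i j => (hb i j).1
  have h2 := fun i j => (hb i j).2.1
  have h3 := fun i j => (hb i j).2.2.1
  have h4 := fun i j => (hb i j).2.2.2
  simp only [map_add, map_smul, Fintype.sum_sum_type, Fin.sum_univ_two, LinearMap.add_apply,
    LinearMap.smul_apply, h1, h2, h3, h4]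
  fin_cases j <;> simp

theorem coe_eq_sum_repr (b : Module.Basis (Fin 2 ⊕ Fin 2) ℤ Λ) (v : Λ) :
    (v : M) = ∑ i, b.repr v i • (b i : M) := by
  conv_lhs => rw [← b.sum_repr v]
  rw [AddSubmonoidClass.coe_finsetSum]
  rfl

/-- The second entry of the type is determined by the form: it is the largest integer which divides
all values of the form at some primitive vector. Here one divisibility is shown; the other follows
by symmetry. -/
theorem HasType.dvd_of_hasType {d₁ d₂ e₁ e₂ : ℕ} (he : e₁ ∣ e₂)
    (hd : HasType Λ (fun v w => B v w) d₁ d₂) (h : HasType Λ (fun v w => B v w) e₁ e₂) :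
    d₂ ∣ e₂ := by
  obtain ⟨b, hb⟩ := hd
  obtain ⟨c, hc⟩ := h
  -- all values `B v w` are divisible by `d₂`, so the coordinates of `e₂ v` are divisible by `d₂`
  set v := b (.inl 1)
  have h1 : ∀ w : Λ, B v w = b.repr w (.inr 1) * (d₂ : ℚ) := fun w => by
    rw [coe_eq_sum_repr b w]
    exact (pairing_sum (b := fun i => (b i : M)) hb _ 1).1
  have h2 : ∀ j : Fin 2, ∀ k ∈ [Sum.inl j, Sum.inr j],
      (d₂ : ℤ) ∣ c.repr v k * (![e₁, e₂] j : ℕ) := by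
    intro j k hk
    have h3 := (pairing_sum (b := fun i => (c i : M)) hc (c.repr v) j).2
    rw [← coe_eq_sum_repr, h1, h1] at h3
    simp only [List.mem_cons, List.not_mem_nil, or_false] at hk
    rcases hk with rfl | rfl
    · refine ⟨b.repr (c (.inr j)) (.inr 1), ?_⟩
      rw [mul_comm (d₂ : ℤ)]
      exact_mod_cast h3.1.symm
    · refine ⟨-b.repr (c (.inl j)) (.inr 1), ?_⟩
      rw [mul_comm (d₂ : ℤ), neg_mul]
      exact_mod_cast (neg_eq_iff_eq_neg.2 h3.2).symm
  have h4 : ∀ k, (d₂ : ℤ) ∣ c.repr v k * e₂ := by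
    have h5 : ∀ j : Fin 2, ((![e₁, e₂] j : ℕ) : ℤ) ∣ e₂ := fun j => by
      fin_cases j
      · exact Int.natCast_dvd_natCast.2 he
      · exact dvd_rfl
    rintro (j | j)
    · exact (h2 j _ (by simp)).trans (mul_dvd_mul_left _ (h5 j))
    · exact (h2 j _ (by simp)).trans (mul_dvd_mul_left _ (h5 j))
  choose m hm using h4
  have h5 : (e₂ : ℤ) • v = (d₂ : ℤ) • ∑ k, m k • c k := by
    conv_lhs => rw [← c.sum_repr v]
    rw [Finset.smul_sum, Finset.smul_sum]
    exact Finset.sum_congr rfl fun k _ => by rw [smul_smul, smul_smul, mul_comm, hm]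
  have h6 := congrArg (fun w => b.repr w (.inl 1)) h5
  simp only [map_smul, Finsupp.smul_apply, smul_eq_mul, v, b.repr_self, Finsupp.single_eq_same,
    mul_one] at h6
  exact Int.natCast_dvd_natCast.1 ⟨_, h6⟩

end UniqueType

/-- The value at an element `r` of a ring `R` of the minimal polynomial `X² - D X + (D² - D) / 4` of
`γ`. -/
def minPoly (D : ℕ) (R : Type) [CommRing R] (r : R) : R := r ^ 2 - D * r + (gamNorm D : ℤ)

theorem minPoly_intCast (n : ℕ) (r : ℤ) :
    minPoly D (ZMod n) r = 0 ↔ (n : ℤ) ∣ minPoly D ℤ r := by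
  rw [← ZMod.intCast_zmod_eq_zero_iff_dvd]
  simp [minPoly]

section IdealType

variable [IsNonsquareDisc D]

theorem minPoly_ne_zero (r : ℤ) : minPoly D ℤ r ≠ 0 := by
  intro h
  have h4 := four_mul_gamNorm D
  simp only [minPoly, Int.cast_id] at h
  have h5 : (2 * r - D) * (2 * r - D) = (D : ℤ) := by linarith [mul_self_nonneg r]
  exact ‹IsNonsquareDisc D›.not_isSquare ⟨(2 * r - D).natAbs, by
    zify
    rw [← sq, sq_abs, sq, h5]⟩

theorem tracePairing_inl_inr (x a : quadOrder D) :
    tracePairing ((x : K D), 0) (0, -(invSqrt D * (a : K D))) = genCoeff D (x * a) := by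
  rw [← trace_invSqrt_mul, tracePairing]
  congr 1
  push_cast
  ring

theorem genCoeff_natCast_mul (m : ℕ) (x : quadOrder D) : genCoeff D (m * x) = m * genCoeff D x := by
  rw [← nsmul_eq_mul, map_nsmul, nsmul_eq_mul]

/-- An ideal with `ℤ`-basis `d₁ k`, `d₁ (γ - r)` has type `(d₁, d₁ k)`: a symplectic basis of
`𝓞_D ⊕ (1/√D) 𝔞` is given by `1`, `γ + r - D` in the first summand and the negatives of
`d₁ (γ - r) / √D`, `d₁ k / √D` in the second one. -/
theorem idealHasType_of_mem_iff {𝔞 : Ideal (quadOrder D)} {d₁ k : ℕ} (hd₁ : 0 < d₁) (hk : 0 < k)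
    (r : ℤ) (h : ∀ x, x ∈ 𝔞 ↔ ∃ a b : ℤ, x = d₁ * (a + b * gen D) ∧ (k : ℤ) ∣ a + b * r) :
    IdealHasType 𝔞 d₁ (d₁ * k) := by
  let x : Fin 2 → quadOrder D := ![1, gen D + (r - D : ℤ)]
  let y : Fin 2 → quadOrder D := ![d₁ * (gen D - r), d₁ * k]
  have hy : ∀ j, y j ∈ 𝔞 := Fin.forall_fin_two.2
    ⟨(h _).2 ⟨-r, 1, by simp only [y, Matrix.cons_val_zero]; push_cast; ring, by simp⟩,
      (h _).2 ⟨k, 0, by simp [y], by simp⟩⟩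
  have hE : ∀ i j, genCoeff D (x i * y j) = if i = j then ((![d₁, d₁ * k] i : ℕ) : ℤ) else 0 := by
    have e1 : x 0 * y 0 = ((d₁ * -r : ℤ) : quadOrder D) + (d₁ : ℤ) * gen D := by
      simp [x, y]; ring
    have e2 : x 0 * y 1 = ((d₁ * k : ℤ) : quadOrder D) + (0 : ℤ) * gen D := by simp [x, y]
    have e3 : x 1 * y 0 = ((-d₁ * minPoly D ℤ r : ℤ) : quadOrder D) + (0 : ℤ) * gen D := by
      have : x 1 * y 0 = d₁ * (gen D * gen D - D * gen D - r ^ 2 + D * r) := by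
        simp [x, y]; ring
      rw [this, gen_mul_gen, minPoly]
      push_cast
      ring
    have e4 : x 1 * y 1 = ((d₁ * k * (r - D) : ℤ) : quadOrder D) + (d₁ * k : ℤ) * gen D := by
      simp [x, y]; ring
    intro i j
    fin_cases i <;> fin_cases j
    · exact (congrArg _ e1).trans (genCoeff_add_mul_gen _ _)
    · exact (congrArg _ e2).trans (genCoeff_add_mul_gen _ _)
    · exact (congrArg _ e3).trans (genCoeff_add_mul_gen _ _)
    · exact (congrArg _ e4).trans ((genCoeff_add_mul_gen _ _).trans (by simp))
  let v : Fin 2 ⊕ Fin 2 → pairModule 𝔞 := Sum.elim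
    (fun i => ⟨(x i, 0), mem_pairModule.2 ⟨(x i).2, Submodule.zero_mem _⟩⟩)
    (fun j => ⟨(0, -(invSqrt D * (y j : K D))), mem_pairModule.2 ⟨Subring.zero_mem _,
      Submodule.neg_mem _ ((mem_scaledIdeal _ _).2 ⟨y j, hy j, rfl⟩)⟩⟩)
  have hv : ∀ i j : Fin 2,
      traceForm D (v (.inl i)) (v (.inl j)) = 0 ∧ traceForm D (v (.inr i)) (v (.inr j)) = 0 ∧
      traceForm D (v (.inl i)) (v (.inr j)) =
        (if i = j then ((![d₁, d₁ * k] i : ℕ) : ℚ) else 0) ∧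
      traceForm D (v (.inr j)) (v (.inl i)) =
        -(if i = j then ((![d₁, d₁ * k] i : ℕ) : ℚ) else 0) := by
    intro i j
    have h1 : traceForm D (v (.inl i)) (v (.inr j)) =
        (if i = j then ((![d₁, d₁ * k] i : ℕ) : ℚ) else 0) := by
      refine (tracePairing_inl_inr (x i) (y j)).trans ?_
      rw [hE]
      split_ifs <;> simp
    refine ⟨?_, ?_, h1, ?_⟩
    · simp [v, traceForm_apply, tracePairing]
    · simp [v, traceForm_apply, tracePairing]
    · rw [← h1, traceForm_apply, traceForm_apply, tracePairing, tracePairing, ← map_neg, neg_sub]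
  have hli : LinearIndependent ℤ v := by
    rw [Fintype.linearIndependent_iff]
    intro c hc
    have hc' : ∑ i, c i • (v i : K D × K D) = 0 := by
      have := congrArg (Submodule.subtype _) hc
      simpa using this
    have hd : ∀ j : Fin 2, ((![d₁, d₁ * k] j : ℕ) : ℚ) ≠ 0 := fun j => by
      fin_cases j
      · exact_mod_cast hd₁.ne'
      · exact_mod_cast (Nat.mul_pos hd₁ hk).ne'
    rintro (j | j)
    · have := (pairing_sum (b := fun i => (v i : K D × K D)) hv c j).2.1
      rw [hc', map_zero, LinearMap.zero_apply] at this
      exact_mod_cast (mul_eq_zero.1 this.symm).resolve_right (hd j)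
    · have := (pairing_sum (b := fun i => (v i : K D × K D)) hv c j).1
      rw [hc', map_zero] at this
      exact_mod_cast (mul_eq_zero.1 this.symm).resolve_right (hd j)
  have hsp : ⊤ ≤ Submodule.span ℤ (Set.range v) := by
    rintro ⟨⟨p, q⟩, hpq⟩ -
    obtain ⟨hp, hq⟩ := mem_pairModule.1 hpq
    obtain ⟨a, b, hab⟩ := exists_eq_add_mul_gen (⟨p, hp⟩ : quadOrder D)
    obtain ⟨α, hα, hqα⟩ := (mem_scaledIdeal _ _).1 hq
    obtain ⟨a', b', rfl, m, hm⟩ := (h α).1 hα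
    have hp' : p = a + b * gam D := congrArg Subtype.val hab
    have ha' : a' = k * m - b' * r := by linarith
    have : (⟨(p, q), hpq⟩ : pairModule 𝔞) = (a - b * (r - D)) • v (.inl 0) + b • v (.inl 1)
        + (-b') • v (.inr 0) + (-m) • v (.inr 1) := by
      apply Subtype.ext
      refine Prod.ext ?_ ?_
      · simp [v, x, hp']
      · change q = _
        rw [show q = _ from hqα, ha']
        simp [v, y]
        ring
    rw [this]
    have hmem : ∀ i, v i ∈ Submodule.span ℤ (Set.range v) := fun i => Submodule.subset_span ⟨i, rfl⟩
    exact add_mem (add_mem (add_mem (Submodule.smul_mem _ _ (hmem _))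
      (Submodule.smul_mem _ _ (hmem _))) (Submodule.smul_mem _ _ (hmem _)))
      (Submodule.smul_mem _ _ (hmem _))
  refine ⟨Module.Basis.mk hli hsp, fun i j => ?_⟩
  simp only [Module.Basis.mk_apply]
  exact hv i j

/-- An ideal of type `(d₁, d₂)` is `d₁` times a primitive ideal: it has a basis `d₁ k`,
`d₁ (γ - r)`. -/
theorem exists_mem_iff_of_idealHasType {𝔞 : Ideal (quadOrder D)} {d₁ d₂ : ℕ} (hd₁ : 0 < d₁)
    (hdvd : d₁ ∣ d₂) (h : IdealHasType 𝔞 d₁ d₂) : ∃ (k : ℕ) (r : ℤ), 0 < k ∧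
      (k : ℤ) ∣ minPoly D ℤ r ∧
      ∀ x, x ∈ 𝔞 ↔ ∃ a b : ℤ, x = d₁ * (a + b * gen D) ∧ (k : ℤ) ∣ a + b * r := by
  obtain ⟨b, hb⟩ := h
  have hb' : ∀ i j : Fin 2, traceForm D (b (.inl i)) (b (.inl j)) = 0 ∧
      traceForm D (b (.inr i)) (b (.inr j)) = 0 ∧
      traceForm D (b (.inl i)) (b (.inr j)) = (if i = j then ((![d₁, d₂] i : ℕ) : ℚ) else 0) ∧
      traceForm D (b (.inr j)) (b (.inl i)) =
        -(if i = j then ((![d₁, d₂] i : ℕ) : ℚ) else 0) := hb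
  have hdvd' : ∀ j : Fin 2, (d₁ : ℤ) ∣ (![d₁, d₂] j : ℕ) := fun j => by
    fin_cases j
    · exact dvd_rfl
    · exact Int.natCast_dvd_natCast.2 hdvd
  -- all values of the pairing are divisible by `d₁`
  have hval : ∀ u v : pairModule 𝔞, ∃ m : ℤ, traceForm D u v = d₁ * m := by
    intro u v
    have h1 : ∀ i, ∃ m : ℤ, traceForm D u (b i) = d₁ * m := by
      rw [coe_eq_sum_repr b u]
      rintro (j | j)
      · obtain ⟨m, hm⟩ := hdvd' j
        refine ⟨-(b.repr u (.inr j) * m), ?_⟩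
        rw [(pairing_sum hb' (b.repr u) j).2.2]
        have : (((![d₁, d₂] j : ℕ) : ℤ) : ℚ) = d₁ * m := by rw [hm]; push_cast; rfl
        rw [← Int.cast_natCast (![d₁, d₂] j), this]
        push_cast
        ring
      · obtain ⟨m, hm⟩ := hdvd' j
        refine ⟨b.repr u (.inl j) * m, ?_⟩
        rw [(pairing_sum hb' (b.repr u) j).2.1]
        have : (((![d₁, d₂] j : ℕ) : ℤ) : ℚ) = d₁ * m := by rw [hm]; push_cast; rfl
        rw [← Int.cast_natCast (![d₁, d₂] j), this]
        push_cast
        ring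
    choose m hm using h1
    refine ⟨∑ i, b.repr v i * m i, ?_⟩
    rw [coe_eq_sum_repr b v, map_sum, Int.cast_sum, Finset.mul_sum]
    refine Finset.sum_congr rfl fun i _ => ?_
    rw [map_smul, hm, zsmul_eq_mul]
    push_cast
    ring
  have hcoeff : ∀ x : quadOrder D, ∀ a ∈ 𝔞, (d₁ : ℤ) ∣ genCoeff D (x * a) := by
    intro x a ha
    obtain ⟨m, hm⟩ := hval ⟨(x, 0), mem_pairModule.2 ⟨x.2, Submodule.zero_mem _⟩⟩
      ⟨(0, -(invSqrt D * (a : K D))), mem_pairModule.2 ⟨Subring.zero_mem _,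
        Submodule.neg_mem _ ((mem_scaledIdeal _ _).2 ⟨a, ha, rfl⟩)⟩⟩
    refine ⟨m, ?_⟩
    have := (tracePairing_inl_inr x a).symm.trans hm
    exact_mod_cast this
  have hdiv : ∀ x ∈ 𝔞, ∃ a b : ℤ, x = d₁ * (a + b * gen D) := by
    intro x hx
    obtain ⟨s, t, rfl⟩ := exists_eq_add_mul_gen x
    obtain ⟨t', ht⟩ : (d₁ : ℤ) ∣ t := by
      have := hcoeff 1 _ hx
      rwa [one_mul, genCoeff_add_mul_gen] at this
    obtain ⟨s', hs⟩ : (d₁ : ℤ) ∣ s := by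
      have h1 := hcoeff (gen D) _ hx
      have h2 : gen D * (s + t * gen D) = ((-(t * gamNorm D) : ℤ) : quadOrder D)
          + ((s + t * D : ℤ) : quadOrder D) * gen D := by
        rw [mul_add, mul_left_comm, gen_mul_gen]
        push_cast
        ring
      rw [h2, genCoeff_add_mul_gen, ht, mul_assoc] at h1
      exact (Int.dvd_add_left (dvd_mul_right _ _)).1 h1
    exact ⟨s', t', by rw [hs, ht]; push_cast; ring⟩
  -- an element of `𝔞` of the form `d₁ (γ - r)` comes from a value `d₁` of the pairing
  obtain ⟨r, hr⟩ : ∃ r : ℤ, (d₁ * (gen D - r) : quadOrder D) ∈ 𝔞 := by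
    obtain ⟨hx, hy⟩ := mem_pairModule.1 (b (.inl 0)).2
    obtain ⟨hx', hy'⟩ := mem_pairModule.1 (b (.inr 0)).2
    obtain ⟨a, ha, hya⟩ := (mem_scaledIdeal _ _).1 hy
    obtain ⟨a', ha', hya'⟩ := (mem_scaledIdeal _ _).1 hy'
    have h1 : tracePairing (b (.inl 0) : K D × K D) (b (.inr 0)) = d₁ := (hb 0 0).2.2.1
    set e : quadOrder D := ⟨_, hx'⟩ * a - ⟨_, hx⟩ * a'
    have he : e ∈ 𝔞 := sub_mem (Ideal.mul_mem_left _ _ ha) (Ideal.mul_mem_left _ _ ha')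
    have h2 : (genCoeff D e : ℚ) = d₁ := by
      rw [← h1, ← trace_invSqrt_mul, tracePairing, hya, hya']
      congr 1
      simp only [e, AddSubgroupClass.coe_sub, Subring.coe_mul]
      ring
    obtain ⟨s, t, hst⟩ := hdiv e he
    have h3 : genCoeff D e = d₁ * t := by
      rw [hst, genCoeff_natCast_mul, genCoeff_add_mul_gen]
    have ht : t = 1 := by
      have h4 : (d₁ : ℤ) * t = d₁ * 1 := by
        rw [← h3, mul_one]
        exact_mod_cast h2
      exact mul_left_cancel₀ (by exact_mod_cast hd₁.ne') h4
    refine ⟨-s, ?_⟩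
    rw [hst, ht] at he
    convert he using 2
    push_cast
    ring
  -- the integers `m` with `d₁ m ∈ 𝔞`
  let J : Ideal ℤ := Ideal.comap (Int.castRingHom (quadOrder D))
    (Submodule.comap (LinearMap.mulLeft (quadOrder D) (d₁ : quadOrder D)) 𝔞)
  have hJ : ∀ m : ℤ, m ∈ J ↔ (d₁ * m : quadOrder D) ∈ 𝔞 := fun m => Iff.rfl
  obtain ⟨k₀, hk₀⟩ := (IsPrincipalIdealRing.principal J).principal
  have hJk : ∀ m : ℤ, m ∈ J ↔ (k₀.natAbs : ℤ) ∣ m := fun m => by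
    rw [hk₀, Int.natAbs_dvd]
    exact Ideal.mem_span_singleton
  have hmin : (k₀.natAbs : ℤ) ∣ minPoly D ℤ r := by
    rw [← hJk, hJ]
    have h1 := 𝔞.mul_mem_left (D - r - gen D) hr
    convert h1 using 1
    have h2 : (D - r - gen D) * (d₁ * (gen D - r)) =
        d₁ * (D * gen D - gen D * gen D - D * r + r ^ 2) := by ring
    rw [h2, gen_mul_gen, minPoly]
    push_cast
    ring
  refine ⟨k₀.natAbs, r, ?_, hmin, fun x => ⟨fun hx => ?_, ?_⟩⟩
  · rw [Nat.pos_iff_ne_zero]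
    rintro h0
    rw [h0] at hmin
    exact minPoly_ne_zero r (by simpa using hmin)
  · obtain ⟨s, t, rfl⟩ := hdiv x hx
    refine ⟨s, t, rfl, (hJk _).1 ((hJ _).2 ?_)⟩
    have := sub_mem hx (𝔞.mul_mem_left t hr)
    convert this using 1
    push_cast
    ring
  · rintro ⟨s, t, rfl, hst⟩
    have := add_mem ((hJ _).1 ((hJk _).2 hst)) (𝔞.mul_mem_left t hr)
    convert this using 1
    push_cast
    ring

/-- The ideals of type `(d₁, d₁ n)` are those with `ℤ`-basis `d₁ n`, `d₁ (γ - r)`, where `r` is a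
root modulo `n` of the minimal polynomial of `γ`. -/
theorem idealHasType_iff {𝔞 : Ideal (quadOrder D)} {d₁ n : ℕ} (hd₁ : 0 < d₁) (hn : 0 < n) :
    IdealHasType 𝔞 d₁ (d₁ * n) ↔ ∃ r : ℤ, (n : ℤ) ∣ minPoly D ℤ r ∧
      ∀ x, x ∈ 𝔞 ↔ ∃ a b : ℤ, x = d₁ * (a + b * gen D) ∧ (n : ℤ) ∣ a + b * r := by
  constructor
  · intro h
    obtain ⟨k, r, hk, hmin, hmem⟩ := exists_mem_iff_of_idealHasType hd₁ (dvd_mul_right _ _) h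
    have h' := idealHasType_of_mem_iff hd₁ hk r hmem
    have hkn : k = n := Nat.dvd_antisymm
      (Nat.dvd_of_mul_dvd_mul_left hd₁ (HasType.dvd_of_hasType (B := traceForm D)
        (dvd_mul_right _ _) h' h))
      (Nat.dvd_of_mul_dvd_mul_left hd₁ (HasType.dvd_of_hasType (B := traceForm D)
        (dvd_mul_right _ _) h h'))
    exact ⟨r, hkn ▸ hmin, hkn ▸ hmem⟩
  · rintro ⟨r, -, hmem⟩
    exact idealHasType_of_mem_iff hd₁ hn r hmem

/-- The ideal `d₁ (n, γ - r)`, for a root `r` modulo `n` of the minimal polynomial of `γ`. -/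
def rootIdeal (d₁ : ℕ) {n : ℕ} (r : ZMod n) (hr : minPoly D (ZMod n) r = 0) :
    Ideal (quadOrder D) where
  carrier := {x | ∃ a b : ℤ, x = d₁ * (a + b * gen D) ∧ (a + b * r : ZMod n) = 0}
  zero_mem' := ⟨0, 0, by simp, by simp⟩
  add_mem' := by
    rintro _ _ ⟨a, b, rfl, h⟩ ⟨a', b', rfl, h'⟩
    refine ⟨a + a', b + b', by push_cast; ring, ?_⟩
    push_cast
    linear_combination h + h'
  smul_mem' := by
    rintro c _ ⟨a, b, rfl, h⟩
    obtain ⟨s, t, rfl⟩ := exists_eq_add_mul_gen c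
    refine ⟨s * a - t * b * gamNorm D, s * b + t * a + t * b * D, ?_, ?_⟩
    · push_cast
      linear_combination (d₁ * t * b) * gen_mul_gen D
    · push_cast
      rw [minPoly] at hr
      linear_combination (s + t * r) * h - t * b * hr

theorem mem_rootIdeal (d₁ : ℕ) {n : ℕ} (r : ZMod n) (hr : minPoly D (ZMod n) r = 0) {r' : ℤ}
    (hr' : (r' : ZMod n) = r) (x : quadOrder D) :
    x ∈ rootIdeal d₁ r hr ↔ ∃ a b : ℤ, x = d₁ * (a + b * gen D) ∧ (n : ℤ) ∣ a + b * r' := by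
  have : ∀ a b : ℤ, (a + b * r : ZMod n) = 0 ↔ (n : ℤ) ∣ a + b * r' := fun a b => by
    rw [← ZMod.intCast_zmod_eq_zero_iff_dvd, ← hr']
    push_cast
    rfl
  simp only [← this]
  rfl

/-- The ideals of type `(d₁, d₁ n)` correspond to the roots modulo `n` of the minimal polynomial
of `γ`. -/
theorem ncard_idealHasType {d₁ n : ℕ} (hd₁ : 0 < d₁) (hn : 0 < n) :
    {𝔞 : Ideal (quadOrder D) | IdealHasType 𝔞 d₁ (d₁ * n)}.ncard =
      {r : ZMod n | minPoly D (ZMod n) r = 0}.ncard := by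
  symm
  refine Set.ncard_congr (fun r hr => rootIdeal d₁ r hr) (fun r hr => ?_) (fun r s hr hs he => ?_)
    fun 𝔞 h𝔞 => ?_
  · obtain ⟨r', rfl⟩ := ZMod.intCast_surjective r
    exact (idealHasType_iff hd₁ hn).2 ⟨r', (minPoly_intCast n r').1 hr, mem_rootIdeal d₁ _ hr rfl⟩
  · obtain ⟨r', rfl⟩ := ZMod.intCast_surjective r
    obtain ⟨s', rfl⟩ := ZMod.intCast_surjective s
    have h1 : (d₁ * ((-r' : ℤ) + (1 : ℤ) * gen D) : quadOrder D) ∈ rootIdeal d₁ (r' : ZMod n) hr :=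
      (mem_rootIdeal d₁ _ hr rfl _).2 ⟨-r', 1, rfl, by simp⟩
    rw [he, mem_rootIdeal d₁ _ hs rfl] at h1
    obtain ⟨a, b, hab, hdvd⟩ := h1
    have hne : (d₁ : quadOrder D) ≠ 0 := by exact_mod_cast hd₁.ne'
    obtain ⟨rfl, rfl⟩ := add_mul_gen_inj (mul_left_cancel₀ hne hab)
    rw [← ZMod.intCast_zmod_eq_zero_iff_dvd] at hdvd
    push_cast at hdvd
    linear_combination -hdvd
  · obtain ⟨r, hr, hmem⟩ := (idealHasType_iff hd₁ hn).1 h𝔞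
    have hr' := (minPoly_intCast n r).2 hr
    exact ⟨r, hr', Ideal.ext fun x => (mem_rootIdeal d₁ _ hr' rfl x).trans (hmem x).symm⟩

end IdealType

/-! ### Decomposition of primes in a quadratic ring -/

section Decomposition

variable {A : Type} [CommRing A] {g : A} {t N : ℤ} {p : ℕ}

/-- The ring `A` is generated by the root `g` of `X² - t X + N` up to an index prime to `p`: `A =
ℤ[g] + p A`, and `ℤ[g] ∩ p A = p ℤ[g]` with `1`, `g` linearly independent modulo `p`, which is not
a zero divisor. Then `A / p` is the quotient of `𝔽_p[X]` by the reduction of the polynomial, and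
the decomposition of `p` in `A` can be read off from the roots modulo `p`. -/
structure IsMonogenicAt (g : A) (t N : ℤ) (p : ℕ) : Prop where
  prime : p.Prime
  quad : g * g = t * g - N
  exists_eq : ∀ x : A, ∃ (a b : ℤ) (y : A), x = a + b * g + p * y
  dvd : ∀ a b : ℤ, (p : A) ∣ a + b * g → (p : ℤ) ∣ a ∧ (p : ℤ) ∣ b
  regular : ∀ y : A, p * y = 0 → y = 0

/-- The prime ideal `(p, g - r)` attached to a root `r` modulo `p`. -/
def rootPrime (g : A) (p : ℕ) (r : ℤ) : Ideal A := Ideal.span {(p : A), g - r}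

theorem natCast_mem_rootPrime (g : A) (p : ℕ) (r : ℤ) : (p : A) ∈ rootPrime g p r :=
  Ideal.subset_span (by simp)

theorem sub_mem_rootPrime (g : A) (p : ℕ) (r : ℤ) : g - r ∈ rootPrime g p r :=
  Ideal.subset_span (by simp)

theorem natCast_dvd_intCast {m : ℤ} (hm : (p : ℤ) ∣ m) : (p : A) ∣ (m : A) := by
  obtain ⟨c, rfl⟩ := hm
  exact ⟨c, by push_cast; rfl⟩

theorem one_mem_of_not_dvd (hp : p.Prime) {I : Ideal A} (hI : (p : A) ∈ I) {a : ℤ}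
    (ha : (a : A) ∈ I) (hpa : ¬ (p : ℤ) ∣ a) : (1 : A) ∈ I := by
  obtain ⟨u, v, huv⟩ := (Nat.prime_iff_prime_int.1 hp).coprime_iff_not_dvd.2 hpa
  have : (1 : A) = u * p + v * a := by
    simpa using congrArg (Int.cast : ℤ → A) huv.symm
  rw [this]
  exact add_mem (I.mul_mem_left _ hI) (I.mul_mem_left _ ha)

/-- For a double root `r` modulo `p`, the prime ideals of `r` and of the conjugate root `t - r`
coincide. -/
theorem rootPrime_eq_conj {r : ℤ} (h2 : (p : ℤ) ∣ 2 * r - t) :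
    rootPrime g p (t - r) = rootPrime g p r := by
  obtain ⟨c, hc⟩ := natCast_dvd_intCast (A := A) h2
  have : g - ((t - r : ℤ) : A) = (g - r) + c * p := by
    rw [mul_comm c, ← hc]
    push_cast
    ring
  refine le_antisymm (Ideal.span_le.2 ?_) (Ideal.span_le.2 ?_)
  · rintro x (rfl | rfl)
    · exact natCast_mem_rootPrime g p r
    · rw [this]
      exact add_mem (sub_mem_rootPrime g p r) (Ideal.mul_mem_left _ _ (natCast_mem_rootPrime g p r))
  · rintro x (rfl | rfl)
    · exact natCast_mem_rootPrime g p _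
    · rw [← sub_eq_iff_eq_add] at this
      rw [← this]
      exact sub_mem (sub_mem_rootPrime g p _) (Ideal.mul_mem_left _ _ (natCast_mem_rootPrime g p _))

namespace IsMonogenicAt

variable (h : IsMonogenicAt g t N p)
include h

theorem mul_conj (r : ℤ) : (g - r) * (g - (t - r : ℤ)) = -((r ^ 2 - t * r + N : ℤ) : A) := by
  push_cast
  linear_combination h.quad

theorem not_dvd_sub (r : ℤ) : ¬ (p : A) ∣ g - r := fun hd => by
  have := (h.dvd (-r) 1 (by push_cast; convert hd using 1; ring)).2
  exact h.prime.one_lt.ne' (by simpa using Int.natAbs_dvd_natAbs.2 this)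

theorem one_notMem {r : ℤ} (hr : (p : ℤ) ∣ r ^ 2 - t * r + N) : (1 : A) ∉ rootPrime g p r := by
  intro h1
  obtain ⟨u, v, huv⟩ := Ideal.mem_span_pair.1 h1
  obtain ⟨c, hc⟩ := natCast_dvd_intCast (A := A) hr
  refine h.not_dvd_sub (t - r) ⟨u * (g - (t - r : ℤ)) - v * c, ?_⟩
  linear_combination (-(g - (t - r : ℤ))) * huv + v * h.mul_conj r - v * hc

theorem exists_sub_mem (r : ℤ) (x : A) : ∃ a : ℤ, x - a ∈ rootPrime g p r := by
  obtain ⟨a, b, y, rfl⟩ := h.exists_eq x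
  refine ⟨a + b * r, ?_⟩
  have := add_mem (Ideal.mul_mem_left _ (b : A) (sub_mem_rootPrime g p r))
    (Ideal.mul_mem_left _ y (natCast_mem_rootPrime g p r))
  convert this using 1
  push_cast
  ring

theorem isMaximal_rootPrime {r : ℤ} (hr : (p : ℤ) ∣ r ^ 2 - t * r + N) :
    (rootPrime g p r).IsMaximal := by
  refine Ideal.isMaximal_iff.2 ⟨h.one_notMem hr, fun J x hJ hx hxJ => ?_⟩
  obtain ⟨a, ha⟩ := h.exists_sub_mem r x
  refine one_mem_of_not_dvd h.prime (hJ (natCast_mem_rootPrime g p r)) (a := a) ?_ fun hpa => hx ?_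
  · have := sub_mem hxJ (hJ ha)
    rwa [sub_sub_cancel] at this
  · have := add_mem ha (Ideal.mem_of_dvd _ (natCast_dvd_intCast hpa)
      (natCast_mem_rootPrime g p r))
    rwa [sub_add_cancel] at this

theorem rootPrime_ne {r s : ℤ} (hs : (p : ℤ) ∣ s ^ 2 - t * s + N) (hrs : ¬ (p : ℤ) ∣ s - r) :
    ¬ rootPrime g p r ≤ rootPrime g p s := fun hle => by
  refine h.one_notMem hs (one_mem_of_not_dvd h.prime (natCast_mem_rootPrime g p s) ?_ hrs)
  have := sub_mem (hle (sub_mem_rootPrime g p r)) (sub_mem_rootPrime g p s)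
  convert this using 1
  push_cast
  ring

theorem rootPrime_mul_le {r : ℤ} (hr : (p : ℤ) ∣ r ^ 2 - t * r + N) :
    rootPrime g p r * rootPrime g p (t - r) ≤ Ideal.span {(p : A)} := by
  rw [rootPrime, rootPrime, Ideal.span_pair_mul_span_pair, Ideal.span_le]
  rintro x (rfl | rfl | rfl | rfl)
  · exact Ideal.mem_span_singleton.2 (dvd_mul_right _ _)
  · exact Ideal.mem_span_singleton.2 (dvd_mul_right _ _)
  · exact Ideal.mem_span_singleton.2 (dvd_mul_left _ _)
  · rw [h.mul_conj]
    exact Ideal.mem_span_singleton.2 ((natCast_dvd_intCast hr).neg_right)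

/-- A simple root modulo `p` gives the decomposition `p = 𝔭 𝔭'`. -/
theorem span_eq_mul {r : ℤ} (hr : (p : ℤ) ∣ r ^ 2 - t * r + N) (h2 : ¬ (p : ℤ) ∣ 2 * r - t) :
    Ideal.span {(p : A)} = rootPrime g p r * rootPrime g p (t - r) := by
  refine le_antisymm ?_ (h.rootPrime_mul_le hr)
  rw [Ideal.span_singleton_le_iff_mem]
  obtain ⟨u, v, huv⟩ := (Nat.prime_iff_prime_int.1 h.prime).coprime_iff_not_dvd.2 h2
  have huv' : (1 : A) = u * p + v * (2 * r - t) := by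
    simpa using congrArg (Int.cast : ℤ → A) huv.symm
  have h1 := Ideal.mul_mem_mul (natCast_mem_rootPrime g p r) (natCast_mem_rootPrime g p (t - r))
  have h2 := Ideal.mul_mem_mul (natCast_mem_rootPrime g p r) (sub_mem_rootPrime g p (t - r))
  have h3 := Ideal.mul_mem_mul (sub_mem_rootPrime g p r) (natCast_mem_rootPrime g p (t - r))
  have := add_mem (Ideal.mul_mem_left _ (u : A) h1) (Ideal.mul_mem_left _ (v : A) (sub_mem h2 h3))
  convert this using 1
  push_cast
  linear_combination (p : A) * huv'

/-- A double root modulo `p` which does not lift modulo `p²` gives the decomposition `p = 𝔭²`. -/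
theorem span_eq_sq {r : ℤ} (hr : (p : ℤ) ∣ r ^ 2 - t * r + N) (h2 : (p : ℤ) ∣ 2 * r - t)
    (h3 : ¬ (p : ℤ) ^ 2 ∣ r ^ 2 - t * r + N) : Ideal.span {(p : A)} = rootPrime g p r ^ 2 := by
  have hle := h.rootPrime_mul_le hr
  have hconj := rootPrime_eq_conj (g := g) h2
  rw [hconj, ← sq] at hle
  refine le_antisymm ?_ hle
  rw [Ideal.span_singleton_le_iff_mem]
  obtain ⟨c, hc⟩ := hr
  have hpc : ¬ (p : ℤ) ∣ c := fun hd => h3 (by rw [hc, sq]; exact mul_dvd_mul_left _ hd)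
  obtain ⟨u, v, huv⟩ := (Nat.prime_iff_prime_int.1 h.prime).coprime_iff_not_dvd.2 hpc
  have huv' : (1 : A) = u * p + v * c := by
    simpa using congrArg (Int.cast : ℤ → A) huv.symm
  have hc' : ((r ^ 2 - t * r + N : ℤ) : A) = p * c := by rw [hc]; push_cast; rfl
  have h1 := Ideal.mul_mem_mul (natCast_mem_rootPrime g p r) (natCast_mem_rootPrime g p r)
  have h4 := Ideal.mul_mem_mul (sub_mem_rootPrime g p r)
    (hconj ▸ sub_mem_rootPrime g p (t - r) : g - (t - r : ℤ) ∈ rootPrime g p r)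
  rw [h.mul_conj, hc'] at h4
  have := sub_mem (Ideal.mul_mem_left _ (u : A) h1) (Ideal.mul_mem_left _ (v : A) h4)
  rw [sq]
  convert this using 1
  linear_combination (p : A) * huv'

theorem span_ne_top : (1 : A) ∉ Ideal.span {(p : A)} := fun h1 => by
  have := (h.dvd 1 0 (by simpa using Ideal.mem_span_singleton.1 h1)).1
  exact h.prime.one_lt.ne' (by simpa using Int.natAbs_dvd_natAbs.2 this)

/-- The prime `p` is inert if and only if the polynomial has no root modulo `p`. -/
theorem isPrime_span_iff :
    (Ideal.span {(p : A)}).IsPrime ↔ ∀ r : ℤ, ¬ (p : ℤ) ∣ r ^ 2 - t * r + N := by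
  constructor
  · intro hP r hr
    have : (g - r) * (g - (t - r : ℤ)) ∈ Ideal.span {(p : A)} := by
      rw [h.mul_conj]
      exact Ideal.mem_span_singleton.2 ((natCast_dvd_intCast hr).neg_right)
    rcases hP.mem_or_mem this with h1 | h1
    · exact h.not_dvd_sub _ (Ideal.mem_span_singleton.1 h1)
    · exact h.not_dvd_sub _ (Ideal.mem_span_singleton.1 h1)
  · intro hno
    have hp := Nat.prime_iff_prime_int.1 h.prime
    -- the norm form has no nontrivial zero modulo `p`
    have key : ∀ a b : ℤ, (p : ℤ) ∣ a ^ 2 + t * a * b + N * b ^ 2 →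
        (p : A) ∣ (a + b * g : A) := by
      intro a b hab
      have hb : (p : ℤ) ∣ b := by
        by_contra hb
        obtain ⟨u, v, huv⟩ := hp.coprime_iff_not_dvd.2 hb
        refine hno (-(a * v)) ?_
        have : (-(a * v)) ^ 2 - t * (-(a * v)) + N = v ^ 2 * (a ^ 2 + t * a * b + N * b ^ 2)
            + p * (u * (t * a * v + N * (1 + v * b))) := by
          linear_combination (-(t * a * v) - N * (1 + v * b)) * huv
        rw [this]
        exact dvd_add (dvd_mul_of_dvd_right hab _) (dvd_mul_right _ _)
      have ha : (p : ℤ) ∣ a := by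
        refine hp.dvd_of_dvd_pow (n := 2) ?_
        obtain ⟨c, rfl⟩ := hb
        obtain ⟨e, he⟩ := hab
        exact ⟨e - t * a * c - N * c * (p * c), by linear_combination he⟩
      exact dvd_add (natCast_dvd_intCast ha) ((natCast_dvd_intCast hb).mul_right _)
    refine ⟨fun htop => h.span_ne_top (htop ▸ Submodule.mem_top), fun {x y} hxy => ?_⟩
    simp only [Ideal.mem_span_singleton] at hxy ⊢
    obtain ⟨a, b, x', rfl⟩ := h.exists_eq x
    obtain ⟨c, d, y', rfl⟩ := h.exists_eq y
    rw [dvd_add_left (dvd_mul_right _ _), dvd_add_left (dvd_mul_right _ _)]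
    have h1 : (p : A) ∣ (a + b * g) * (c + d * g) := by
      obtain ⟨e, he⟩ := hxy
      exact ⟨e - x' * (c + d * g + p * y') - y' * (a + b * g), by linear_combination he⟩
    have h2 : (p : A) ∣
        ((a * c - b * d * N : ℤ) : A) + ((a * d + b * c + t * b * d : ℤ) : A) * g := by
      convert h1 using 1
      push_cast
      linear_combination (-(b * d : A)) * h.quad
    obtain ⟨h3, h4⟩ := h.dvd _ _ h2
    -- the norm form is multiplicative
    have h5 : (p : ℤ) ∣ (a ^ 2 + t * a * b + N * b ^ 2) * (c ^ 2 + t * c * d + N * d ^ 2) := by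
      have : (a ^ 2 + t * a * b + N * b ^ 2) * (c ^ 2 + t * c * d + N * d ^ 2) =
          (a * c - b * d * N) * (a * c - b * d * N + t * (a * d + b * c + t * b * d)) +
            (a * d + b * c + t * b * d) * (N * (a * d + b * c + t * b * d)) := by ring
      rw [this]
      exact dvd_add (h3.mul_right _) (h4.mul_right _)
    exact (hp.dvd_or_dvd h5).imp (key a b) (key c d)

/-- A product of two prime ideals which equals `(p)` is not prime, by cancellation of `p`. -/
theorem not_isPrime_of_eq_mul {P Q : Ideal A} (hP : P.IsPrime) (hQ : Q.IsPrime)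
    (hPQ : Ideal.span {(p : A)} = P * Q) : ¬ (Ideal.span {(p : A)}).IsPrime := by
  intro hpr
  have aux : ∀ I J : Ideal A, J ≠ ⊤ → Ideal.span {(p : A)} = I * J →
      ¬ I ≤ Ideal.span {(p : A)} := by
    intro I J hJ hIJ hle
    have h1 : (p : A) ∈ Ideal.span {(p : A)} * J :=
      Ideal.mul_mono_left hle (hIJ ▸ Ideal.mem_span_singleton_self _)
    obtain ⟨z, hz, hpz⟩ := Ideal.mem_span_singleton_mul.1 h1
    have := h.regular (z - 1) (by rw [mul_sub, hpz, mul_one, sub_self])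
    rw [sub_eq_zero] at this
    exact hJ ((Ideal.eq_top_iff_one _).2 (this ▸ hz))
  rcases hpr.mul_le.1 hPQ.ge with h1 | h1
  · exact aux P Q hQ.ne_top hPQ h1
  · exact aux Q P hP.ne_top (hPQ.trans (mul_comm _ _)) h1

theorem exists_root_of_not_isPrime (hpr : ¬ (Ideal.span {(p : A)}).IsPrime) :
    ∃ r : ℤ, (p : ℤ) ∣ r ^ 2 - t * r + N := by
  by_contra! hno
  exact hpr (h.isPrime_span_iff.2 hno)

/-- If no double root modulo `p` lifts modulo `p²`, the ramified primes are those for which the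
polynomial has a double root. -/
theorem ramified_iff (hsq : ∀ r : ℤ, (p : ℤ) ∣ 2 * r - t → ¬ (p : ℤ) ^ 2 ∣ r ^ 2 - t * r + N) :
    (∃ P : Ideal A, P.IsPrime ∧ Ideal.span {(p : A)} = P ^ 2) ↔
      ∃ r : ℤ, (p : ℤ) ∣ r ^ 2 - t * r + N ∧ (p : ℤ) ∣ 2 * r - t := by
  constructor
  · rintro ⟨P, hP, hPp⟩
    obtain ⟨r, hr⟩ := h.exists_root_of_not_isPrime
      (h.not_isPrime_of_eq_mul hP hP (hPp.trans (sq P)))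
    refine ⟨r, hr, ?_⟩
    by_contra h2
    have hs : (p : ℤ) ∣ (t - r) ^ 2 - t * (t - r) + N := by convert hr using 1; ring
    have hspan := h.span_eq_mul hr h2
    have h1 : P ≤ rootPrime g p r := (h.isMaximal_rootPrime hr).isPrime.le_of_pow_le
      (hPp.symm.le.trans (hspan.le.trans Ideal.mul_le_left))
    have h1' : P ≤ rootPrime g p (t - r) := (h.isMaximal_rootPrime hs).isPrime.le_of_pow_le
      (hPp.symm.le.trans (hspan.le.trans Ideal.mul_le_right))
    have h3 : rootPrime g p r * rootPrime g p (t - r) ≤ P :=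
      hspan ▸ hPp ▸ Ideal.pow_le_self two_ne_zero
    rcases hP.mul_le.1 h3 with h4 | h4
    · exact h.rootPrime_ne hs (fun hd => h2 (by rwa [← dvd_neg, neg_sub, two_mul, ← sub_sub]))
        (h4.trans h1')
    · exact h.rootPrime_ne hr (fun hd => h2 (by convert hd using 1; ring)) (h4.trans h1)
  · rintro ⟨r, hr, h2⟩
    exact ⟨_, (h.isMaximal_rootPrime hr).isPrime, h.span_eq_sq hr h2 (hsq r h2)⟩

/-- The split primes are those for which the polynomial has a simple root. -/
theorem split_iff :
    (∃ P Q : Ideal A, P.IsPrime ∧ Q.IsPrime ∧ P ≠ Q ∧ Ideal.span {(p : A)} = P * Q) ↔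
      ∃ r : ℤ, (p : ℤ) ∣ r ^ 2 - t * r + N ∧ ¬ (p : ℤ) ∣ 2 * r - t := by
  constructor
  · rintro ⟨P, Q, hP, hQ, hne, hPQ⟩
    obtain ⟨r, hr⟩ := h.exists_root_of_not_isPrime (h.not_isPrime_of_eq_mul hP hQ hPQ)
    refine ⟨r, hr, fun h2 => hne ?_⟩
    have hle := h.rootPrime_mul_le hr
    rw [rootPrime_eq_conj h2, ← sq, hPQ] at hle
    have hmax := h.isMaximal_rootPrime hr
    have h3 := hP.le_of_pow_le (hle.trans Ideal.mul_le_left)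
    have h4 := hQ.le_of_pow_le (hle.trans Ideal.mul_le_right)
    rw [← hmax.eq_of_le hP.ne_top h3, ← hmax.eq_of_le hQ.ne_top h4]
  · rintro ⟨r, hr, h2⟩
    have hs : (p : ℤ) ∣ (t - r) ^ 2 - t * (t - r) + N := by convert hr using 1; ring
    refine ⟨_, _, (h.isMaximal_rootPrime hr).isPrime, (h.isMaximal_rootPrime hs).isPrime,
      fun he => ?_, h.span_eq_mul hr h2⟩
    exact h.rootPrime_ne hs (fun hd => h2 (by rwa [← dvd_neg, neg_sub, two_mul, ← sub_sub])) he.le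

end IsMonogenicAt

end Decomposition

/-! ### Decomposition of primes in the maximal order -/

section MaxOrder

theorem conductor_mul_mem {x : K D} (hx : x ∈ maxOrder D) :
    (conductor D : K D) * x ∈ quadOrder D := by
  have := AddSubgroup.nsmul_index_mem ((quadOrder D).toAddSubgroup.addSubgroupOf
    (maxOrder D).toSubring.toAddSubgroup) ⟨x, hx⟩
  rw [AddSubgroup.mem_addSubgroupOf] at this
  rw [← nsmul_eq_mul]
  exact this

/-- At a prime not dividing the conductor, the index of `𝓞_D` in the maximal order is invertible. -/
theorem mem_quadOrder_of_coprime {p : ℕ} (hp : p.Coprime (conductor D)) {x : K D}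
    (hx : x ∈ maxOrder D) (hpx : (p : K D) * x ∈ quadOrder D) : x ∈ quadOrder D := by
  obtain ⟨u, v, huv⟩ := Nat.isCoprime_iff_coprime.2 hp
  have h1 : (1 : K D) = u * p + v * conductor D := by
    simpa using congrArg (Int.cast : ℤ → K D) huv.symm
  have h2 : x = u * (p * x) + v * (conductor D * x) := by linear_combination x * h1
  rw [h2]
  exact (quadOrder D).add_mem ((quadOrder D).mul_mem (intCast_mem _ _) hpx)
    ((quadOrder D).mul_mem (intCast_mem _ _) (conductor_mul_mem hx))

theorem isIntegral_of_eq {x : K D} (t m : ℤ) (h : x * x = t * x - m) : x ∈ maxOrder D := by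
  refine ⟨Polynomial.X ^ 2 - Polynomial.C t * Polynomial.X + Polynomial.C m, ?_, ?_⟩
  · monicity!
  · simp only [Polynomial.eval₂_add, Polynomial.eval₂_sub, Polynomial.eval₂_mul,
      Polynomial.eval₂_pow, Polynomial.eval₂_X, Polynomial.eval₂_C]
    rw [sq, h, eq_intCast, eq_intCast]
    ring

variable [IsNonsquareDisc D]

theorem quadOrder_le_maxOrder {x : K D} (hx : x ∈ quadOrder D) : x ∈ maxOrder D := by
  have : quadOrder D ≤ (maxOrder D).toSubring := by
    rw [quadOrder, Subring.closure_le]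
    rintro _ rfl
    exact isIntegral_of_eq D (gamNorm D) (by rw [gam_mul_gam]; push_cast; ring)
  exact this hx

/-- The generator `γ` as an element of the maximal order. -/
def maxGen (D : ℕ) [IsNonsquareDisc D] : maxOrder D := ⟨gam D, quadOrder_le_maxOrder (gam_mem D)⟩

theorem natCast_mul_eq_zero {p : ℕ} (hp : p ≠ 0) {y : K D} (h : (p : K D) * y = 0) : y = 0 := by
  refine (mul_eq_zero.1 h).resolve_left fun h0 => hp ?_
  have := congrArg QuadraticAlgebra.re h0
  simpa using this

/-- At a prime not dividing the conductor, the maximal order is generated by `γ` up to an index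
prime to `p`. -/
theorem isMonogenicAt_maxGen {p : ℕ} (hp : p.Prime) (hpc : p.Coprime (conductor D)) :
    IsMonogenicAt (maxGen D) D (gamNorm D) p where
  prime := hp
  quad := Subtype.ext (by
    change gam D * gam D = _
    rw [gam_mul_gam]
    push_cast
    rfl)
  exists_eq x := by
    obtain ⟨u, v, huv⟩ := Nat.isCoprime_iff_coprime.2 hpc
    have h1 : (1 : K D) = u * p + v * conductor D := by
      simpa using congrArg (Int.cast : ℤ → K D) huv.symm
    obtain ⟨a, b, hab⟩ := exists_eq_add_mul_gen
      (⟨_, conductor_mul_mem x.2⟩ : quadOrder D)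
    have hab' : (conductor D : K D) * x = a + b * gam D := congrArg Subtype.val hab
    refine ⟨v * a, v * b, u * x, Subtype.ext ?_⟩
    change (x : K D) = ((v * a : ℤ) : K D) + ((v * b : ℤ) : K D) * gam D + p * (u * x)
    push_cast
    linear_combination (x : K D) * h1 + v * hab'
  dvd a b := by
    rintro ⟨y, hy⟩
    have hy' : (a : K D) + b * gam D = p * (y : K D) := congrArg Subtype.val hy
    have hmem : (y : K D) ∈ quadOrder D := by
      refine mem_quadOrder_of_coprime hpc y.2 ?_
      rw [← hy']
      exact (quadOrder D).add_mem (intCast_mem _ _)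
        ((quadOrder D).mul_mem (intCast_mem _ _) (gam_mem D))
    obtain ⟨c, d, hcd⟩ := exists_eq_add_mul_gen (⟨_, hmem⟩ : quadOrder D)
    have h1 : (a + b * gen D : quadOrder D) = (p * c : ℤ) + (p * d : ℤ) * gen D := by
      apply Subtype.ext
      have hcd' : (y : K D) = c + d * gam D := congrArg Subtype.val hcd
      change (a : K D) + b * gam D = ((p * c : ℤ) : K D) + ((p * d : ℤ) : K D) * gam D
      rw [hy', hcd']
      push_cast
      ring
    obtain ⟨rfl, rfl⟩ := add_mul_gen_inj h1
    exact ⟨dvd_mul_right _ _, dvd_mul_right _ _⟩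
  regular y hy := Subtype.ext (natCast_mul_eq_zero hp.ne_zero (congrArg Subtype.val hy))

/-- If `r` were a double root modulo `p` that is a root modulo `p²`, then `(γ - r) / p` would be
integral, so that `p` divides the conductor. -/
theorem not_sq_dvd_of_dvd {p : ℕ} (hp : p.Prime) (hpc : p.Coprime (conductor D)) (r : ℤ)
    (h2 : (p : ℤ) ∣ 2 * r - D) : ¬ (p : ℤ) ^ 2 ∣ r ^ 2 - D * r + gamNorm D := by
  rintro ⟨m, hm⟩
  obtain ⟨t, ht⟩ := h2
  have hinv : ((1 / p : ℚ) : K D) * (p : K D) = 1 := by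
    have hp0 : (p : ℚ) ≠ 0 := by exact_mod_cast hp.ne_zero
    ext <;> simp [hp0, QuadraticAlgebra.re_one, QuadraticAlgebra.im_one]
  set x : K D := ((1 / p : ℚ) : K D) * (gam D - r) with hx
  have hpx : (p : K D) * x = gam D - r := by
    rw [hx]
    linear_combination (gam D - r) * hinv
  have hm' : (r ^ 2 - D * r + gamNorm D : K D) = p ^ 2 * m := by
    exact_mod_cast congrArg (Int.cast : ℤ → K D) hm
  have ht' : (2 * r - D : K D) = p * t := by
    exact_mod_cast congrArg (Int.cast : ℤ → K D) ht
  have hint : x ∈ maxOrder D := by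
    refine isIntegral_of_eq (-t) m ?_
    refine sub_eq_zero.1 (natCast_mul_eq_zero hp.ne_zero (natCast_mul_eq_zero hp.ne_zero ?_))
    push_cast
    have h3 := gam_mul_gam D
    linear_combination (p * x + (gam D - r)) * hpx + h3 - hm' - (gam D - r) * ht'
      + (p : K D) * t * hpx
  have hmem := mem_quadOrder_of_coprime hpc hint (by
    rw [hpx]
    exact (quadOrder D).sub_mem (gam_mem D) (intCast_mem _ _))
  have hd := ((isMonogenicAt_maxGen hp hpc).not_dvd_sub r)
  exact hd ⟨⟨x, hint⟩, Subtype.ext hpx.symm⟩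

theorem isInert_iff {p : ℕ} (hp : p.Prime) (hpc : p.Coprime (conductor D)) :
    IsInert D p ↔ ∀ r : ℤ, ¬ (p : ℤ) ∣ minPoly D ℤ r :=
  (isMonogenicAt_maxGen hp hpc).isPrime_span_iff

theorem isRamified_iff {p : ℕ} (hp : p.Prime) (hpc : p.Coprime (conductor D)) :
    IsRamified D p ↔ ∃ r : ℤ, (p : ℤ) ∣ minPoly D ℤ r ∧ (p : ℤ) ∣ 2 * r - D :=
  (isMonogenicAt_maxGen hp hpc).ramified_iff (not_sq_dvd_of_dvd hp hpc)

theorem isSplit_iff {p : ℕ} (hp : p.Prime) (hpc : p.Coprime (conductor D)) :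
    IsSplit D p ↔ ∃ r : ℤ, (p : ℤ) ∣ minPoly D ℤ r ∧ ¬ (p : ℤ) ∣ 2 * r - D :=
  (isMonogenicAt_maxGen hp hpc).split_iff

end MaxOrder

/-! ### The number of roots modulo `n` -/

/-- The number of roots modulo `n` of the minimal polynomial of `γ`. -/
def numRoots (D n : ℕ) : ℕ := {r : ZMod n | minPoly D (ZMod n) r = 0}.ncard

theorem map_minPoly {R S : Type} [CommRing R] [CommRing S] (φ : R →+* S) (r : R) :
    φ (minPoly D R r) = minPoly D S (φ r) := by
  simp [minPoly]

/-- The Chinese remainder theorem for the roots. -/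
theorem numRoots_mul {a b : ℕ} (hab : a.Coprime b) :
    numRoots D (a * b) = numRoots D a * numRoots D b := by
  rw [numRoots, numRoots, numRoots, ← Set.ncard_prod]
  let e := ZMod.chineseRemainder hab
  have h : ∀ r, minPoly D (ZMod (a * b)) r = 0 ↔
      minPoly D (ZMod a) (e r).1 = 0 ∧ minPoly D (ZMod b) (e r).2 = 0 := fun r => by
    rw [← e.map_eq_zero_iff, Prod.ext_iff]
    exact and_congr
      (iff_of_eq (congrArg (· = 0)
        (map_minPoly ((RingHom.fst _ _).comp (e : ZMod (a * b) →+* ZMod a × ZMod b)) r)))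
      (iff_of_eq (congrArg (· = 0)
        (map_minPoly ((RingHom.snd _ _).comp (e : ZMod (a * b) →+* ZMod a × ZMod b)) r)))
  refine Set.ncard_congr (fun r _ => e r) (fun r hr => (h r).1 hr)
    (fun r s _ _ hrs => e.injective hrs) fun x hx => ?_
  obtain ⟨r, rfl⟩ := e.surjective x
  exact ⟨r, (h r).2 hx, rfl⟩

theorem minPoly_sub_minPoly (r s : ℤ) :
    minPoly D ℤ s - minPoly D ℤ r = (s - r) * (s + r - D) := by
  simp only [minPoly]
  ring

theorem numRoots_eq_zero {n m : ℕ} (hmn : m ∣ n) (h : ∀ r : ℤ, ¬ (m : ℤ) ∣ minPoly D ℤ r) :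
    numRoots D n = 0 := by
  have : {r : ZMod n | minPoly D (ZMod n) r = 0} = ∅ := by
    refine Set.eq_empty_of_forall_notMem fun r hr => ?_
    obtain ⟨r, rfl⟩ := ZMod.intCast_surjective r
    exact h r ((Int.natCast_dvd_natCast.2 hmn).trans ((minPoly_intCast n r).1 hr))
  rw [numRoots, this, Set.ncard_empty]

section PrimePower

variable {p : ℕ}

/-- Hensel's lemma for a simple root. -/
theorem exists_root_pow (hp : p.Prime) {r : ℤ} (hr : (p : ℤ) ∣ minPoly D ℤ r)
    (h2 : ¬ (p : ℤ) ∣ 2 * r - D) (k : ℕ) :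
    ∃ s : ℤ, (p : ℤ) ^ (k + 1) ∣ minPoly D ℤ s ∧ ¬ (p : ℤ) ∣ 2 * s - D := by
  induction k with
  | zero => exact ⟨r, by simpa using hr, h2⟩
  | succ k ih =>
    obtain ⟨s, ⟨c, hc⟩, hs⟩ := ih
    obtain ⟨u, v, huv⟩ := int_isCoprime_of_prime hp hs
    refine ⟨s - p ^ (k + 1) * (u * c), ⟨c * v + p ^ k * (u * c) ^ 2, ?_⟩, fun hd => hs ?_⟩
    · have h3 : minPoly D ℤ (s - p ^ (k + 1) * (u * c)) = minPoly D ℤ s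
          - p ^ (k + 1) * (u * c) * (2 * s - D) + (p ^ (k + 1) * (u * c)) ^ 2 := by
        simp only [minPoly]
        ring
      rw [h3, hc]
      linear_combination (p : ℤ) ^ (k + 1) * c * (-huv)
    · have h4 : (p : ℤ) ∣ 2 * (p ^ (k + 1) * (u * c)) :=
        ((dvd_pow_self (p : ℤ) k.succ_ne_zero).mul_right _).mul_left _
      have := dvd_add hd h4
      rwa [show 2 * (s - p ^ (k + 1) * (u * c)) - D + 2 * (p ^ (k + 1) * (u * c)) = 2 * s - D by
        ring] at this

/-- For a simple root modulo `p`, the roots modulo `p ^ k` are a lift `s` of it and its conjugate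
`D - s`. -/
theorem numRoots_of_simple (hp : p.Prime) {r : ℤ} (hr : (p : ℤ) ∣ minPoly D ℤ r)
    (h2 : ¬ (p : ℤ) ∣ 2 * r - D) {k : ℕ} (hk : 0 < k) : numRoots D (p ^ k) = 2 := by
  obtain ⟨k, rfl⟩ := Nat.exists_eq_add_one.2 hk
  obtain ⟨s, hs, h3⟩ := exists_root_pow hp hr h2 k
  have hdvd : ∀ x : ℤ, (x : ZMod (p ^ (k + 1))) = 0 ↔ (p : ℤ) ^ (k + 1) ∣ x := fun x => by
    rw [ZMod.intCast_zmod_eq_zero_iff_dvd]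
    push_cast
    rfl
  have hroot : ∀ x : ℤ, minPoly D (ZMod (p ^ (k + 1))) x = 0 ↔
      (p : ℤ) ^ (k + 1) ∣ (x - s) * (x + s - D) := fun x => by
    rw [minPoly_intCast, ← minPoly_sub_minPoly, dvd_sub_left hs]
    push_cast
    rfl
  have : {r : ZMod (p ^ (k + 1)) | minPoly D (ZMod (p ^ (k + 1))) r = 0} =
      {(s : ZMod (p ^ (k + 1))), ((D - s : ℤ) : ZMod (p ^ (k + 1)))} := by
    ext x
    obtain ⟨x, rfl⟩ := ZMod.intCast_surjective x
    simp only [Set.mem_ofPred_eq, Set.mem_insert_iff, Set.mem_singleton_iff]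
    rw [hroot, ← sub_eq_zero, ← sub_eq_zero (b := ((D - s : ℤ) : ZMod (p ^ (k + 1)))),
      ← Int.cast_sub, ← Int.cast_sub, hdvd, hdvd, show x - (D - s) = x + s - D by ring]
    constructor
    · intro h
      by_cases hx : (p : ℤ) ∣ x - s
      · left
        have hx' : ¬ (p : ℤ) ∣ x + s - D := fun h' => h3 (by
          have := dvd_sub h' hx
          rwa [show x + s - D - (x - s) = 2 * s - D by ring] at this)
        exact (int_isCoprime_of_prime hp hx').symm.pow_left.dvd_of_dvd_mul_right h
      · exact .inr ((int_isCoprime_of_prime hp hx).symm.pow_left.dvd_of_dvd_mul_left h)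
    · rintro (h | h)
      · exact h.mul_right _
      · exact h.mul_left _
  rw [numRoots, this, Set.ncard_pair]
  rw [Ne, ← sub_eq_zero, ← Int.cast_sub, hdvd, show s - (D - s) = 2 * s - D by ring]
  exact fun h => h3 ((dvd_pow_self (p : ℤ) k.succ_ne_zero).trans h)

theorem numRoots_of_double (hp : p.Prime) {r : ℤ} (hr : (p : ℤ) ∣ minPoly D ℤ r)
    (h2 : (p : ℤ) ∣ 2 * r - D) : numRoots D p = 1 := by
  have : {r : ZMod p | minPoly D (ZMod p) r = 0} = {(r : ZMod p)} := by
    ext x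
    obtain ⟨x, rfl⟩ := ZMod.intCast_surjective x
    simp only [Set.mem_ofPred_eq, Set.mem_singleton_iff]
    rw [minPoly_intCast, ← sub_eq_zero (b := (r : ZMod p)), ← Int.cast_sub,
      ZMod.intCast_zmod_eq_zero_iff_dvd, ← dvd_sub_left hr, minPoly_sub_minPoly]
    refine ⟨fun h => ?_, fun h => h.mul_right _⟩
    rcases (Nat.prime_iff_prime_int.1 hp).dvd_or_dvd h with h | h
    · exact h
    · rwa [← dvd_sub_left h2, show x + r - D - (2 * r - D) = x - r by ring] at h
  rw [numRoots, this, Set.ncard_singleton]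

end PrimePower

/-! ### The prime factor condition and the number of roots -/

/-- If one root modulo `p` is a double root, then so is every other root. -/
theorem dvd_two_mul_sub_of_dvd {p : ℕ} (hp : p.Prime) {r s : ℤ} (hr : (p : ℤ) ∣ minPoly D ℤ r)
    (hs : (p : ℤ) ∣ minPoly D ℤ s) (h2 : (p : ℤ) ∣ 2 * r - D) : (p : ℤ) ∣ 2 * s - D := by
  have h3 : (p : ℤ) ∣ s - r := by
    have h := dvd_sub hs hr
    rw [minPoly_sub_minPoly] at h
    rcases (Nat.prime_iff_prime_int.1 hp).dvd_or_dvd h with h | h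
    · exact h
    · rwa [← dvd_sub_left h2, show s + r - D - (2 * r - D) = s - r by ring] at h
  have := dvd_add (h3.mul_left 2) h2
  rwa [show 2 * (s - r) + (2 * r - D) = 2 * s - D by ring] at this

theorem numSplit_mul {a b : ℕ} (ha : a ≠ 0) (hb : b ≠ 0) (hab : a.Coprime b) :
    numSplit D 1 (a * b) = numSplit D 1 a + numSplit D 1 b := by
  simp only [numSplit, Nat.div_one]
  have hfin : ∀ c : ℕ, c ≠ 0 → {p : ℕ | p.Prime ∧ p ∣ c ∧ IsSplit D p}.Finite := fun c hc =>
    (Set.finite_le_nat c).subset fun p hp => Nat.le_of_dvd (Nat.pos_of_ne_zero hc) hp.2.1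
  rw [← Set.ncard_union_eq ?_ (hfin a ha) (hfin b hb)]
  · congr 1
    ext p
    simp only [Set.mem_ofPred_eq, Set.mem_union]
    constructor
    · rintro ⟨hp, hd, hs⟩
      exact (hp.dvd_mul.1 hd).imp (fun h => ⟨hp, h, hs⟩) (fun h => ⟨hp, h, hs⟩)
    · rintro (⟨hp, hd, hs⟩ | ⟨hp, hd, hs⟩)
      · exact ⟨hp, hd.mul_right _, hs⟩
      · exact ⟨hp, hd.mul_left _, hs⟩
  · refine Set.disjoint_left.2 ?_
    rintro p ⟨hp, hpa, -⟩ ⟨-, hpb, -⟩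
    exact hp.one_lt.ne' (Nat.eq_one_of_dvd_coprimes hab hpa hpb)

theorem primeFactorCondition_mul {a b : ℕ} (ha : a ≠ 0) (hb : b ≠ 0) (hab : a.Coprime b) :
    PrimeFactorCondition D 1 (a * b) ↔ PrimeFactorCondition D 1 a ∧ PrimeFactorCondition D 1 b := by
  simp only [PrimeFactorCondition, Nat.div_one]
  have hfa : ∀ p : ℕ, p.Prime → p ∣ a → (a * b).factorization p = a.factorization p :=
    fun p hp hpa => Nat.factorization_eq_of_coprime_left hab (by simp [hp, hpa, ha])
  have hfb : ∀ p : ℕ, p.Prime → p ∣ b → (a * b).factorization p = b.factorization p :=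
    fun p hp hpb => Nat.factorization_eq_of_coprime_right hab (by simp [hp, hpb, hb])
  constructor
  · intro h
    refine ⟨fun p hp hpa => ?_, fun p hp hpb => ?_⟩
    · rw [← hfa p hp hpa]
      exact h p hp (hpa.mul_right _)
    · rw [← hfb p hp hpb]
      exact h p hp (hpb.mul_left _)
  · rintro ⟨h1, h2⟩ p hp hd
    rcases hp.dvd_mul.1 hd with hd | hd
    · rw [hfa p hp hd]
      exact h1 p hp hd
    · rw [hfb p hp hd]
      exact h2 p hp hd

section PrimeFactor

variable [IsNonsquareDisc D]

/-- At a prime not dividing the conductor there are no roots if `p` is inert, two if it splits, and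
if it is ramified, one modulo `p` and none modulo `p²`. -/
theorem numRoots_prime_pow {p k : ℕ} (hp : p.Prime) (hk : 0 < k) (hpc : p.Coprime (conductor D)) :
    (PrimeFactorCondition D 1 (p ^ k) → numRoots D (p ^ k) = 2 ^ numSplit D 1 (p ^ k)) ∧
      (¬ PrimeFactorCondition D 1 (p ^ k) → numRoots D (p ^ k) = 0) := by
  have hP : PrimeFactorCondition D 1 (p ^ k) ↔ ¬ IsInert D p ∧ (IsRamified D p → k = 1) := by
    simp only [PrimeFactorCondition, Nat.div_one]
    constructor
    · intro h
      have := h p hp (dvd_pow_self p hk.ne')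
      rwa [hp.factorization_pow, Finsupp.single_eq_same] at this
    · intro h q hq hqp
      obtain rfl := (Nat.prime_dvd_prime_iff_eq hq hp).1 (hq.dvd_of_dvd_pow hqp)
      rwa [hp.factorization_pow, Finsupp.single_eq_same]
  have hset : ∀ (s : Prop), (IsSplit D p ↔ s) →
      {q : ℕ | q.Prime ∧ q ∣ p ^ k / 1 ∧ IsSplit D q} = {q | q = p ∧ s} := fun s hs => by
    ext q
    simp only [Set.mem_ofPred_eq, Nat.div_one]
    constructor
    · rintro ⟨hq, hqp, hqs⟩
      obtain rfl := (Nat.prime_dvd_prime_iff_eq hq hp).1 (hq.dvd_of_dvd_pow hqp)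
      exact ⟨rfl, hs.1 hqs⟩
    · rintro ⟨rfl, h⟩
      exact ⟨hp, dvd_pow_self q hk.ne', hs.2 h⟩
  rw [hP, numSplit]
  by_cases hno : ∀ r : ℤ, ¬ (p : ℤ) ∣ minPoly D ℤ r
  · exact ⟨fun h => absurd ((isInert_iff hp hpc).2 hno) h.1,
      fun _ => numRoots_eq_zero (dvd_pow_self p hk.ne') hno⟩
  have hin : ¬ IsInert D p := fun h => hno ((isInert_iff hp hpc).1 h)
  push Not at hno
  obtain ⟨r, hr⟩ := hno
  by_cases h2 : (p : ℤ) ∣ 2 * r - D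
  · have hram : IsRamified D p := (isRamified_iff hp hpc).2 ⟨r, hr, h2⟩
    have hspl : ¬ IsSplit D p := fun h => by
      obtain ⟨s, hs, hs2⟩ := (isSplit_iff hp hpc).1 h
      exact hs2 (dvd_two_mul_sub_of_dvd hp hr hs h2)
    rw [hset False (by simpa using hspl)]
    refine ⟨fun h => ?_, fun h => ?_⟩
    · rw [h.2 hram, pow_one, numRoots_of_double hp hr h2]
      simp
    · have hk2 : 2 ≤ k := by
        by_contra hk2
        exact h ⟨hin, fun _ => by omega⟩
      refine numRoots_eq_zero (pow_dvd_pow p hk2) fun s hs => ?_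
      push_cast at hs
      exact not_sq_dvd_of_dvd hp hpc s
        (dvd_two_mul_sub_of_dvd hp hr ((dvd_pow_self _ two_ne_zero).trans hs) h2) hs
  · have hram : ¬ IsRamified D p := fun h => by
      obtain ⟨s, hs, hs2⟩ := (isRamified_iff hp hpc).1 h
      exact h2 (dvd_two_mul_sub_of_dvd hp hs hr hs2)
    have hspl : IsSplit D p := (isSplit_iff hp hpc).2 ⟨r, hr, h2⟩
    rw [hset True (by simpa using hspl)]
    refine ⟨fun _ => ?_, fun h => absurd ⟨hin, fun h' => absurd h' hram⟩ h⟩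
    rw [numRoots_of_simple hp hr h2 hk]
    simp

/-- The number of roots modulo `n` is determined by the decomposition of the primes dividing `n`. -/
theorem numRoots_eq (n : ℕ) (hn : 0 < n) (hnc : n.Coprime (conductor D)) :
    (PrimeFactorCondition D 1 n → numRoots D n = 2 ^ numSplit D 1 n) ∧
      (¬ PrimeFactorCondition D 1 n → numRoots D n = 0) := by
  induction n using Nat.recOnPosPrimePosCoprime with
  | prime_pow p k hp hk =>
    exact numRoots_prime_pow hp hk (hnc.coprime_dvd_left (dvd_pow_self p hk.ne'))
  | zero => exact absurd hn (lt_irrefl 0)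
  | one =>
    have hone : ∀ p : ℕ, p.Prime → ¬ p ∣ 1 := fun p hp h => hp.one_lt.ne' (Nat.dvd_one.1 h)
    have hP : PrimeFactorCondition D 1 1 := fun p hp h => absurd h (by simpa using hone p hp)
    have hs : {p : ℕ | p.Prime ∧ p ∣ 1 / 1 ∧ IsSplit D p} = ∅ :=
      Set.eq_empty_of_forall_notMem fun p hp => hone p hp.1 (by simpa using hp.2.1)
    have hr : {r : ZMod 1 | minPoly D (ZMod 1) r = 0} = {0} :=
      Set.ext fun r => by simp [Subsingleton.elim r 0, Subsingleton.elim (minPoly D (ZMod 1) 0) 0]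
    exact ⟨fun _ => by rw [numRoots, hr, numSplit, hs]; simp, fun h => absurd hP h⟩
  | coprime a b ha hb hab iha ihb =>
    have ha0 : 0 < a := by omega
    have hb0 : 0 < b := by omega
    obtain ⟨ha1, ha2⟩ := iha ha0 (hnc.coprime_dvd_left (dvd_mul_right a b))
    obtain ⟨hb1, hb2⟩ := ihb hb0 (hnc.coprime_dvd_left (dvd_mul_left b a))
    rw [primeFactorCondition_mul ha0.ne' hb0.ne' hab, numRoots_mul hab,
      numSplit_mul ha0.ne' hb0.ne' hab, pow_add]
    refine ⟨fun h => by rw [ha1 h.1, hb1 h.2], fun h => ?_⟩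
    by_cases h1 : PrimeFactorCondition D 1 a
    · rw [hb2 fun h2 => h ⟨h1, h2⟩, mul_zero]
    · rw [ha2 h1, zero_mul]

end PrimeFactor

/-! ### Existence and number of the ideals of type `(d₁, d₂)` -/

/-- Ideals of type `(d₁, d₂)` exist under the prime factor condition only, and then there are two
choices for each splitting prime divisor of `d₂ / d₁`. -/
theorem idealHasType_count [IsNonsquareDisc D] {d₁ d₂ : ℕ} (hd₁ : 0 < d₁) (hd₂ : 0 < d₂)
    (hdvd : d₁ ∣ d₂) (hcop : (d₂ / d₁).Coprime (conductor D)) :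
    ((∃ 𝔞 : Ideal (quadOrder D), IdealHasType 𝔞 d₁ d₂) ↔ PrimeFactorCondition D d₁ d₂) ∧
      (PrimeFactorCondition D d₁ d₂ →
        {𝔞 : Ideal (quadOrder D) | IdealHasType 𝔞 d₁ d₂}.ncard = 2 ^ numSplit D d₁ d₂) := by
  obtain ⟨n, rfl⟩ := hdvd
  have hn : 0 < n := Nat.pos_of_mul_pos_left hd₂
  have hdiv : d₁ * n / d₁ = n / 1 := by rw [Nat.mul_div_cancel_left n hd₁, Nat.div_one]
  rw [hdiv, Nat.div_one] at hcop
  have hP : PrimeFactorCondition D d₁ (d₁ * n) ↔ PrimeFactorCondition D 1 n := by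
    simp only [PrimeFactorCondition, hdiv]
  have hs : numSplit D d₁ (d₁ * n) = numSplit D 1 n := by simp only [numSplit, hdiv]
  have hcard : {𝔞 : Ideal (quadOrder D) | IdealHasType 𝔞 d₁ (d₁ * n)}.ncard = numRoots D n :=
    ncard_idealHasType hd₁ hn
  obtain ⟨h1, h2⟩ := numRoots_eq n hn hcop
  rw [hP, hs, hcard]
  refine ⟨⟨?_, fun h => ?_⟩, h1⟩
  · rintro ⟨𝔞, h𝔞⟩
    obtain ⟨r, hr, -⟩ := (idealHasType_iff hd₁ hn).1 h𝔞
    by_contra hno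
    have : NeZero n := ⟨hn.ne'⟩
    have h3 := (Set.ncard_eq_zero (Set.toFinite _)).1 (h2 hno)
    exact (h3 ▸ ((minPoly_intCast n r).2 hr :
      (r : ZMod n) ∈ {r : ZMod n | minPoly D (ZMod n) r = 0}) : (r : ZMod n) ∈ (∅ : Set _))
  · refine Set.nonempty_of_ncard_ne_zero
      (s := {𝔞 : Ideal (quadOrder D) | IdealHasType 𝔞 d₁ (d₁ * n)}) ?_
    rw [hcard, h1 h]
    positivity

end

end RealMult

theorem mainTheorem2 (D : ℕ) (hD : D % 4 = 0 ∨ D % 4 = 1) (hsq : ¬ IsSquare D)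
    (d₁ d₂ : ℕ) (hd₁ : 0 < d₁) (hd₂ : 0 < d₂) (hdvd : d₁ ∣ d₂)
    (hcop : (d₂ / d₁).Coprime (RealMult.conductor D)) :
    (Nonempty (RealMult.ModuliSpace D d₁ d₂) ↔ RealMult.PrimeFactorCondition D d₁ d₂) ∧
    (RealMult.PrimeFactorCondition D d₁ d₂ →
      -- the irreducible components are the `2 ^ s` loci `X_𝔞`, and `X` is their disjoint union
      {Z : Set (RealMult.ModuliSpace D d₁ d₂) | RealMult.IsIrredComponent Z} =
        RealMult.component d₁ d₂ ''
          {𝔞 : Ideal (RealMult.quadOrder D) | RealMult.IdealHasType 𝔞 d₁ d₂} ∧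
      {Z : Set (RealMult.ModuliSpace D d₁ d₂) | RealMult.IsIrredComponent Z}.ncard =
        2 ^ RealMult.numSplit D d₁ d₂ ∧
      (⋃ 𝔞 ∈ {𝔞 : Ideal (RealMult.quadOrder D) | RealMult.IdealHasType 𝔞 d₁ d₂},
        RealMult.component d₁ d₂ 𝔞) = Set.univ ∧
      {𝔞 : Ideal (RealMult.quadOrder D) | RealMult.IdealHasType 𝔞 d₁ d₂}.PairwiseDisjoint
        (RealMult.component d₁ d₂) ∧
      -- each `X_𝔞` is isomorphic to its Hilbert modular surface by `[z] ↦ [(A_z, H_z, ρ_z)]`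
      ∀ 𝔞 : Ideal (RealMult.quadOrder D), RealMult.IdealHasType 𝔞 d₁ d₂ →
        IsOpen (RealMult.component d₁ d₂ 𝔞) ∧
        ∃ Φ : RealMult.HilbertSurface 𝔞 ≃ₜ RealMult.component d₁ d₂ 𝔞,
          (∀ z : UpperHalfPlane × UpperHalfPlane,
            ∃ h : (RealMult.torusAt 𝔞 z).IsRM d₁ d₂,
              (Φ (RealMult.HilbertSurface.mk 𝔞 z) : RealMult.ModuliSpace D d₁ d₂) =
                RealMult.ModuliSpace.mk ⟨RealMult.torusAt 𝔞 z, h⟩) ∧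
          (∀ (S : Set (RealMult.ModuliSpace D d₁ d₂)) (f : RealMult.ModuliSpace D d₁ d₂ → ℂ),
            IsOpen S → S ⊆ RealMult.component d₁ d₂ 𝔞 →
              (RealMult.HolomorphicOn S f ↔
                RealMult.HilbertSurface.HolomorphicOn
                  {q | (Φ q : RealMult.ModuliSpace D d₁ d₂) ∈ S} (fun q => f (Φ q))))) := by
  have : RealMult.IsNonsquareDisc D := ⟨hD, hsq⟩
  obtain ⟨hiff, hcard⟩ := RealMult.idealHasType_count hd₁ hd₂ hdvd hcop
  have hmod : Nonempty (RealMult.ModuliSpace D d₁ d₂) ↔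
      ∃ 𝔞 : Ideal (RealMult.quadOrder D), RealMult.IdealHasType 𝔞 d₁ d₂ := by
    constructor
    · rintro ⟨c⟩
      obtain ⟨𝔞, h𝔞, -⟩ := RealMult.exists_mem_component hd₁ hd₂ c
      exact ⟨𝔞, h𝔞⟩
    · rintro ⟨𝔞, h𝔞⟩
      exact ⟨RealMult.classifying (RealMult.isRM_torusAt hd₁ hd₂ h𝔞)
        (UpperHalfPlane.I, UpperHalfPlane.I)⟩
  refine ⟨hmod.trans hiff, fun hP => ⟨RealMult.setOf_isIrredComponent hd₁ hd₂, ?_,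
    RealMult.iUnion_component hd₁ hd₂, RealMult.pairwiseDisjoint_component hd₁,
    fun 𝔞 h𝔞 => ⟨RealMult.isOpen_component hd₁ hd₂ h𝔞, ?_⟩⟩⟩
  · rw [RealMult.setOf_isIrredComponent hd₁ hd₂,
      (RealMult.injOn_component hd₁ hd₂).ncard_image, hcard hP]
  · have h := RealMult.isRM_torusAt hd₁ hd₂ h𝔞
    obtain ⟨Φ, hΦ⟩ := RealMult.exists_homeomorph hd₁ h𝔞 h
    refine ⟨Φ, fun z => ⟨h z, hΦ z⟩, fun S f _ hS => ?_⟩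
    rw [RealMult.holomorphicOn_iff h hd₁ h𝔞 hS f]
    refine forall_congr' fun z => ?_
    simp only [Set.mem_ofPred_eq, hΦ]
    exact imp_congr_right fun _ =>
      RealMult.analyticAt_pt_iff (fun z => f (RealMult.classifying h z)) z
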